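/- Let $n,k\ge 1$ and let $(M,HM,J)$ be a smooth abstract CR manifold of type $(n,k)$: $M$ is a smooth real manifold of dimension $2n+k$, $HM\subset TM$ is a smooth subbundle of rank $2n$, and $J:HM\to HM$ is a smooth fibre-preserving bundle isomorphism with $J^2=-I$ that is formally integrable, i.e. $[T^{0,1},T^{0,1}]\subset T^{0,1}$ where $T^{0,1}=\{X+iJX\mid X \text{ a smooth section of } HM\}$. Let $\bar\partial_M$ denote the tangential Cauchy–Riemann operator: a $(0,1)$-form is a section of the dual of the bundle $T^{0,1}$; for a smooth function $u$, $(\bar\partial_M u)(Z)=Zu$, and for a smooth $(0,1)$-form $f$, $(\bar\partial_M f)(Z,W)=Z(f(W))-W(f(Z))-f([Z,W])$, for smooth sections $Z,W$ of $T^{0,1}$. Let $p\in M$. Assume: (i) there is a covector $\xi\in T_p^*M$, $\xi\neq 0$, vanishing on $H_pM$, such that the Levi form $\mathcal L_p(\xi,X)=\xi([J\widetilde X,\widetilde X]_p)$, $X\in H_pM$ (where $\widetilde X$ is any smooth local section of $HM$ with $\widetilde X(p)=X$; the value does not depend on the choice), is positive definite, i.e. $\mathcal L_p(\xi,X)>0$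 for all $X\in H_pM\setminus\{0\}$; (ii) the Poincaré lemma for $\bar\partial_M$ on $(0,1)$-forms holds at $p$: for every open neighborhood $\Omega$ of $p$ and every smooth $(0,1)$-form $f$ on $\Omega$ with $\bar\partial_M f=0$ there exist an open neighborhood $\omega\subset\Omega$ of $p$ and a smooth function $u:\omega\to\mathbb C$ with $\bar\partial_M u=f$ on $\omega$. Then $M$ is locally CR embeddable at $p$: there exist an open neighborhood $U$ of $p$ and $n+k$ smooth functions $\varphi_1,\dots,\varphi_{n+k}:U\to\mathbb C$ with $\bar\partial_M\varphi_j=0$ on $U$ for every $j$, whose differentials $d\varphi_1,\dots,d\varphi_{n+k}$ are linearly independent over $\mathbb C$ at every point of $U$. -/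

import Mathlib

open Set
open scoped Manifold ContDiff

noncomputable section

/-- A family `X` of vectors `X q` in subspaces `H q` of the tangent spaces is smooth on `U`,
as a (real) vector field. A section over `U` of the family `H` is given by a total function,
whose values outside `U` are irrelevant. -/
def SmoothSectionOn {d : ℕ} {M : Type*} [TopologicalSpace M]
    [ChartedSpace (EuclideanSpace ℝ (Fin d)) M] [IsManifold (𝓡 d) ∞ M]
    (H : ∀ q : M, Submodule ℝ (TangentSpace (𝓡 d) q)) (X : ∀ q, H q) (U : Set M) : Prop :=
  ContMDiffOn (𝓡 d) (𝓡 d).tangent ∞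
    (fun q => (⟨q, (X q : TangentSpace (𝓡 d) q)⟩ : TangentBundle (𝓡 d) M)) U

/-- The Lie bracket `[X, Y]` at `q` of two sections of `H`, as a tangent vector. -/
def bracketAt {d : ℕ} {M : Type*} [TopologicalSpace M]
    [ChartedSpace (EuclideanSpace ℝ (Fin d)) M]
    {H : ∀ q : M, Submodule ℝ (TangentSpace (𝓡 d) q)} (X Y : ∀ q, H q) (q : M) :
    TangentSpace (𝓡 d) q :=
  VectorField.mlieBracket (𝓡 d)
    (fun q => (X q : TangentSpace (𝓡 d) q)) (fun q => (Y q : TangentSpace (𝓡 d) q)) q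

/-- The differential at `q` of a complex-valued function, an `ℝ`-linear map `T_q M → ℂ`. -/
def complexDiff {d : ℕ} {M : Type*} [TopologicalSpace M]
    [ChartedSpace (EuclideanSpace ℝ (Fin d)) M] (u : M → ℂ) (q : M) :
    TangentSpace (𝓡 d) q →L[ℝ] ℂ :=
  mfderiv (𝓡 d) 𝓘(ℝ, ℂ) u q

/-- An abstract CR structure of type `(n, k)` on a smooth manifold `M` of dimension `2n + k`:
a subbundle `HM` of `TM` of rank `2n` with a smooth, formally integrable complex structure `J`. -/
structure CRStructure (n k : ℕ) (M : Type*) [TopologicalSpace M]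
    [ChartedSpace (EuclideanSpace ℝ (Fin (2 * n + k))) M]
    [IsManifold (𝓡 (2 * n + k)) ∞ M] where
  /-- The fibre `H_q M`. -/
  H : ∀ q : M, Submodule ℝ (TangentSpace (𝓡 (2 * n + k)) q)
  /-- The fibres have dimension `2n`. -/
  finrank_H : ∀ q, Module.finrank ℝ (H q) = 2 * n
  /-- `HM` is a smooth subbundle: it has a smooth frame near every point. -/
  exists_frame : ∀ p : M, ∃ U : Set M, IsOpen U ∧ p ∈ U ∧ ∃ X : Fin (2 * n) → ∀ q, H q,
    (∀ i, SmoothSectionOn H (X i) U) ∧ ∀ q ∈ U, LinearIndependent ℝ (fun i => X i q)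
  /-- The partial complex structure. -/
  J : ∀ q, H q →ₗ[ℝ] H q
  J_sq : ∀ q (v : H q), J q (J q v) = -v
  /-- `J` maps smooth sections to smooth sections. -/
  smooth_J : ∀ (U : Set M), IsOpen U → ∀ X : (∀ q, H q), SmoothSectionOn H X U →
    SmoothSectionOn H (fun q => J q (X q)) U
  /-- Formal integrability `[T^{0,1}, T^{0,1}] ⊆ T^{0,1}`: the real and imaginary parts of
  `[X + iJX, Y + iJY] = ([X, Y] - [JX, JY]) + i ([X, JY] + [JX, Y])` are `V` and `JV`
  for a vector `V` in `H_q M`. -/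
  integrable : ∀ (U : Set M), IsOpen U → ∀ X Y : (∀ q, H q),
    SmoothSectionOn H X U → SmoothSectionOn H Y U → ∀ q ∈ U, ∃ V : H q,
      (V : TangentSpace (𝓡 (2 * n + k)) q) =
        bracketAt X Y q - bracketAt (fun q => J q (X q)) (fun q => J q (Y q)) q ∧
      (J q V : TangentSpace (𝓡 (2 * n + k)) q) =
        bracketAt X (fun q => J q (Y q)) q + bracketAt (fun q => J q (X q)) Y q

namespace CRStructure

variable {n k : ℕ} {M : Type*} [TopologicalSpace M]
  [ChartedSpace (EuclideanSpace ℝ (Fin (2 * n + k))) M] [IsManifold (𝓡 (2 * n + k)) ∞ M]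

/-- `ξ ∈ T*_p M` belongs to the characteristic bundle `H^o M`: it annihilates `H_p M`. -/
def IsCharacteristic (S : CRStructure n k M) (p : M)
    (ξ : TangentSpace (𝓡 (2 * n + k)) p →L[ℝ] ℝ) : Prop :=
  ∀ v ∈ S.H p, ξ v = 0

/-- The value `ξ([JX, X])` of the Levi form at the covector `ξ` over `p`, on the vector `X p` of
`H_p M`, computed with a section `X` of `HM` that is smooth near `p`. -/
def leviForm (S : CRStructure n k M) (p : M) (ξ : TangentSpace (𝓡 (2 * n + k)) p →L[ℝ] ℝ)
    (X : ∀ q, S.H q) : ℝ :=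
  ξ (bracketAt (fun q => S.J q (X q)) X p)

/-- The Levi form at `ξ` is positive definite: it is positive on all nonzero `v ∈ H_p M`
(with all smooth local extensions `X` of `v`; the value depends only on `v`). -/
def LeviPosDef (S : CRStructure n k M) (p : M)
    (ξ : TangentSpace (𝓡 (2 * n + k)) p →L[ℝ] ℝ) : Prop :=
  ∀ v : S.H p, v ≠ 0 → ∀ (U : Set M), IsOpen U → p ∈ U → ∀ X : (∀ q, S.H q),
    SmoothSectionOn S.H X U → X p = v → 0 < S.leviForm p ξ X

/-- The operator `∂̄_M` on functions: `(∂̄_M u)(v + iJv) = du(v) + i du(Jv)`. Fibrewise forms on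
`T^{0,1}_q = {v + iJv | v ∈ H_q M}` are written as functions of `v`. -/
def dbar (S : CRStructure n k M) (u : M → ℂ) (q : M) : S.H q →ₗ[ℝ] ℂ :=
  (complexDiff u q).toLinearMap ∘ₗ (S.H q).subtype +
    Complex.I • ((complexDiff u q).toLinearMap ∘ₗ (S.H q).subtype ∘ₗ S.J q)

/-- Smooth `(0,1)` forms on an open set `Ω`, i.e. smooth sections over `Ω` of the bundle of
complex linear forms on `T^{0,1}`. The form `α` takes the value `α q v` on `v + iJv`; since
`Jv + iJ(Jv) = -i (v + iJv)`, complex linearity on `T^{0,1}_q` means `α (Jv) = -i α(v)`. -/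
structure IsForm01On (S : CRStructure n k M) (α : ∀ q, S.H q →ₗ[ℝ] ℂ) (Ω : Set M) : Prop where
  map_J : ∀ q ∈ Ω, ∀ v : S.H q, α q (S.J q v) = -Complex.I * α q v
  smooth : ∀ U ⊆ Ω, IsOpen U → ∀ X : (∀ q, S.H q), SmoothSectionOn S.H X U →
    ContMDiffOn (𝓡 (2 * n + k)) 𝓘(ℝ, ℂ) ∞ (fun q => α q (X q)) U

/-- `∂̄_M α = 0` on the open set `Ω`, for a `(0,1)` form `α`: with `Z = X + iJX`, `W = Y + iJY`,
`(∂̄_M α)(Z, W) = Z(α(W)) - W(α(Z)) - α([Z, W])` vanishes. Here `[Z, W] = V + iJV`, with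
`V = [X, Y] - [JX, JY]`, which is in `H_q M` by integrability. -/
def DbarClosedOn (S : CRStructure n k M) (α : ∀ q, S.H q →ₗ[ℝ] ℂ) (Ω : Set M) : Prop :=
  ∀ U ⊆ Ω, IsOpen U → ∀ X Y : (∀ q, S.H q),
    SmoothSectionOn S.H X U → SmoothSectionOn S.H Y U → ∀ q ∈ U, ∀ V : S.H q,
      (V : TangentSpace (𝓡 (2 * n + k)) q) =
        bracketAt X Y q - bracketAt (fun q => S.J q (X q)) (fun q => S.J q (Y q)) q →
      S.dbar (fun q => α q (Y q)) q (X q) - S.dbar (fun q => α q (X q)) q (Y q) - α q V = 0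

/-- The Poincaré lemma for `∂̄_M` on `(0,1)` forms holds at `p`. -/
def PoincareLemmaAt (S : CRStructure n k M) (p : M) : Prop :=
  ∀ Ω : Set M, IsOpen Ω → p ∈ Ω → ∀ α : (∀ q, S.H q →ₗ[ℝ] ℂ),
    S.IsForm01On α Ω → S.DbarClosedOn α Ω →
      ∃ U : Set M, IsOpen U ∧ p ∈ U ∧ U ⊆ Ω ∧ ∃ u : M → ℂ,
        ContMDiffOn (𝓡 (2 * n + k)) 𝓘(ℝ, ℂ) ∞ u U ∧ ∀ q ∈ U, S.dbar u q = α q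

/-- `u` is a (smooth) CR function on the open set `U`. -/
def IsCRFunctionOn (S : CRStructure n k M) (u : M → ℂ) (U : Set M) : Prop :=
  ContMDiffOn (𝓡 (2 * n + k)) 𝓘(ℝ, ℂ) ∞ u U ∧ ∀ q ∈ U, S.dbar u q = 0

/-- `M` is locally CR embeddable at `p`: near `p` there are `n + k` smooth CR functions whose
differentials are linearly independent over `ℂ`. -/
def LocallyCREmbeddableAt (S : CRStructure n k M) (p : M) : Prop :=
  ∃ U : Set M, IsOpen U ∧ p ∈ U ∧ ∃ φ : Fin (n + k) → M → ℂ,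
    (∀ j, S.IsCRFunctionOn (φ j) U) ∧
    ∀ q ∈ U, LinearIndependent ℂ
      (fun j => (complexDiff (φ j) q : TangentSpace (𝓡 (2 * n + k)) q →L[ℝ] ℂ))

end CRStructure

end

/-! The covectors θ ∈ T*_pM ⊗ ℂ annihilating T^{0,1}_p form a complex space of dimension n + k. It
suffices to realise each of them as the differential at p of a CR function, since linear
independence at p persists nearby.

Flat frame. In a chart sending p to 0, T^{0,1} has a frame Z_j = X_j + iJX_j dual to n linear
functions ζ_k, that is Z_j ζ_k = δ_jk. The bracket [Z_j, Z_l] is in T^{0,1} by integrability and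
kills every ζ_k, so it vanishes. Thus ∂̄_M becomes a system of commuting operators D_j
(`FlatFrame`), and ∂̄_M-closed forms are data F_k with D_l F_k = D_k F_l.

Approximate CR functions. Truncated Taylor expansions along the Z_j produce functions g with
prescribed leading part and D_j g vanishing at 0 to any given finite order
(`FlatFrame.exists_approx`). For leading part -iξ, the real Hessian β of such a function satisfies
β(v, v) + β(Jv, Jv) = Levi form of v on H_p; a quadratic form that is CR to leading order repairs
the rest of β. This gives a phase ψ with ψ(0) = 0 and Re ψ ≥ c|x|² (`exists_phase`). If φ is
approximately CR with φ(0) = 0 and dφ(0) = θ, then g = e^{-τψ}φ still has dg(0) = θ, while any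
finite number of derivatives of D_j g is O(1/τ), once the orders of vanishing are high enough
(`exists_small`).

Uniform solvability. A Baire category argument upgrades the Poincaré lemma to solutions with a bound
(`exists_uniform_solution`). It is run on the Banach space of bounded coefficient sequences b, each
giving the closed form ∑ b_j f_j, rather than on a Fréchet space of closed forms. With f_j = (j + 1)
∂̄g_j, where g_j is chosen so that all derivatives are summable, it yields u_j with ∂̄u_j = f_j near
0 and |du_j(0)| ≤ A (`exists_bounded_solutions`). Then g_j - u_j/(j + 1) is CR near 0 with
differential within A/(j + 1) of θ. Differentials at 0 of CR germs form a subspace of a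
finite-dimensional space, which is closed, so θ itself is attained (`FlatFrame.exists_solution`). -/

open Filter Topology
open scoped BoundedContinuousFunction

/-! ### Order of vanishing at the origin -/

section VanishingOrder

universe u

variable {E F G K : Type u} [NormedAddCommGroup E] [NormedSpace ℝ E] [NormedAddCommGroup F]
  [NormedSpace ℝ F] [NormedAddCommGroup G] [NormedSpace ℝ G] [NormedAddCommGroup K]
  [NormedSpace ℝ K]

theorem contDiff_bilin (B : F →L[ℝ] G →L[ℝ] K) {f : E → F} {g : E → G}
    (hf : ContDiff ℝ ∞ f) (hg : ContDiff ℝ ∞ g) : ContDiff ℝ ∞ (fun x => B (f x) (g x)) :=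
  (B.contDiff.comp hf).clm_apply hg

/-- All derivatives of `u` of order less than `m` vanish at the origin. -/
def VanishOrd (m : ℕ) (u : E → F) : Prop := ∀ k < m, iteratedFDeriv ℝ k u 0 = 0

namespace VanishOrd

theorem zero (u : E → F) : VanishOrd 0 u := fun _ h => absurd h (Nat.not_lt_zero _)

theorem mono {a b : ℕ} {u : E → F} (hu : VanishOrd b u) (h : a ≤ b) : VanishOrd a u :=
  fun k hk => hu k (hk.trans_le h)

theorem congr {m : ℕ} {u v : E → F} (hu : VanishOrd m u) (h : u =ᶠ[𝓝 0] v) : VanishOrd m v :=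
  fun k hk => by rw [← (h.iteratedFDeriv ℝ k).eq_of_nhds]; exact hu k hk

theorem of_eventually_zero {u : E → F} (h : ∀ᶠ x in 𝓝 0, u x = 0) (m : ℕ) : VanishOrd m u := by
  have h0 : VanishOrd m (fun _ : E => (0 : F)) := fun k _ => by
    simp
  exact h0.congr (h.mono fun x hx => hx.symm)

theorem apply_zero {m : ℕ} {u : E → F} (hu : VanishOrd (m + 1) u) : u 0 = 0 := by
  have := hu 0 (Nat.succ_pos _)
  rw [← norm_eq_zero, norm_iteratedFDeriv_zero] at this
  exact norm_eq_zero.1 this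

theorem fderiv {m : ℕ} {u : E → F} (hu : VanishOrd (m + 1) u) : VanishOrd m (fderiv ℝ u) := by
  intro k hk
  rw [← norm_eq_zero, norm_iteratedFDeriv_fderiv, hu (k + 1) (by omega), norm_zero]

theorem of_fderiv {m : ℕ} {u : E → F} (h0 : u 0 = 0) (hu : VanishOrd m (_root_.fderiv ℝ u)) :
    VanishOrd (m + 1) u := by
  intro k hk
  rw [← norm_eq_zero]
  cases k with
  | zero => rw [norm_iteratedFDeriv_zero, h0, norm_zero]
  | succ k => rw [← norm_iteratedFDeriv_fderiv, hu k (by omega), norm_zero]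

theorem one {u : E → F} (h0 : u 0 = 0) : VanishOrd 1 u := of_fderiv h0 (zero _)

/-- In every term of the Leibniz estimate, at least one factor is differentiated fewer times than
its order of vanishing. -/
theorem bilin {a b : ℕ} (B : F →L[ℝ] G →L[ℝ] K) {f : E → F} {g : E → G}
    (hf : ContDiff ℝ ∞ f) (hg : ContDiff ℝ ∞ g) (ha : VanishOrd a f) (hb : VanishOrd b g) :
    VanishOrd (a + b) (fun x => B (f x) (g x)) := by
  intro k hk
  have := B.norm_iteratedFDeriv_le_of_bilinear hf hg (0 : E) (n := k) (by exact_mod_cast le_top)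
  rw [← norm_le_zero_iff]
  refine this.trans (le_of_eq ?_)
  rw [Finset.sum_eq_zero, mul_zero]
  intro i hi
  have := Finset.mem_range.1 hi
  by_cases hia : i < a
  · rw [ha i hia]; simp
  · rw [hb (k - i) (by omega)]; simp

theorem add {m : ℕ} {u v : E → F} (hu' : ContDiff ℝ ∞ u) (hv' : ContDiff ℝ ∞ v)
    (hu : VanishOrd m u) (hv : VanishOrd m v) : VanishOrd m (u + v) := by
  intro k hk
  rw [iteratedFDeriv_add_apply (hu'.of_le (by exact_mod_cast le_top)).contDiffAt
    (hv'.of_le (by exact_mod_cast le_top)).contDiffAt, hu k hk, hv k hk, add_zero]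

theorem clm {m : ℕ} (L : F →L[ℝ] G) {u : E → F} (hu' : ContDiff ℝ ∞ u) (hu : VanishOrd m u) :
    VanishOrd m (fun x => L (u x)) := by
  intro k hk
  have := L.iteratedFDeriv_comp_left (hu'.contDiffAt (x := 0)) (i := k) (by exact_mod_cast le_top)
  rw [show (fun x => L (u x)) = L ∘ u from rfl, this, hu k hk]
  ext; simp

variable [FiniteDimensional ℝ E]

/-- The mean value inequality on the ball of radius ‖x‖ passes a bound of order m for the derivative
to one of order m + 1 for the function. -/
theorem bound {m : ℕ} {u : E → F} (hu' : ContDiff ℝ ∞ u) (hu : VanishOrd m u) (R : ℝ) :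
    ∃ C, 0 ≤ C ∧ ∀ x, ‖x‖ ≤ R → ‖u x‖ ≤ C * ‖x‖ ^ m := by
  induction m generalizing F with
  | zero =>
    obtain ⟨C, hC⟩ := (isCompact_closedBall (0 : E) R).exists_bound_of_continuousOn
      hu'.continuous.continuousOn
    refine ⟨max C 0, le_max_right _ _, fun x hx => ?_⟩
    simpa using Or.inl (hC x (by simpa using hx))
  | succ m ih =>
    obtain ⟨C, hC0, hC⟩ := ih (hu'.fderiv_right (m := ∞) (by simp)) hu.fderiv
    refine ⟨C, hC0, fun x hx => ?_⟩
    have := (convex_closedBall (0 : E) ‖x‖).norm_image_sub_le_of_norm_fderiv_le (𝕜 := ℝ) (f := u)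
      (C := C * ‖x‖ ^ m) (fun y _ => (hu'.differentiable (by simp)).differentiableAt)
      (fun y hy => ?_) (x := 0) (y := x) (by simp) (by simp)
    · simpa [hu.apply_zero, pow_succ, mul_assoc] using this
    · have hy' : ‖y‖ ≤ ‖x‖ := by simpa using hy
      exact (hC y (hy'.trans hx)).trans (by gcongr)

theorem bound_of_hasCompactSupport {m : ℕ} {u : E → F} (hu' : ContDiff ℝ ∞ u)
    (hs : HasCompactSupport u) (hu : VanishOrd m u) :
    ∃ C, 0 ≤ C ∧ ∀ x, ‖u x‖ ≤ C * ‖x‖ ^ m := by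
  obtain ⟨R, hR⟩ := hs.isBounded.exists_norm_le
  obtain ⟨C, hC0, hC⟩ := hu.bound hu' R
  refine ⟨C, hC0, fun x => ?_⟩
  by_cases hx : x ∈ tsupport u
  · exact hC x (hR x hx)
  · rw [image_eq_zero_of_notMem_tsupport hx, norm_zero]; positivity

end VanishOrd

end VanishingOrder

/-! ### Decay of oscillating exponentials times flat functions -/

section Decay

variable {E : Type} [NormedAddCommGroup E] [NormedSpace ℝ E] [FiniteDimensional ℝ E]

/-- This is t^K / K! ≤ e^t at t = τcy. -/
theorem exp_mul_pow_le {τ c y : ℝ} (hτ : 1 ≤ τ) (hc : 0 < c) (hy : 0 ≤ y) (K : ℕ) :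
    Real.exp (-(τ * (c * y))) * y ^ K ≤ (K.factorial / c ^ K) / τ ^ K := by
  have h := Real.pow_div_factorial_le_exp (x := τ * (c * y)) (by positivity) K
  rw [Real.exp_neg, inv_mul_le_iff₀ (Real.exp_pos _)]
  refine le_trans (le_of_eq ?_) (mul_le_mul_of_nonneg_right h (by positivity))
  have : (K.factorial : ℝ) ≠ 0 := by positivity
  have hτ0 : τ ≠ 0 := by positivity
  rw [mul_pow, mul_pow]
  field_simp

/-- The Gaussian factor turns two orders of vanishing into one power of 1/τ, and each derivative
costs at most one factor τ or one order of vanishing. The codomain is generalised in the induction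
because the derivative of `h` has values in linear maps. -/
theorem decay_exp_smul {ψ : E → ℂ} (hψ : ContDiff ℝ ∞ ψ) {c : ℝ} (hc : 0 < c)
    (hre : ∀ x, c * ‖x‖ ^ 2 ≤ (ψ x).re) (K m : ℕ) {F : Type} [NormedAddCommGroup F]
    [NormedSpace ℂ F] {h : E → F} (hh : ContDiff ℝ ∞ h) (hs : HasCompactSupport h)
    (hv : VanishOrd (m + 2 * K) h) :
    ∃ C, 0 ≤ C ∧ ∀ τ : ℝ, 1 ≤ τ → ∀ x,
      ‖iteratedFDeriv ℝ m (fun x => Complex.exp (-(τ * ψ x)) • h x) x‖ ≤ C * (τ ^ m / τ ^ K) := by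
  induction m generalizing F with
  | zero =>
    obtain ⟨C, hC0, hC⟩ := hv.bound_of_hasCompactSupport hh hs
    refine ⟨C * (K.factorial / c ^ K), by positivity, fun τ hτ x => ?_⟩
    have hτ0 : 0 < τ := by linarith
    rw [norm_iteratedFDeriv_zero, norm_smul, Complex.norm_exp]
    have h1 : (-((τ : ℂ) * ψ x)).re ≤ -(τ * (c * ‖x‖ ^ 2)) := by
      simp only [Complex.neg_re, Complex.mul_re, Complex.ofReal_re, Complex.ofReal_im, zero_mul,
        sub_zero]
      exact neg_le_neg (mul_le_mul_of_nonneg_left (hre x) hτ0.le)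
    have h2 := exp_mul_pow_le hτ hc (sq_nonneg ‖x‖) K
    calc Real.exp (-((τ : ℂ) * ψ x)).re * ‖h x‖
        ≤ Real.exp (-(τ * (c * ‖x‖ ^ 2))) * (C * ‖x‖ ^ (0 + 2 * K)) := by
          gcongr
          exact hC x
      _ = C * (Real.exp (-(τ * (c * ‖x‖ ^ 2))) * (‖x‖ ^ 2) ^ K) := by
          rw [zero_add, pow_mul]; ring
      _ ≤ C * ((K.factorial / c ^ K) / τ ^ K) := by gcongr
      _ = _ := by ring
  | succ m ih =>
    have hdψ : ContDiff ℝ ∞ (fderiv ℝ ψ) := hψ.fderiv_right (by simp)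
    have hdh : ContDiff ℝ ∞ (fderiv ℝ h) := hh.fderiv_right (by simp)
    let B : F →L[ℝ] (E →L[ℝ] ℂ) →L[ℝ] E →L[ℝ] F :=
      (ContinuousLinearMap.compL ℝ E ℂ F).comp (ContinuousLinearMap.lsmul ℝ ℂ).flip
    have hBa : ∀ f φ v, B f φ v = φ v • f := fun f φ v => rfl
    have hBh : ContDiff ℝ ∞ (fun x => B (h x) (fderiv ℝ ψ x)) :=
      contDiff_bilin B hh hdψ
    obtain ⟨C₁, hC₁0, hC₁⟩ := ih hdh (hs.fderiv ℝ)
      ((hv.mono (b := m + 1 + 2 * K) (a := m + 2 * K + 1) (by omega)).fderiv)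
    obtain ⟨C₂, hC₂0, hC₂⟩ := ih (h := fun x => B (h x) (fderiv ℝ ψ x)) hBh
      (hs.mono' fun x hx => subset_tsupport _ fun h0 => hx (by simp [h0]))
      ((VanishOrd.bilin B hh hdψ hv (VanishOrd.zero _)).mono (by omega))
    refine ⟨C₁ + C₂, by positivity, fun τ hτ x => ?_⟩
    have hτ0 : 0 < τ := by linarith
    have hψd : ∀ x, HasFDerivAt ψ (fderiv ℝ ψ x) x := fun x =>
      (hψ.differentiable (by simp)).differentiableAt.hasFDerivAt
    have hhd : ∀ x, HasFDerivAt h (fderiv ℝ h x) x := fun x =>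
      (hh.differentiable (by simp)).differentiableAt.hasFDerivAt
    -- d(e^{-τψ}h) = e^{-τψ}(dh - τ h dψ). The first term loses an order of vanishing, the second
    -- gains a factor τ; both are of the type handled by the induction hypothesis.
    have hD : fderiv ℝ (fun x => Complex.exp (-(τ * ψ x)) • h x) =
        (fun x => Complex.exp (-(τ * ψ x)) • fderiv ℝ h x) +
        (-τ) • fun x => Complex.exp (-(τ * ψ x)) • B (h x) (fderiv ℝ ψ x) := by
      funext x
      have h1 : HasFDerivAt (fun x => Complex.exp (-(τ * ψ x)) • h x) _ x :=
        (((hψd x).const_mul (τ : ℂ)).neg.cexp).smul (hhd x)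
      rw [h1.fderiv]
      ext v
      simp only [add_apply, smul_apply, ContinuousLinearMap.smulRight_apply, Pi.add_apply,
        Pi.smul_apply, Pi.neg_apply, neg_apply, hBa, ← Complex.coe_smul, smul_eq_mul,
        Complex.ofReal_neg]
      module
    have hexp : ContDiff ℝ ∞ (fun x => Complex.exp (-(τ * ψ x))) :=
      (contDiff_const.mul hψ).neg.cexp
    have hs1 : ContDiff ℝ m (fun x => Complex.exp (-(τ * ψ x)) • fderiv ℝ h x) :=
      (hexp.smul hdh).of_le (by exact_mod_cast le_top)
    have hs2 : ContDiff ℝ m (fun x => Complex.exp (-(τ * ψ x)) • B (h x) (fderiv ℝ ψ x)) :=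
      (hexp.smul hBh).of_le (by exact_mod_cast le_top)
    have hs3 : ContDiff ℝ m ((-τ) • fun x => Complex.exp (-(τ * ψ x)) • B (h x) (fderiv ℝ ψ x)) :=
      hs2.const_smul (-τ)
    rw [← norm_iteratedFDeriv_fderiv, hD, iteratedFDeriv_add_apply hs1.contDiffAt
      hs3.contDiffAt, iteratedFDeriv_const_smul_apply hs2.contDiffAt]
    refine (norm_add_le _ _).trans ?_
    rw [norm_smul, Real.norm_eq_abs, abs_neg, abs_of_pos hτ0]
    have e1 : C₁ * (τ ^ m / τ ^ K) ≤ C₁ * (τ ^ (m + 1) / τ ^ K) := by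
      gcongr
      omega
    have e2 : τ * (C₂ * (τ ^ m / τ ^ K)) = C₂ * (τ ^ (m + 1) / τ ^ K) := by
      rw [pow_succ]; ring
    have := mul_le_mul_of_nonneg_left (hC₂ τ hτ x) hτ0.le
    have := hC₁ τ hτ x
    linarith

end Decay

/-! ### Formal solutions for commuting derivations of a filtered algebra -/

section FilteredDerivations

variable {A ι : Type*} [CommRing A] [Algebra ℂ A] {F : ℕ → Submodule ℂ A}
  {D : ι → Derivation ℂ A A} {ζ : ι → A}

/-- `∑_{a ≤ N} (-ζ)ᵃ/a! Dᵃ u`, the truncated flow of `u` along `D` back to `ζ = 0`. -/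
noncomputable def truncFlow (D : Derivation ℂ A A) (ζ : A) (N : ℕ) (u : A) : A :=
  ∑ a ∈ Finset.range (N + 1), ((-1 : ℂ) ^ a / a.factorial) • (ζ ^ a * D^[a] u)

/-- A decreasing multiplicative filtration `F` of the algebra `A`, of which the derivations `D i`
lower the degree by at most one, and functions `ζ j` in `F 1` dual to the `D i`, which commute,
up to elements of arbitrarily high degree. -/
structure DualFiltration (F : ℕ → Submodule ℂ A) (D : ι → Derivation ℂ A A) (ζ : ι → A) :
    Prop where
  top : ∀ u, u ∈ F 0
  anti : ∀ {a b}, a ≤ b → F b ≤ F a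
  mul : ∀ {a b u v}, u ∈ F a → v ∈ F b → u * v ∈ F (a + b)
  deriv : ∀ i {a u}, u ∈ F (a + 1) → D i u ∈ F a
  coord : ∀ i, ζ i ∈ F 1
  self : ∀ i N, D i (ζ i) - 1 ∈ F N
  ne : ∀ i j N, i ≠ j → D i (ζ j) ∈ F N
  comm : ∀ i j u N, D i (D j u) - D j (D i u) ∈ F N

namespace DualFiltration

variable (h : DualFiltration F D ζ)
include h

theorem mul_left {a : ℕ} (u : A) {v : A} (hv : v ∈ F a) : u * v ∈ F a := by
  simpa using h.mul (h.top u) hv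

theorem iterate_mem (i : ι) {k : ℕ} (a : ℕ) {u : A} (hu : u ∈ F k) : (D i)^[a] u ∈ F (k - a) := by
  induction a with
  | zero => simpa using hu
  | succ a ih =>
    rw [Function.iterate_succ_apply']
    rcases Nat.lt_or_ge a k with hk | hk
    · exact h.deriv i (by rwa [show k - (a + 1) + 1 = k - a by omega])
    · rw [show k - (a + 1) = 0 by omega]; exact h.top _

theorem pow_mem (i : ι) (a : ℕ) : ζ i ^ a ∈ F a := by
  induction a with
  | zero => exact h.top _
  | succ a ih => rw [pow_succ]; exact h.mul ih (h.coord i)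

theorem iterate_comm (i j : ι) (a : ℕ) (u : A) (N : ℕ) :
    D i ((D j)^[a] u) - (D j)^[a] (D i u) ∈ F N := by
  induction a generalizing N with
  | zero => simp
  | succ a ih =>
    rw [Function.iterate_succ_apply', Function.iterate_succ_apply']
    have := (F N).add_mem (h.comm i j ((D j)^[a] u) N) (h.deriv j (ih (N + 1)))
    simpa using this

theorem deriv_pow_ne {i j : ι} (hij : i ≠ j) (a N : ℕ) : D i (ζ j ^ a) ∈ F N := by
  rw [Derivation.leibniz_pow, nsmul_eq_mul, smul_eq_mul]
  exact h.mul_left _ (h.mul_left _ (h.ne i j N hij))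

theorem deriv_pow_self (i : ι) (a N : ℕ) : D i (ζ i ^ a) - a * ζ i ^ (a - 1) ∈ F N := by
  rw [Derivation.leibniz_pow, nsmul_eq_mul, smul_eq_mul]
  have := h.mul_left (a * ζ i ^ (a - 1)) (h.self i N)
  convert this using 1
  ring

theorem truncFlow_mem (j : ι) (N : ℕ) {k : ℕ} {u : A} (hu : u ∈ F k) :
    truncFlow (D j) (ζ j) N u ∈ F k := by
  refine (F k).sum_mem fun a _ => (F k).smul_mem _ ?_
  exact h.anti (by omega) (h.mul (h.pow_mem j a) (h.iterate_mem j a hu))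

/-- The term of index 0 is u itself. Every other term pairs ζ^(a+1) with D^a(Du), and the degree
gained from ζ exceeds the degree lost to D^a by one. -/
theorem truncFlow_sub_mem (j : ι) (N : ℕ) {k : ℕ} {u : A} (hu : D j u ∈ F k) :
    truncFlow (D j) (ζ j) N u - u ∈ F (k + 1) := by
  rw [truncFlow, Finset.sum_range_succ']
  simp only [pow_zero, Nat.factorial_zero, Nat.cast_one, div_one, one_smul, one_mul,
    Function.iterate_zero, id, add_sub_cancel_right]
  refine (F _).sum_mem fun a _ => (F _).smul_mem _ ?_
  rw [Function.iterate_succ_apply]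
  exact h.anti (by omega) (h.mul (h.pow_mem j (a + 1)) (h.iterate_mem j a hu))

/-- Flowing along D j preserves what was already achieved for D i, because D i commutes with D j and
kills ζ j. -/
theorem deriv_truncFlow_ne {i j : ι} (hij : i ≠ j) (N : ℕ) (u : A) (M : ℕ) :
    D i (truncFlow (D j) (ζ j) N u) - truncFlow (D j) (ζ j) N (D i u) ∈ F M := by
  rw [truncFlow, truncFlow, map_sum, ← Finset.sum_sub_distrib]
  refine (F M).sum_mem fun a _ => ?_
  rw [Derivation.map_smul, ← smul_sub]
  refine (F M).smul_mem _ ?_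
  rw [Derivation.leibniz, smul_eq_mul, smul_eq_mul]
  have := (F M).add_mem (h.mul_left (ζ j ^ a) (h.iterate_comm i j a u M))
    (h.mul_left ((D j)^[a] u) (h.deriv_pow_ne hij a M))
  convert this using 1
  ring

/-- When Dζ = 1 the derivative of the sum telescopes, and only (-ζ)^N/N! D^(N+1) u survives. -/
theorem deriv_truncFlow_self (j : ι) (N : ℕ) (u : A) :
    D j (truncFlow (D j) (ζ j) N u) ∈ F N := by
  -- The relation Dζ = 1 is only known up to every level of the filtration, so the telescoped
  -- identity is an identity modulo the intersection of all levels.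
  have key : ∀ N, D j (truncFlow (D j) (ζ j) N u) -
      ((-1 : ℂ) ^ N / N.factorial) • (ζ j ^ N * (D j)^[N + 1] u) ∈ ⨅ M, F M := by
    intro N
    rw [Submodule.mem_iInf]
    intro M
    induction N with
    | zero => simp [truncFlow]
    | succ N ih =>
      rw [truncFlow, Finset.sum_range_succ, ← truncFlow, map_add, Derivation.map_smul,
        Derivation.leibniz, smul_eq_mul, smul_eq_mul, ← Function.iterate_succ_apply' (D j)]
      have h1 := (F M).smul_mem ((-1 : ℂ) ^ (N + 1) / (N + 1).factorial)
        (h.mul_left ((D j)^[N + 1] u) (h.deriv_pow_self j (N + 1) M))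
      have := (F M).add_mem ih h1
      convert this using 1
      have e : ((-1 : ℂ) ^ (N + 1) / (N + 1).factorial) • ((D j)^[N + 1] u *
          (((N + 1 : ℕ) : A) * ζ j ^ N)) =
          - (((-1 : ℂ) ^ N / N.factorial) • (ζ j ^ N * (D j)^[N + 1] u)) := by
        rw [← neg_smul, ← map_natCast (algebraMap ℂ A), mul_left_comm, ← Algebra.smul_def,
          smul_smul, mul_comm (ζ j ^ N)]
        congr 1
        have : (N.factorial : ℂ) ≠ 0 := by exact_mod_cast N.factorial_ne_zero
        have : (N : ℂ) + 1 ≠ 0 := by exact_mod_cast N.succ_ne_zero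
        rw [Nat.factorial_succ, pow_succ]
        push_cast
        field_simp
      rw [Nat.add_sub_cancel, mul_sub, smul_sub, e, smul_add]
      simp only [Nat.succ_eq_add_one]
      abel
  have h1 := (Submodule.mem_iInf _).1 (key N) N
  have h2 := (F N).smul_mem ((-1 : ℂ) ^ N / N.factorial)
    (h.mul_left ((D j)^[N + 1] u) (h.pow_mem j N))
  rw [mul_comm] at h2
  simpa using (F N).add_mem h1 h2

/-- Approximate solutions of `D i g = 0`, with prescribed leading part. -/
theorem exists_approx [Fintype ι] {k : ℕ} {u : A} (hu : ∀ i, D i u ∈ F k) (N : ℕ) :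
    ∃ g, (∀ i, D i g ∈ F N) ∧ g - u ∈ F (k + 1) := by
  classical
  -- The directions are treated one at a time. Keeping D i g ∈ F k for all i, including those not
  -- yet treated, ensures that each new correction stays in F (k + 1).
  suffices H : ∀ s : Finset ι, ∃ g, (∀ i ∈ s, D i g ∈ F N) ∧ (∀ i, D i g ∈ F k) ∧
      g - u ∈ F (k + 1) by
    obtain ⟨g, h1, -, h3⟩ := H Finset.univ
    exact ⟨g, fun i => h1 i (Finset.mem_univ i), h3⟩
  intro s
  induction s using Finset.induction_on with
  | empty => exact ⟨u, by simp, hu, by simp⟩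
  | insert j s hj ih =>
    obtain ⟨g, h1, h2, h3⟩ := ih
    have h4 := h.truncFlow_sub_mem j N (h2 j)
    refine ⟨truncFlow (D j) (ζ j) N g, ?_, fun i => ?_, ?_⟩
    · intro i hi
      rcases eq_or_ne i j with rfl | hij
      · exact h.deriv_truncFlow_self i N g
      · have := (F N).add_mem (h.deriv_truncFlow_ne hij N g N)
          (h.truncFlow_mem j N (h1 i (Finset.mem_of_mem_insert_of_ne hi hij)))
        simpa using this
    · have := (F k).add_mem (h.deriv i h4) (h2 i)
      simpa using this
    · simpa using (F (k + 1)).add_mem h4 h3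

end DualFiltration

end FilteredDerivations

/-! ### Derivatives along complex vector fields -/

section CRDerivative

variable {E : Type} [NormedAddCommGroup E] [NormedSpace ℝ E]

/-- The derivative of `u` along the complex vector field `X + iY`. -/
noncomputable def crDeriv (X Y : E → E) (u : E → ℂ) (x : E) : ℂ :=
  fderiv ℝ u x (X x) + Complex.I * fderiv ℝ u x (Y x)

variable {X Y : E → E} {u v : E → ℂ} {x : E}

theorem ContDiff.crDeriv (hX : ContDiff ℝ ∞ X) (hY : ContDiff ℝ ∞ Y) (hu : ContDiff ℝ ∞ u) :
    ContDiff ℝ ∞ (crDeriv X Y u) := by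
  have h : ContDiff ℝ ∞ (fderiv ℝ u) := hu.fderiv_right (by simp)
  exact (h.clm_apply hX).add (contDiff_const.mul (h.clm_apply hY))

theorem crDeriv_add (hu : DifferentiableAt ℝ u x) (hv : DifferentiableAt ℝ v x) :
    crDeriv X Y (u + v) x = crDeriv X Y u x + crDeriv X Y v x := by
  rw [crDeriv, fderiv_add hu hv]
  simp only [add_apply, crDeriv]
  ring

theorem crDeriv_sub (hu : DifferentiableAt ℝ u x) (hv : DifferentiableAt ℝ v x) :
    crDeriv X Y (u - v) x = crDeriv X Y u x - crDeriv X Y v x := by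
  rw [crDeriv, fderiv_sub hu hv]
  simp only [sub_apply, crDeriv]
  ring

theorem crDeriv_mul (hu : DifferentiableAt ℝ u x) (hv : DifferentiableAt ℝ v x) :
    crDeriv X Y (u * v) x = u x * crDeriv X Y v x + v x * crDeriv X Y u x := by
  rw [crDeriv, fderiv_mul hu hv]
  simp only [add_apply, smul_apply, crDeriv, smul_eq_mul]
  ring

theorem crDeriv_const_mul (c : ℂ) (hu : DifferentiableAt ℝ u x) :
    crDeriv X Y (fun x => c * u x) x = c * crDeriv X Y u x := by
  rw [crDeriv, fderiv_const_mul hu]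
  simp only [smul_apply, crDeriv, smul_eq_mul]
  ring

theorem crDeriv_clm (L : E →L[ℝ] ℂ) : crDeriv X Y L x = L (X x) + Complex.I * L (Y x) := by
  rw [crDeriv, L.fderiv]

theorem crDeriv_congr (h : u =ᶠ[𝓝 x] v) : crDeriv X Y u =ᶠ[𝓝 x] crDeriv X Y v := by
  filter_upwards [h.fderiv (𝕜 := ℝ)] with y hy
  rw [crDeriv, crDeriv, hy]

theorem HasCompactSupport.crDeriv (hu : HasCompactSupport u) :
    HasCompactSupport (crDeriv X Y u) := by
  refine (hu.fderiv ℝ).mono' fun x hx => subset_tsupport _ fun h0 => hx ?_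
  simp [_root_.crDeriv, h0]

theorem VanishOrd.crDeriv (hX : ContDiff ℝ ∞ X) (hY : ContDiff ℝ ∞ Y) (hu : ContDiff ℝ ∞ u)
    {m : ℕ} (h : VanishOrd (m + 1) u) : VanishOrd m (crDeriv X Y u) := by
  have hd : ContDiff ℝ ∞ (_root_.fderiv ℝ u) := hu.fderiv_right (by simp)
  have h1 := fun Z hZ => VanishOrd.bilin (ContinuousLinearMap.id ℝ (E →L[ℝ] ℂ)) (g := Z) hd hZ
    h.fderiv (VanishOrd.zero Z)
  exact (h1 X hX).add (hd.clm_apply hX) (contDiff_const.mul (hd.clm_apply hY))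
    ((h1 Y hY).clm (ContinuousLinearMap.mul ℝ ℂ Complex.I) (hd.clm_apply hY))

theorem VanishOrd.mul {a b : ℕ} (hu' : ContDiff ℝ ∞ u) (hv' : ContDiff ℝ ∞ v)
    (hu : VanishOrd a u) (hv : VanishOrd b v) : VanishOrd (a + b) (u * v) :=
  VanishOrd.bilin (ContinuousLinearMap.mul ℝ ℂ) hu' hv' hu hv

theorem VanishOrd.const_smul {m : ℕ} (c : ℂ) (hu' : ContDiff ℝ ∞ u) (hu : VanishOrd m u) :
    VanishOrd m (c • u) :=
  hu.clm (ContinuousLinearMap.mul ℝ ℂ c) hu'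

variable (E) in
/-- The algebra of smooth complex functions. -/
def smoothAlgebra : Subalgebra ℂ (E → ℂ) where
  carrier := {u | ContDiff ℝ ∞ u}
  mul_mem' {u v} (hu : ContDiff ℝ ∞ u) (hv : ContDiff ℝ ∞ v) := hu.mul hv
  add_mem' {u v} (hu : ContDiff ℝ ∞ u) (hv : ContDiff ℝ ∞ v) := hu.add hv
  algebraMap_mem' c := (contDiff_const : ContDiff ℝ ∞ fun _ : E => c)

theorem smoothAlgebra_contDiff (u : smoothAlgebra E) : ContDiff ℝ ∞ (u : E → ℂ) := u.2

theorem smoothAlgebra_differentiable (u : smoothAlgebra E) : Differentiable ℝ (u : E → ℂ) :=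
  (smoothAlgebra_contDiff u).differentiable (by simp)

/-- `crDeriv X Y` as a derivation of the algebra of smooth functions. -/
noncomputable def crDerivation (X Y : E → E) (hX : ContDiff ℝ ∞ X) (hY : ContDiff ℝ ∞ Y) :
    Derivation ℂ (smoothAlgebra E) (smoothAlgebra E) :=
  Derivation.mk'
    { toFun := fun u => ⟨crDeriv X Y u, ContDiff.crDeriv hX hY u.2⟩
      map_add' := fun u v => Subtype.ext <| funext fun x =>
        crDeriv_add (smoothAlgebra_differentiable u x) (smoothAlgebra_differentiable v x)
      map_smul' := fun c u => Subtype.ext <| funext fun x =>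
        crDeriv_const_mul c (smoothAlgebra_differentiable u x) }
    fun u v => Subtype.ext <| funext fun x =>
      crDeriv_mul (smoothAlgebra_differentiable u x) (smoothAlgebra_differentiable v x)

variable (E) in
/-- The smooth functions vanishing to order `m` at the origin. -/
def vanishingSubmodule (m : ℕ) : Submodule ℂ (smoothAlgebra E) where
  carrier := {u | VanishOrd m (u : E → ℂ)}
  add_mem' {u v} hu hv := VanishOrd.add u.2 v.2 hu hv
  zero_mem' := VanishOrd.of_eventually_zero (Eventually.of_forall fun _ => rfl) m
  smul_mem' c u hu := VanishOrd.const_smul c u.2 hu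

end CRDerivative

/-- A commuting frame `X j + iY j` of complex vector fields near the origin of `E`, with dual
complex linear coordinates `ζ j`. -/
structure FlatFrame (ι E : Type) [DecidableEq ι] [NormedAddCommGroup E] [NormedSpace ℝ E] where
  /-- The real parts of the fields. -/
  X : ι → E → E
  /-- The imaginary parts of the fields. -/
  Y : ι → E → E
  /-- The dual coordinates. -/
  ζ : ι → E →L[ℝ] ℂ
  /-- The radius of the ball on which the relations hold. -/
  r : ℝ
  r_pos : 0 < r
  contDiff_X : ∀ j, ContDiff ℝ ∞ (X j)
  contDiff_Y : ∀ j, ContDiff ℝ ∞ (Y j)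
  dual : ∀ x ∈ Metric.ball (0 : E) r, ∀ j k,
    ζ k (X j x) + Complex.I * ζ k (Y j x) = if j = k then 1 else 0
  comm : ∀ u : E → ℂ, ContDiff ℝ ∞ u → ∀ x ∈ Metric.ball (0 : E) r, ∀ j k,
    crDeriv (X j) (Y j) (crDeriv (X k) (Y k) u) x = crDeriv (X k) (Y k) (crDeriv (X j) (Y j) u) x

/-! ### Approximate solutions for a flat frame -/

namespace FlatFrame

variable {ι E : Type} [DecidableEq ι] [NormedAddCommGroup E] [NormedSpace ℝ E]
  (C : FlatFrame ι E)

/-- The derivative along the `j`th field. -/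
noncomputable def D (j : ι) : (E → ℂ) → E → ℂ := crDeriv (C.X j) (C.Y j)

theorem contDiff_D (j : ι) {u : E → ℂ} (hu : ContDiff ℝ ∞ u) : ContDiff ℝ ∞ (C.D j u) :=
  ContDiff.crDeriv (C.contDiff_X j) (C.contDiff_Y j) hu

theorem ball_mem : Metric.ball (0 : E) C.r ∈ 𝓝 (0 : E) := Metric.ball_mem_nhds _ C.r_pos

/-- The derivation of the algebra of smooth functions given by the `j`th field. -/
noncomputable def derivation (j : ι) : Derivation ℂ (smoothAlgebra E) (smoothAlgebra E) :=
  crDerivation (C.X j) (C.Y j) (C.contDiff_X j) (C.contDiff_Y j)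

/-- The relations of the frame hold on a ball only, so the defects are functions vanishing near 0,
which lie in every level of the filtration. This is why `DualFiltration` asks for its relations
modulo each F N. -/
theorem dualFiltration : DualFiltration (vanishingSubmodule E) C.derivation
    (fun j => ⟨C.ζ j, ((C.ζ j).contDiff : ContDiff ℝ ∞ (C.ζ j))⟩) where
  top u := VanishOrd.zero _
  anti h _ hu := VanishOrd.mono hu h
  mul {_ _ u v} hu hv := VanishOrd.mul u.2 v.2 hu hv
  deriv j _ u hu := VanishOrd.crDeriv (C.contDiff_X j) (C.contDiff_Y j) u.2 hu
  coord j := VanishOrd.one (map_zero _)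
  self j N := VanishOrd.of_eventually_zero (by
    filter_upwards [C.ball_mem] with x hx
    change crDeriv _ _ (C.ζ j) x - 1 = 0
    rw [crDeriv_clm, C.dual x hx, if_pos rfl, sub_self]) N
  ne i j N hij := VanishOrd.of_eventually_zero (by
    filter_upwards [C.ball_mem] with x hx
    change crDeriv _ _ (C.ζ j) x = 0
    rw [crDeriv_clm, C.dual x hx, if_neg hij]) N
  comm i j u N := VanishOrd.of_eventually_zero (by
    filter_upwards [C.ball_mem] with x hx
    exact sub_eq_zero.2 (C.comm u u.2 x hx i j)) N

theorem exists_approx [Fintype ι] {k : ℕ} {u : E → ℂ} (hu : ContDiff ℝ ∞ u)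
    (h : ∀ j, VanishOrd k (C.D j u)) (N : ℕ) :
    ∃ g, ContDiff ℝ ∞ g ∧ (∀ j, VanishOrd N (C.D j g)) ∧ VanishOrd (k + 1) (g - u) := by
  obtain ⟨g, h1, h2⟩ := C.dualFiltration.exists_approx (u := ⟨u, hu⟩) h N
  exact ⟨g, g.2, h1, h2⟩

end FlatFrame

/-! ### Hessians, positivity and the Levi form -/

section Hessian

variable {E : Type} [NormedAddCommGroup E] [NormedSpace ℝ E]

theorem second_fderiv_symm {F : Type} [NormedAddCommGroup F] [NormedSpace ℝ F] {u : E → F}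
    (hu : ContDiff ℝ ∞ u) (x v w : E) :
    fderiv ℝ (fderiv ℝ u) x v w = fderiv ℝ (fderiv ℝ u) x w v :=
  (hu.contDiffAt.isSymmSndFDerivAt (by
    simpa using (WithTop.coe_le_coe.2 le_top : ((2 : ℕ∞) : WithTop ℕ∞) ≤ ∞))) v w

/-- The difference of a and its quadratic Taylor polynomial has derivative at most (c/4)‖x‖ near 0,
hence is at most (c/4)‖x‖² in absolute value, while the polynomial is at least (c/2)‖x‖². -/
theorem eventually_le_of_hessian {a : E → ℝ} (ha : ContDiff ℝ ∞ a) (h0 : a 0 = 0)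
    (h1 : fderiv ℝ a 0 = 0) {c : ℝ} (hc : 0 < c)
    (h2 : ∀ x, c * ‖x‖ ^ 2 ≤ fderiv ℝ (fderiv ℝ a) 0 x x) :
    ∀ᶠ x in 𝓝 0, c / 4 * ‖x‖ ^ 2 ≤ a x := by
  set B := fderiv ℝ (fderiv ℝ a) 0 with hB
  have hd : ContDiff ℝ ∞ (fderiv ℝ a) := ha.fderiv_right (by simp)
  have hda : HasFDerivAt (fderiv ℝ a) B 0 :=
    (hd.differentiable (by simp)).differentiableAt.hasFDerivAt
  have hq : ∀ x, HasFDerivAt (fun x => a x - 1 / 2 * B x x) (fderiv ℝ a x - B x) x := by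
    intro x
    have e1 := (ha.differentiable (by simp)).differentiableAt.hasFDerivAt (x := x)
    have e2 := (B.hasFDerivAt (x := x)).clm_apply (hasFDerivAt_id x)
    refine (e1.sub (e2.const_mul (1 / 2))).congr_fderiv ?_
    ext v
    have := second_fderiv_symm ha 0 x v
    simp only [← hB] at this
    simp [this]
    ring
  have hsmall := (hasFDerivAt_iff_isLittleO_nhds_zero.1 hda).def (c := c / 4) (by positivity)
  obtain ⟨δ, hδ, hball⟩ := Metric.eventually_nhds_iff_ball.1 hsmall
  filter_upwards [Metric.ball_mem_nhds (0 : E) hδ] with x hx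
  have := (convex_closedBall (0 : E) ‖x‖).norm_image_sub_le_of_norm_hasFDerivWithin_le
      (C := c / 4 * ‖x‖) (fun y _ => (hq y).hasFDerivWithinAt)
      (fun y hy => ?_) (x := 0) (y := x) (by simp) (by simp)
  · have h3 := neg_le_of_abs_le (by simpa [h0] using this)
    have h4 := h2 x
    nlinarith
  · have hy' : ‖y‖ ≤ ‖x‖ := by simpa using hy
    have := hball y (by simpa using hy'.trans_lt (by simpa using hx))
    rw [zero_add, h1, sub_zero] at this
    exact this.trans (by gcongr)

/-- A compactness argument on the unit sphere: where f ≤ 0, the function g is bounded below by a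
positive constant, so a large multiple of it compensates. Homogeneity carries the bound to the whole
space. -/
theorem exists_add_mul_pos [FiniteDimensional ℝ E] {f g : E → ℝ} (hf : Continuous f)
    (hg : Continuous g) (hf2 : ∀ (t : ℝ) x, f (t • x) = t ^ 2 * f x)
    (hg2 : ∀ (t : ℝ) x, g (t • x) = t ^ 2 * g x) (hg0 : ∀ x, 0 ≤ g x)
    (hpos : ∀ x, x ≠ 0 → g x = 0 → 0 < f x) :
    ∃ K c : ℝ, 0 < c ∧ ∀ x, c * ‖x‖ ^ 2 ≤ f x + K * g x := by
  have hS : IsCompact (Metric.sphere (0 : E) 1) := isCompact_sphere _ _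
  have hne : ∀ x ∈ Metric.sphere (0 : E) 1, x ≠ 0 := fun x hx h => by simp [h] at hx
  obtain ⟨K, hK⟩ : ∃ K : ℝ, ∀ x ∈ Metric.sphere (0 : E) 1, 0 < f x + K * g x := by
    have hT : IsCompact (Metric.sphere (0 : E) 1 ∩ {x | f x ≤ 0}) :=
      hS.inter_right (isClosed_le hf continuous_const)
    rcases (Metric.sphere (0 : E) 1 ∩ {x | f x ≤ 0}).eq_empty_or_nonempty with he | he
    · refine ⟨0, fun x hx => ?_⟩
      by_contra hx'
      have : x ∈ (∅ : Set E) := he ▸ ⟨hx, by simpa using hx'⟩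
      exact this
    · obtain ⟨x₀, hx₀, hmin⟩ := hT.exists_isMinOn he hg.continuousOn
      have hm : 0 < g x₀ := (hg0 x₀).lt_of_ne fun h =>
        absurd (hpos x₀ (hne x₀ hx₀.1) h.symm) (not_lt.2 hx₀.2)
      obtain ⟨M, hM⟩ := hS.exists_bound_of_continuousOn hf.continuousOn
      have hM0 : 0 ≤ M := (norm_nonneg _).trans (hM x₀ hx₀.1)
      -- M bounds |f| on the sphere and g x₀ is the minimum of g where f ≤ 0; the additional 1 makes
      -- the inequality strict.
      refine ⟨M / g x₀ + 1, fun x hx => ?_⟩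
      by_cases hfx : f x ≤ 0
      · have h1 : g x₀ ≤ g x := hmin ⟨hx, hfx⟩
        have h2 := neg_le_of_abs_le (hM x hx)
        have h3 : M ≤ M / g x₀ * g x := by
          rw [div_mul_eq_mul_div, le_div_iff₀ hm]; gcongr
        nlinarith
      · have : 0 ≤ (M / g x₀ + 1) * g x := mul_nonneg (by positivity) (hg0 x)
        linarith [not_le.1 hfx]
  have hcont : Continuous fun x => f x + K * g x := hf.add (continuous_const.mul hg)
  obtain ⟨c, hc, hmin⟩ : ∃ c : ℝ, 0 < c ∧ ∀ x ∈ Metric.sphere (0 : E) 1, c ≤ f x + K * g x := by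
    rcases (Metric.sphere (0 : E) 1).eq_empty_or_nonempty with he | he
    · exact ⟨1, one_pos, fun x hx => by simp [he] at hx⟩
    · obtain ⟨x₀, hx₀, hmin⟩ := hS.exists_isMinOn he hcont.continuousOn
      exact ⟨_, hK x₀ hx₀, fun x hx => hmin hx⟩
  refine ⟨K, c, hc, fun x => ?_⟩
  rcases eq_or_ne x 0 with rfl | hx
  · have e1 := hf2 0 0
    have e2 := hg2 0 0
    simp only [smul_zero, ne_eq, OfNat.ofNat_ne_zero, not_false_eq_true, zero_pow, zero_mul]
      at e1 e2
    simp [e1, e2]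
  · have hx' : ‖x‖ ≠ 0 := norm_ne_zero_iff.2 hx
    have h := hmin (‖x‖⁻¹ • x) (by simp [norm_smul, hx'])
    rw [hf2, hg2] at h
    have h2 := mul_le_mul_of_nonneg_left h (sq_nonneg ‖x‖)
    calc c * ‖x‖ ^ 2 = ‖x‖ ^ 2 * c := mul_comm _ _
      _ ≤ _ := h2
      _ = f x + K * g x := by field_simp

/-- The real part of the Hessian of `ψ` at the origin. -/
noncomputable def reHessian (ψ : E → ℂ) : E →L[ℝ] E →L[ℝ] ℝ :=
  (ContinuousLinearMap.compL ℝ E ℂ ℝ Complex.reCLM).comp (fderiv ℝ (fderiv ℝ ψ) 0)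

theorem reHessian_apply (ψ : E → ℂ) (v w : E) :
    reHessian ψ v w = (fderiv ℝ (fderiv ℝ ψ) 0 v w).re := rfl

/-- The Levi form is the `J`-invariant part of the Hessian of an approximate CR function. -/
theorem reHessian_add_eq_levi {X Y : E → E} (hX : ContDiff ℝ ∞ X) (hY : ContDiff ℝ ∞ Y)
    {ψ : E → ℂ} (hψ : ContDiff ℝ ∞ ψ) (h2 : VanishOrd 2 (crDeriv X Y ψ)) {ξ : E →L[ℝ] ℝ}
    (hξ : ∀ v, fderiv ℝ ψ 0 v = -Complex.I * ξ v) :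
    reHessian ψ (X 0) (X 0) + reHessian ψ (Y 0) (Y 0) =
      ξ (VectorField.lieBracket ℝ Y X 0) := by
  have hd : ContDiff ℝ ∞ (fderiv ℝ ψ) := hψ.fderiv_right (by simp)
  have e1 : HasFDerivAt (fderiv ℝ ψ) (fderiv ℝ (fderiv ℝ ψ) 0) 0 :=
    (hd.differentiable (by simp)).differentiableAt.hasFDerivAt
  have eX : HasFDerivAt X (fderiv ℝ X 0) 0 :=
    (hX.differentiable (by simp)).differentiableAt.hasFDerivAt
  have eY : HasFDerivAt Y (fderiv ℝ Y 0) 0 :=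
    (hY.differentiable (by simp)).differentiableAt.hasFDerivAt
  have e2 := (e1.clm_apply eX).add ((e1.clm_apply eY).const_mul Complex.I)
  have h0 : fderiv ℝ (crDeriv X Y ψ) 0 = 0 := by
    have := h2.fderiv.apply_zero
    exact this
  have e3 := e2.fderiv.symm.trans h0
  -- The differential of (X + iY)ψ vanishes at 0. Its real part at v = X and imaginary part at v =
  -- Y, added together, cancel the mixed second derivatives by symmetry and leave the bracket.
  have key : ∀ v, fderiv ℝ (fderiv ℝ ψ) 0 v (X 0) + -Complex.I * ξ (fderiv ℝ X 0 v) +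
      Complex.I * (fderiv ℝ (fderiv ℝ ψ) 0 v (Y 0) + -Complex.I * ξ (fderiv ℝ Y 0 v)) = 0 := by
    intro v
    have := DFunLike.congr_fun e3 v
    rw [← hξ, ← hξ]
    refine Eq.trans ?_ this
    simp
    ring
  have kX := congrArg Complex.re (key (X 0))
  have kY := congrArg Complex.im (key (Y 0))
  have hs := second_fderiv_symm hψ 0 (X 0) (Y 0)
  have hs' := congrArg Complex.im hs
  simp only [Complex.add_re, Complex.add_im, Complex.mul_re, Complex.mul_im, Complex.I_re,
    Complex.I_im, Complex.neg_re, Complex.neg_im, Complex.ofReal_re, Complex.ofReal_im,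
    Complex.zero_re, Complex.zero_im] at kX kY
  rw [reHessian_apply, reHessian_apply, VectorField.lieBracket_eq, map_sub]
  linarith

end Hessian

theorem fderiv_quadratic {E : Type} [NormedAddCommGroup E] [NormedSpace ℝ E]
    {B : E →L[ℝ] E →L[ℝ] ℂ} (hsymm : ∀ x y, B x y = B y x) (x : E) :
    fderiv ℝ (fun x => (1 / 2 : ℂ) * B x x) x = B x := by
  have e2 := ((B.hasFDerivAt (x := x)).clm_apply (hasFDerivAt_id x)).const_mul (1 / 2 : ℂ)
  refine HasFDerivAt.fderiv (e2.congr_fderiv ?_)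
  ext v
  simp [hsymm v x]
  ring

/-- A function with positive real part near the origin can be changed away from the origin to have
positive real part everywhere. -/
theorem exists_global_phase {E : Type} [NormedAddCommGroup E] [InnerProductSpace ℝ E]
    [FiniteDimensional ℝ E] {ψ : E → ℂ} (hψ : ContDiff ℝ ∞ ψ) {c : ℝ} (hc : 0 < c)
    (h : ∀ᶠ x in 𝓝 0, c * ‖x‖ ^ 2 ≤ (ψ x).re) :
    ∃ φ : E → ℂ, ContDiff ℝ ∞ φ ∧ φ =ᶠ[𝓝 0] ψ ∧
      ∃ c, 0 < c ∧ ∀ x, c * ‖x‖ ^ 2 ≤ (φ x).re := by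
  obtain ⟨δ, hδ, hball⟩ := Metric.eventually_nhds_iff_ball.1 h
  let χ : ContDiffBump (0 : E) := ⟨δ / 2, δ, by positivity, by linarith⟩
  have hχ : ContDiff ℝ ∞ χ := χ.contDiff
  refine ⟨fun x => ((χ x : ℝ) : ℂ) * ψ x + (((1 - χ x) * ‖x‖ ^ 2 : ℝ) : ℂ), ?_, ?_, min c 1,
    by positivity, fun x => ?_⟩
  · exact ((Complex.ofRealCLM.contDiff.comp hχ).mul hψ).add
      (Complex.ofRealCLM.contDiff.comp ((contDiff_const.sub hχ).mul (contDiff_norm_sq ℝ)))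
  · filter_upwards [χ.eventuallyEq_one] with x hx
    rw [hx]
    simp
  · have h0 := χ.nonneg (x := x)
    have h1 := χ.le_one (x := x)
    have hn := sq_nonneg ‖x‖
    simp only [Complex.add_re, Complex.re_ofReal_mul, Complex.ofReal_re]
    have e2 : min c 1 * ‖x‖ ^ 2 ≤ ‖x‖ ^ 2 := by
      have := min_le_right c 1
      nlinarith
    have e1 : χ x * (min c 1 * ‖x‖ ^ 2) ≤ χ x * (ψ x).re := by
      by_cases hx : x ∈ Metric.ball (0 : E) δ
      · refine mul_le_mul_of_nonneg_left (le_trans ?_ (hball x hx)) h0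
        gcongr
        exact min_le_left _ _
      · rw [χ.zero_of_le_dist (by simpa using hx)]; simp
    have e3 := mul_le_mul_of_nonneg_left e2 (sub_nonneg.2 h1)
    linarith

/-! ### The phase function -/

namespace FlatFrame

variable {ι E : Type} [Fintype ι] [DecidableEq ι] [NormedAddCommGroup E]

section Combinations

variable [NormedSpace ℝ E] (C : FlatFrame ι E)

/-- The real part of the complex vector field `∑ j, c j • (X j + iY j)`. -/
def combX (c : ι → ℂ) (x : E) : E := ∑ j, ((c j).re • C.X j x - (c j).im • C.Y j x)

/-- The imaginary part of the complex vector field `∑ j, c j • (X j + iY j)`. -/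
def combY (c : ι → ℂ) (x : E) : E := ∑ j, ((c j).re • C.Y j x + (c j).im • C.X j x)

theorem contDiff_combX (c : ι → ℂ) : ContDiff ℝ ∞ (C.combX c) :=
  ContDiff.sum fun j _ => (contDiff_const.smul (C.contDiff_X j)).sub
    (contDiff_const.smul (C.contDiff_Y j))

theorem contDiff_combY (c : ι → ℂ) : ContDiff ℝ ∞ (C.combY c) :=
  ContDiff.sum fun j _ => (contDiff_const.smul (C.contDiff_Y j)).add
    (contDiff_const.smul (C.contDiff_X j))

theorem clm_comb (L : E →L[ℝ] ℂ) (c : ι → ℂ) (x : E) :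
    L (C.combX c x) + Complex.I * L (C.combY c x) =
      ∑ j, c j * (L (C.X j x) + Complex.I * L (C.Y j x)) := by
  rw [combX, combY, map_sum, map_sum, Finset.mul_sum, ← Finset.sum_add_distrib]
  refine Finset.sum_congr rfl fun j _ => ?_
  simp only [map_sub, map_add, map_smul, Complex.real_smul]
  conv_rhs => rw [← Complex.re_add_im (c j)]
  linear_combination (-(c j).im * L (C.Y j x)) * Complex.I_mul_I

theorem crDeriv_comb (c : ι → ℂ) (u : E → ℂ) (x : E) :
    crDeriv (C.combX c) (C.combY c) u x = ∑ j, c j * C.D j u x :=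
  C.clm_comb (fderiv ℝ u x) c x

theorem combX_I_smul (c : ι → ℂ) (x : E) : C.combX (Complex.I • c) x = -C.combY c x := by
  rw [combX, combY, ← Finset.sum_neg_distrib]
  exact Finset.sum_congr rfl fun j _ => by simp; abel

theorem combY_I_smul (c : ι → ℂ) (x : E) : C.combY (Complex.I • c) x = C.combX c x := by
  rw [combX, combY]
  exact Finset.sum_congr rfl fun j _ => by simp; abel

theorem combX_single (j : ι) (x : E) : C.combX (Pi.single j 1) x = C.X j x := by
  rw [combX, Finset.sum_eq_single j]
  · simp
  · intro i _ hi; simp [hi]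
  · simp

theorem combY_single (j : ι) (x : E) : C.combY (Pi.single j 1) x = C.Y j x := by
  rw [combY, Finset.sum_eq_single j]
  · simp
  · intro i _ hi; simp [hi]
  · simp

/-- The values at the origin of the real parts of the fields, as a linear map. -/
def realPart : (ι → ℂ) →ₗ[ℝ] E where
  toFun c := C.combX c 0
  map_add' c d := by
    simp only [combX, ← Finset.sum_add_distrib]
    exact Finset.sum_congr rfl fun j _ => by simp [add_smul]; abel
  map_smul' t c := by
    simp only [combX, Finset.smul_sum]
    exact Finset.sum_congr rfl fun j _ => by simp [mul_smul, smul_sub]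

end Combinations

variable [InnerProductSpace ℝ E] [FiniteDimensional ℝ E] (C : FlatFrame ι E)

/-- Here a is a projection onto the real span H_0 of the fields at 0 and b is -J ∘ a, where J maps
`combX c 0` to `combY c 0`. The last clause says that a fixes H_0. -/
theorem exists_projection (hinj : ∀ c, C.combX c 0 = 0 → c = 0) :
    ∃ a b : E →L[ℝ] E, ∀ x, ∃ c, a x = C.combX c 0 ∧ b x = -C.combY c 0 ∧
      ∀ d, x = C.combX d 0 → c = d := by
  obtain ⟨P, hP⟩ := C.realPart.exists_leftInverse_of_injective
    (LinearMap.ker_eq_bot'.2 fun c hc => hinj c hc)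
  have hP' : ∀ c, P (C.combX c 0) = c := fun c => LinearMap.congr_fun hP c
  let M : (ι → ℂ) →ₗ[ℝ] (ι → ℂ) :=
    { toFun := fun c => Complex.I • c
      map_add' := fun c d => smul_add _ _ _
      map_smul' := fun t c => smul_comm _ _ _ }
  refine ⟨(C.realPart ∘ₗ P).toContinuousLinearMap,
    (C.realPart ∘ₗ M ∘ₗ P).toContinuousLinearMap, fun x => ⟨P x, rfl, ?_, ?_⟩⟩
  · exact C.combX_I_smul (P x) 0
  · rintro d rfl
    exact hP' d

/-- A quadratic form which is an approximate CR function and by which the real part of the given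
Hessian can be made positive. -/
theorem exists_quadratic (hinj : ∀ c, C.combX c 0 = 0 → c = 0) (β : E →L[ℝ] E →L[ℝ] ℝ)
    (hsymm : ∀ x y, β x y = β y x)
    (hβ : ∀ c, c ≠ 0 → 0 < β (C.combX c 0) (C.combX c 0) + β (C.combY c 0) (C.combY c 0)) :
    ∃ B : E →L[ℝ] E →L[ℝ] ℂ, (∀ x y, B x y = B y x) ∧
      (∀ x j, B x (C.X j 0) + Complex.I * B x (C.Y j 0) = 0) ∧
      ∃ c : ℝ, 0 < c ∧ ∀ x, c * ‖x‖ ^ 2 ≤ β x x + (B x x).re := by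
  obtain ⟨a, b, hab⟩ := C.exists_projection hinj
  have haX : ∀ c, a (C.combX c 0) = C.combX c 0 ∧ b (C.combX c 0) = - C.combY c 0 := by
    intro c
    obtain ⟨d, h1, h2, h3⟩ := hab (C.combX c 0)
    obtain rfl := h3 c rfl
    exact ⟨h1, h2⟩
  have haY : ∀ c, a (C.combY c 0) = C.combY c 0 ∧ b (C.combY c 0) = C.combX c 0 := by
    intro c
    have h := haX (Complex.I • c)
    rw [combX_I_smul, combY_I_smul, map_neg, map_neg, neg_inj, neg_inj] at h
    exact h
  set t : E →L[ℝ] E := ContinuousLinearMap.id ℝ E - a with ht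
  have hta : ∀ x, t x = x - a x := fun x => rfl
  -- On H_0, the kernel of t, this function is (β(x, x) + β(Jx, Jx))/2, which is positive by `hβ`.
  -- Transversally to H_0 a multiple of ‖t x‖² is added.
  have hfc : Continuous fun x => β x x - 1 / 2 * (β (a x) (a x) - β (b x) (b x)) := by fun_prop
  have hgc : Continuous fun x => ‖t x‖ ^ 2 := by fun_prop
  obtain ⟨K, c, hc, hK⟩ := exists_add_mul_pos hfc hgc
    (fun s x => by simp only [map_smul, smul_apply, smul_eq_mul]; ring)
    (fun s x => by rw [map_smul, norm_smul, mul_pow, Real.norm_eq_abs, sq_abs])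
    (fun x => by positivity) (fun x hx h0 => by
      have h1 : a x = x := by
        have : t x = 0 := by simpa using h0
        rw [hta] at this
        exact (sub_eq_zero.1 this).symm
      obtain ⟨d, h2, h3, -⟩ := hab x
      have hd : d ≠ 0 := by
        rintro rfl
        apply hx
        rw [← h1, h2]
        simp [combX]
      have := hβ d hd
      rw [h1, h3, ← h1, h2]
      simp only [map_neg, neg_apply]
      linarith)
  let ofR : (E →L[ℝ] ℝ) →L[ℝ] (E →L[ℝ] ℂ) :=
    ContinuousLinearMap.compL ℝ E ℝ ℂ Complex.ofRealCLM
  let T : E →L[ℝ] E →L[ℝ] ℝ := (innerSL ℝ).bilinearComp t t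
  -- The real part `B1` subtracts the J-anti-invariant half of β on H_0 and adds the transversal
  -- term, which does not see H_0. The imaginary part `B2` is then dictated by B(x, Jy) = iB(x, y)
  -- for y in H_0.
  let B1 : E →L[ℝ] E →L[ℝ] ℂ := ofR.comp ((-(1 / 2 : ℝ)) • (β.bilinearComp a a -
    β.bilinearComp b b) + K • T)
  let B2 : E →L[ℝ] E →L[ℝ] ℂ := ofR.comp ((-(1 / 2 : ℝ)) • (β.bilinearComp b a +
    β.bilinearComp a b))
  have hB1 : ∀ x y, B1 x y = ((-(1 / 2) * (β (a x) (a y) - β (b x) (b y)) +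
    K * inner ℝ (t x) (t y) : ℝ) : ℂ) := fun x y => rfl
  have hB2 : ∀ x y, B2 x y = ((-(1 / 2) * (β (b x) (a y) + β (a x) (b y)) : ℝ) : ℂ) :=
    fun x y => rfl
  have hB : ∀ x y, (B1 + Complex.I • B2) x y = B1 x y + Complex.I * B2 x y := fun x y => rfl
  refine ⟨B1 + Complex.I • B2, fun x y => ?_, fun x j => ?_, c, hc, fun x => ?_⟩
  · rw [hB, hB, hB1, hB1, hB2, hB2, hsymm (a x), hsymm (b x), hsymm (b x), hsymm (a x),
      real_inner_comm, add_comm (β (a y) (b x))]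
  · have hX := haX (Pi.single j 1)
    have hY := haY (Pi.single j 1)
    rw [combX_single, combY_single] at hX hY
    rw [hB, hB, hB1, hB1, hB2, hB2, hta (C.X j 0), hta (C.Y j 0), hX.1, hX.2, hY.1, hY.2]
    simp only [sub_self, inner_zero_right, map_neg]
    push_cast
    linear_combination (1 / 2 * (-(β (b x) (C.Y j 0) : ℂ) - β (a x) (C.X j 0))) *
      Complex.I_mul_I
  · refine (hK x).trans (le_of_eq ?_)
    rw [hB, hB1, hB2, real_inner_self_eq_norm_sq]
    simp only [Complex.add_re, Complex.ofReal_re, Complex.mul_re, Complex.I_re, Complex.ofReal_im,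
      Complex.I_im]
    ring

/-- The derivative of B(x, x)/2 along the field Z_j is B(x, Z_j(x)). The value Z_j(0) contributes
nothing, and x and Z_j(x) - Z_j(0) both vanish at 0. -/
theorem quadratic_vanishOrd {B : E →L[ℝ] E →L[ℝ] ℂ} (hsymm : ∀ x y, B x y = B y x)
    (hB : ∀ x j, B x (C.X j 0) + Complex.I * B x (C.Y j 0) = 0) (j : ι) :
    VanishOrd 2 (C.D j fun x => (1 / 2 : ℂ) * B x x) := by
  have hd := fderiv_quadratic hsymm
  have hX : ContDiff ℝ ∞ fun x => C.X j x - C.X j 0 := (C.contDiff_X j).sub contDiff_const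
  have hY : ContDiff ℝ ∞ fun x => C.Y j x - C.Y j 0 := (C.contDiff_Y j).sub contDiff_const
  have hid : VanishOrd 1 (fun x : E => x) := VanishOrd.one rfl
  have h1 := VanishOrd.bilin B contDiff_id hX hid (VanishOrd.one (by simp))
  have h2 := VanishOrd.bilin B contDiff_id hY hid (VanishOrd.one (by simp))
  have h3 := h1.add (contDiff_bilin B contDiff_id hX)
    (contDiff_const.mul (contDiff_bilin B contDiff_id hY))
    (h2.clm (ContinuousLinearMap.mul ℝ ℂ Complex.I) (contDiff_bilin B contDiff_id hY))
  refine h3.congr (Eventually.of_forall fun x => ?_)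
  rw [D, crDeriv, hd]
  simp only [Pi.add_apply, map_sub, id]
  linear_combination -hB x j

/-- An approximate CR function with positive real part. -/
theorem exists_phase (hinj : ∀ c, C.combX c 0 = 0 → c = 0) {ξ : E →L[ℝ] ℝ}
    (hX : ∀ j, ξ (C.X j 0) = 0) (hY : ∀ j, ξ (C.Y j 0) = 0)
    (hL : ∀ c, c ≠ 0 → 0 < ξ (VectorField.lieBracket ℝ (C.combY c) (C.combX c) 0)) (N : ℕ) :
    ∃ ψ : E → ℂ, ContDiff ℝ ∞ ψ ∧ (∀ j, VanishOrd N (C.D j ψ)) ∧ ψ 0 = 0 ∧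
      ∃ c, 0 < c ∧ ∀ x, c * ‖x‖ ^ 2 ≤ (ψ x).re := by
  let L : E →L[ℝ] ℂ := (-Complex.I) • Complex.ofRealCLM.comp ξ
  have hLv : ∀ v, L v = -Complex.I * ξ v := fun v => rfl
  have hLs : ContDiff ℝ ∞ L := L.contDiff
  -- Order N + 2 covers the order N of the conclusion and the order 2 that the Hessian identity
  -- needs even for small N.
  obtain ⟨ψ₁, hψ₁, hD₁, hv₁⟩ := C.exists_approx (k := 1) hLs (fun j => VanishOrd.one (by
    rw [D, crDeriv_clm, hLv, hLv, hX, hY]; simp)) (N + 2)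
  have hψ₁0 : ψ₁ 0 = 0 := by
    have := (hv₁.mono one_le_two).apply_zero
    simpa using this
  have hdψ₁ : fderiv ℝ ψ₁ 0 = L := by
    have := hv₁.fderiv.apply_zero
    rw [fderiv_sub (hψ₁.differentiable (by simp)).differentiableAt
      (hLs.differentiable (by simp)).differentiableAt, L.fderiv] at this
    exact sub_eq_zero.1 this
  have hβ : ∀ c, c ≠ 0 → 0 < reHessian ψ₁ (C.combX c 0) (C.combX c 0) +
      reHessian ψ₁ (C.combY c 0) (C.combY c 0) := by
    intro c hc
    rw [reHessian_add_eq_levi (C.contDiff_combX c) (C.contDiff_combY c) hψ₁ ?_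
      (fun v => by rw [hdψ₁, hLv])]
    · exact hL c hc
    · have : ∀ s : Finset ι, VanishOrd 2 (fun x => ∑ j ∈ s, c j * C.D j ψ₁ x) ∧
          ContDiff ℝ ∞ (fun x => ∑ j ∈ s, c j * C.D j ψ₁ x) := by
        intro s
        induction s using Finset.induction_on with
        | empty =>
          simp only [Finset.sum_empty]
          exact ⟨VanishOrd.of_eventually_zero (Eventually.of_forall fun _ => rfl) 2,
            contDiff_const⟩
        | insert j s hj ih =>
          simp only [Finset.sum_insert hj]
          have hs := C.contDiff_D j hψ₁
          exact ⟨VanishOrd.add (contDiff_const.mul hs) ih.2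
            (((hD₁ j).mono (by omega)).const_smul (c j) hs) ih.1,
            (contDiff_const.mul hs).add ih.2⟩
      exact (this Finset.univ).1.congr
        (Eventually.of_forall fun x => (C.crDeriv_comb c ψ₁ x).symm)
  obtain ⟨B, hBs, hB0, c, hc, hpos⟩ := C.exists_quadratic hinj (reHessian ψ₁)
    (fun x y => by rw [reHessian_apply, reHessian_apply, second_fderiv_symm hψ₁]) hβ
  have hQ : ContDiff ℝ ∞ fun x => (1 / 2 : ℂ) * B x x :=
    contDiff_const.mul (contDiff_bilin B contDiff_id contDiff_id)
  -- Since q agrees with B(x, x)/2 to third order, adding it leaves the value and the differential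
  -- of ψ₁ at 0 unchanged and adds B to the Hessian.
  obtain ⟨q, hq, hDq, hvq⟩ := C.exists_approx (k := 2) hQ (C.quadratic_vanishOrd hBs hB0) N
  have hd := fderiv_quadratic hBs
  have hq0 : q 0 = 0 := by
    have := (hvq.mono (show 1 ≤ 3 by omega)).apply_zero
    simpa using this
  have hdq : fderiv ℝ (q - fun x => (1 / 2 : ℂ) * B x x) = fderiv ℝ q - fun x => B x := by
    funext x
    rw [fderiv_sub (hq.differentiable (by simp)).differentiableAt
      (hQ.differentiable (by simp)).differentiableAt, hd]
    rfl
  have hdq0 : fderiv ℝ q 0 = 0 := by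
    have := (hvq.fderiv.mono one_le_two).apply_zero
    rw [hdq] at this
    simpa using this
  have hddq0 : fderiv ℝ (fderiv ℝ q) 0 = B := by
    have := hvq.fderiv.fderiv.apply_zero
    have hq' : ContDiff ℝ ∞ (fderiv ℝ q) := hq.fderiv_right (by simp)
    rw [hdq, fderiv_sub (hq'.differentiable (by simp)).differentiableAt
      B.differentiableAt, B.fderiv] at this
    exact sub_eq_zero.1 this
  have hψ : ContDiff ℝ ∞ (ψ₁ + q) := hψ₁.add hq
  have hDψ : ∀ j, VanishOrd N (C.D j (ψ₁ + q)) := fun j =>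
    (((hD₁ j).mono (by omega)).add (C.contDiff_D j hψ₁) (C.contDiff_D j hq) (hDq j)).congr
      (Eventually.of_forall fun x => (crDeriv_add (hψ₁.differentiable (by simp)).differentiableAt
        (hq.differentiable (by simp)).differentiableAt).symm)
  have hdψ : ∀ x, fderiv ℝ (fun x => ((ψ₁ + q) x).re) x =
      Complex.reCLM.comp (fderiv ℝ ψ₁ x + fderiv ℝ q x) := by
    intro x
    have := Complex.reCLM.hasFDerivAt.comp x
      ((hψ₁.differentiable (by simp)).differentiableAt.hasFDerivAt (x := x) |>.add
      ((hq.differentiable (by simp)).differentiableAt.hasFDerivAt (x := x)))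
    exact this.fderiv
  have hddψ : fderiv ℝ (fderiv ℝ fun x => ((ψ₁ + q) x).re) 0 =
      (ContinuousLinearMap.compL ℝ E ℂ ℝ Complex.reCLM).comp
        (fderiv ℝ (fderiv ℝ ψ₁) 0 + B) := by
    rw [show fderiv ℝ (fun x => ((ψ₁ + q) x).re) = _ from funext hdψ]
    have h1 : ContDiff ℝ ∞ (fderiv ℝ ψ₁) := hψ₁.fderiv_right (by simp)
    have h2 : ContDiff ℝ ∞ (fderiv ℝ q) := hq.fderiv_right (by simp)
    have h3 := ((h1.differentiable (by simp)).differentiableAt.hasFDerivAt (x := 0)).add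
      ((h2.differentiable (by simp)).differentiableAt.hasFDerivAt (x := 0))
    rw [hddq0] at h3
    exact ((ContinuousLinearMap.compL ℝ E ℂ ℝ Complex.reCLM).hasFDerivAt.comp 0 h3).fderiv
  -- The real part has a critical point at 0 because the differential there is -iξ with ξ real.
  have hloc := eventually_le_of_hessian (a := fun x => ((ψ₁ + q) x).re)
    (Complex.reCLM.contDiff.comp hψ) (by simp [hψ₁0, hq0])
    (by rw [hdψ, hdψ₁, hdq0]; ext v; simp [hLv]) hc
    (fun x => by rw [hddψ]; exact hpos x)
  obtain ⟨φ, hφ, hφψ, c', hc', hφpos⟩ := exists_global_phase hψ (by positivity) hloc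
  refine ⟨φ, hφ, fun j => (hDψ j).congr (crDeriv_congr hφψ.symm), ?_, c', hc', hφpos⟩
  rw [hφψ.eq_of_nhds, Pi.add_apply, hψ₁0, hq0, add_zero]

end FlatFrame

/-! ### Functions with given differential and small ∂̄ -/

namespace FlatFrame

variable {ι E : Type} [Fintype ι] [DecidableEq ι] [NormedAddCommGroup E]
  [InnerProductSpace ℝ E] [FiniteDimensional ℝ E] (C : FlatFrame ι E)

omit [Fintype ι] [FiniteDimensional ℝ E] in
theorem D_exp_smul {ψ φ : E → ℂ} (hψ : ContDiff ℝ ∞ ψ) (hφ : ContDiff ℝ ∞ φ) (τ : ℝ) (j : ι) :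
    C.D j (fun x => Complex.exp (-(τ * ψ x)) • φ x) =
      (fun x => Complex.exp (-(τ * ψ x)) • C.D j φ x) +
      (-τ) • fun x => Complex.exp (-(τ * ψ x)) • (φ * C.D j ψ) x := by
  funext x
  have h1 : HasFDerivAt (fun x => Complex.exp (-(τ * ψ x)) • φ x) _ x :=
    (((((hψ.differentiable (by simp)).differentiableAt.hasFDerivAt (x := x)).const_mul
      (τ : ℂ)).neg.cexp)).smul ((hφ.differentiable (by simp)).differentiableAt.hasFDerivAt (x := x))
  simp only [D, crDeriv]
  rw [h1.fderiv]
  simp only [crDeriv, add_apply, smul_apply, ContinuousLinearMap.smulRight_apply,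
    Pi.add_apply, Pi.smul_apply, Pi.neg_apply, neg_apply, Pi.mul_apply, smul_eq_mul,
    Complex.real_smul, Complex.ofReal_neg]
  ring

/-- D(e^{-τψ}φ) = e^{-τψ}(Dφ - τφDψ). The decay lemma is used with K = m + 2, so that even the
second term, with its extra factor τ, is of size τ · τ^m/τ^(m+2) = 1/τ. -/
theorem exists_decay {ψ φ : E → ℂ} (hψ : ContDiff ℝ ∞ ψ) (hφ : ContDiff ℝ ∞ φ)
    (hφs : HasCompactSupport φ) {c : ℝ} (hc : 0 < c) (hre : ∀ x, c * ‖x‖ ^ 2 ≤ (ψ x).re)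
    (m : ℕ) (j : ι) (h1 : VanishOrd (m + 2 * (m + 2)) (C.D j φ))
    (h2 : VanishOrd (m + 2 * (m + 2)) (C.D j ψ)) :
    ∃ A, 0 ≤ A ∧ ∀ τ : ℝ, 1 ≤ τ → ∀ x, ‖iteratedFDeriv ℝ m
      (C.D j fun x => Complex.exp (-(τ * ψ x)) • φ x) x‖ ≤ A / τ := by
  have hDφ := C.contDiff_D j hφ
  have hDψ := C.contDiff_D j hψ
  have hφDψ : VanishOrd (m + 2 * (m + 2)) (φ * C.D j ψ) := by
    simpa using VanishOrd.mul hφ hDψ (VanishOrd.zero φ) h2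
  obtain ⟨A₁, hA₁0, hA₁⟩ := decay_exp_smul hψ hc hre (m + 2) m hDφ hφs.crDeriv h1
  obtain ⟨A₂, hA₂0, hA₂⟩ := decay_exp_smul (h := φ * C.D j ψ) hψ hc hre (m + 2) m (hφ.mul hDψ)
    (hφs.mul_right) hφDψ
  refine ⟨A₁ + A₂, by positivity, fun τ hτ x => ?_⟩
  have hτ0 : 0 < τ := by linarith
  have hexp : ContDiff ℝ ∞ (fun x => Complex.exp (-(τ * ψ x))) :=
    (contDiff_const.mul hψ).neg.cexp
  have hs1 : ContDiff ℝ m (fun x => Complex.exp (-(τ * ψ x)) • C.D j φ x) :=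
    (hexp.smul hDφ).of_le (by exact_mod_cast le_top)
  have hs2 : ContDiff ℝ m (fun x => Complex.exp (-(τ * ψ x)) • (φ * C.D j ψ) x) :=
    (hexp.smul (hφ.mul hDψ)).of_le (by exact_mod_cast le_top)
  have hs3 : ContDiff ℝ m ((-τ) • fun x => Complex.exp (-(τ * ψ x)) • (φ * C.D j ψ) x) :=
    hs2.const_smul (-τ)
  rw [C.D_exp_smul hψ hφ, iteratedFDeriv_add_apply hs1.contDiffAt hs3.contDiffAt,
    iteratedFDeriv_const_smul_apply hs2.contDiffAt]
  refine (norm_add_le _ _).trans ?_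
  rw [norm_smul, Real.norm_eq_abs, abs_neg, abs_of_pos hτ0]
  have e0 : τ ^ m / τ ^ (m + 2) = 1 / τ ^ 2 := by rw [pow_add]; field_simp
  have i1 := hA₁ τ hτ x
  have i2 := mul_le_mul_of_nonneg_left (hA₂ τ hτ x) hτ0.le
  rw [e0] at i1 i2
  have e1 : A₁ * (1 / τ ^ 2) ≤ A₁ / τ := by
    rw [mul_one_div]
    gcongr
    nlinarith
  have e2 : τ * (A₂ * (1 / τ ^ 2)) = A₂ / τ := by field_simp
  rw [add_div]
  linarith

/-- Functions with prescribed differential at the origin and with small `∂̄`. -/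
theorem exists_small (hinj : ∀ c, C.combX c 0 = 0 → c = 0) {ξ : E →L[ℝ] ℝ}
    (hX : ∀ j, ξ (C.X j 0) = 0) (hY : ∀ j, ξ (C.Y j 0) = 0)
    (hL : ∀ c, c ≠ 0 → 0 < ξ (VectorField.lieBracket ℝ (C.combY c) (C.combX c) 0))
    {θ : E →L[ℝ] ℂ} (hθ : ∀ j, θ (C.X j 0) + Complex.I * θ (C.Y j 0) = 0) (N : ℕ) {ε : ℝ}
    (hε : 0 < ε) :
    ∃ g : E → ℂ, ContDiff ℝ ∞ g ∧ HasCompactSupport g ∧ fderiv ℝ g 0 = θ ∧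
      ∀ j, ∀ m ≤ N, ∀ x, ‖iteratedFDeriv ℝ m (C.D j g) x‖ ≤ ε := by
  -- The order 3N + 4 is m + 2(m + 2) at m = N, and thus suffices for every m ≤ N.
  obtain ⟨ψ, hψ, hDψ, hψ0, c, hc, hre⟩ := C.exists_phase hinj hX hY hL (3 * N + 4)
  have hθs : ContDiff ℝ ∞ θ := θ.contDiff
  obtain ⟨φ₀, hφ₀, hDφ₀, hv⟩ := C.exists_approx (k := 1) hθs
    (fun j => VanishOrd.one (by rw [D, crDeriv_clm, hθ])) (3 * N + 4)
  let χ : ContDiffBump (0 : E) := ⟨1, 2, one_pos, one_lt_two⟩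
  let φ : E → ℂ := fun x => (χ x : ℂ) * φ₀ x
  have hφ : ContDiff ℝ ∞ φ := (Complex.ofRealCLM.contDiff.comp χ.contDiff).mul hφ₀
  have hφs : HasCompactSupport φ :=
    χ.hasCompactSupport.mono' fun x hx => subset_tsupport _ fun h0 => hx (by simp [φ, h0])
  have hφφ₀ : φ =ᶠ[𝓝 0] φ₀ := by
    filter_upwards [χ.eventuallyEq_one] with x hx
    simp [φ, hx]
  have hDφ : ∀ j, VanishOrd (3 * N + 4) (C.D j φ) := fun j =>
    (hDφ₀ j).congr (crDeriv_congr hφφ₀.symm)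
  have hφ0 : φ 0 = 0 := by
    have := (hv.mono one_le_two).apply_zero
    rw [hφφ₀.eq_of_nhds]
    simpa using this
  have hdφ : fderiv ℝ φ 0 = θ := by
    have := hv.fderiv.apply_zero
    rw [fderiv_sub (hφ₀.differentiable (by simp)).differentiableAt
      (hθs.differentiable (by simp)).differentiableAt, θ.fderiv] at this
    rw [hφφ₀.fderiv_eq]
    exact sub_eq_zero.1 this
  have hdec : ∀ (p : ι × Fin (N + 1)), ∃ A, 0 ≤ A ∧ ∀ τ : ℝ, 1 ≤ τ → ∀ x,
      ‖iteratedFDeriv ℝ p.2 (C.D p.1 fun x => Complex.exp (-(τ * ψ x)) • φ x) x‖ ≤ A / τ :=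
    fun p => C.exists_decay hψ hφ hφs hc hre p.2 p.1 ((hDφ p.1).mono (by omega))
      ((hDψ p.1).mono (by omega))
  choose A hA0 hA using hdec
  have hS0 : 0 ≤ ∑ p, A p := Finset.sum_nonneg fun p _ => hA0 p
  -- Large enough that A p / τ ≤ ε for every field and every order at once, and at least 1 as the
  -- decay estimate requires.
  set τ : ℝ := (∑ p, A p) / ε + 1 with hτ
  have hτ1 : 1 ≤ τ := by
    have : 0 ≤ (∑ p, A p) / ε := by positivity
    linarith
  have hτ0 : 0 < τ := by linarith
  refine ⟨fun x => Complex.exp (-(τ * ψ x)) • φ x, ((contDiff_const.mul hψ).neg.cexp).smul hφ,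
    hφs.mono' fun x hx => subset_tsupport _ fun h0 => hx (by simp [h0]), ?_, ?_⟩
  · have h1 : HasFDerivAt (fun x => Complex.exp (-(τ * ψ x)) • φ x) _ 0 :=
      (((((hψ.differentiable (by simp)).differentiableAt.hasFDerivAt (x := 0)).const_mul
        (τ : ℂ)).neg.cexp)).smul
        ((hφ.differentiable (by simp)).differentiableAt.hasFDerivAt (x := 0))
    rw [h1.fderiv, hφ0, hdφ]
    ext v
    simp [hψ0]
  · intro j m hm x
    refine (hA (j, ⟨m, by omega⟩) τ hτ1 x).trans ?_
    rw [div_le_iff₀ hτ0]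
    have h1 : A (j, ⟨m, by omega⟩) ≤ ∑ p, A p :=
      Finset.single_le_sum (f := A) (fun p _ => hA0 p) (Finset.mem_univ _)
    refine h1.trans ?_
    rw [hτ, mul_add, mul_div_cancel₀ _ hε.ne']
    linarith

end FlatFrame

/-! ### A Baire category argument for linear relations -/

section OpenMapping

variable {X U : Type*} [NormedAddCommGroup X] [NormedSpace ℝ X] [AddCommGroup U] [Module ℝ U]

/-- `Bd m C u` says that the `m`th seminorm of `u` is at most `C`. -/
structure BoundSystem (Bd : ℕ → ℝ → U → Prop) : Prop where
  smul : ∀ {m C u} (t : ℝ), Bd m C u → Bd m (|t| * C) (t • u)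
  sub : ∀ {m C C' u v}, Bd m C u → Bd m C' v → Bd m (C + C') (u - v)
  mono : ∀ {m C C' u}, Bd m C u → C ≤ C' → Bd m C' u

/-- Differences of approximants near two points of the ball, b₀ + tb and b₀, approximate tb;
rescaling by 1/t gives a bound linear in ‖b‖ with arbitrarily small error. -/
theorem exists_dense_bound {Bd : ℕ → ℝ → U → Prop} (hBd : BoundSystem Bd)
    {S : Submodule ℝ (X × U)} {m : ℕ} {A : ℝ}
    (h : (interior (closure {b : X | ∃ u, (b, u) ∈ S ∧ Bd m A u})).Nonempty) :
    ∃ K : ℝ, 1 ≤ K ∧ ∀ b : X, ∀ δ > 0, ∃ p ∈ S, Bd m (K * ‖b‖) p.2 ∧ ‖b - p.1‖ < δ := by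
  obtain ⟨b₀, hb₀⟩ := h
  obtain ⟨r, hr, hball⟩ := Metric.mem_nhds_iff.1 (mem_interior_iff_mem_nhds.1 hb₀)
  obtain ⟨c₀, ⟨w₀, hw₀, hw₀B⟩⟩ := (closure_nonempty_iff.1 ⟨b₀, interior_subset hb₀⟩)
  have key : ∀ b : X, b ≠ 0 → ∀ δ > 0, ∃ p ∈ S,
      Bd m ((4 * A / r) * ‖b‖) p.2 ∧ ‖b - p.1‖ < δ := by
    intro b hb δ hδ
    have hbn : 0 < ‖b‖ := norm_pos_iff.2 hb
    -- Chosen so that tb has norm r/2, which keeps b₀ + tb inside the ball of radius r.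
    set t : ℝ := r / (2 * ‖b‖) with ht
    have ht0 : 0 < t := by positivity
    have h1 : b₀ + t • b ∈ closure {b : X | ∃ u, (b, u) ∈ S ∧ Bd m A u} := by
      apply hball
      rw [Metric.mem_ball, dist_eq_norm, add_sub_cancel_left, norm_smul, Real.norm_eq_abs,
        abs_of_pos ht0, ht]
      have : r / (2 * ‖b‖) * ‖b‖ = r / 2 := by field_simp
      linarith
    have h2 : b₀ ∈ closure {b : X | ∃ u, (b, u) ∈ S ∧ Bd m A u} := interior_subset hb₀
    obtain ⟨c₁, ⟨u₁, hu₁, hB₁⟩, hd₁⟩ := Metric.mem_closure_iff.1 h1 (t * δ / 2) (by positivity)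
    obtain ⟨c₂, ⟨u₂, hu₂, hB₂⟩, hd₂⟩ := Metric.mem_closure_iff.1 h2 (t * δ / 2) (by positivity)
    refine ⟨t⁻¹ • ((c₁, u₁) - (c₂, u₂)), S.smul_mem _ (S.sub_mem hu₁ hu₂), ?_, ?_⟩
    · have := hBd.smul t⁻¹ (hBd.sub hB₁ hB₂)
      have e : |t⁻¹| * (A + A) = 4 * A / r * ‖b‖ := by
        rw [abs_of_pos (inv_pos.2 ht0), ht]; field_simp; ring
      rw [e] at this
      exact this
    · rw [dist_eq_norm] at hd₁ hd₂
      have e : b - (t⁻¹ • ((c₁, u₁) - (c₂, u₂)) : X × U).1 =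
          t⁻¹ • ((b₀ + t • b - c₁) - (b₀ - c₂)) := by
        simp only [Prod.smul_fst, Prod.fst_sub, smul_sub, smul_add, inv_smul_smul₀ ht0.ne']
        abel
      rw [e, norm_smul, Real.norm_eq_abs, abs_of_pos (inv_pos.2 ht0)]
      have h3 : ‖(b₀ + t • b - c₁) - (b₀ - c₂)‖ < t * δ := by
        refine (norm_sub_le _ _).trans_lt ?_
        linarith
      calc t⁻¹ * ‖(b₀ + t • b - c₁) - (b₀ - c₂)‖ < t⁻¹ * (t * δ) := by gcongr
        _ = δ := by field_simp
  refine ⟨max 1 (4 * A / r), le_max_left _ _, fun b δ hδ => ?_⟩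
  rcases eq_or_ne b 0 with rfl | hb
  · refine ⟨0, S.zero_mem, ?_, by simpa using hδ⟩
    have := hBd.smul 0 hw₀B
    simpa using this
  · obtain ⟨p, hp, hpB, hpd⟩ := key b hb δ hδ
    exact ⟨p, hp, hBd.mono hpB (by gcongr; exact le_max_right _ _), hpd⟩

/-- An open mapping theorem for countably many linear relations, of which the union of the
domains is a Banach space. -/
theorem exists_uniform_solution [CompleteSpace X] {Bd : ℕ → ℝ → U → Prop}
    (hBd : BoundSystem Bd) (S : ℕ → Submodule ℝ (X × U))
    (hfin : ∀ ν, ∀ p ∈ S ν, ∀ m, ∃ C, Bd m C p.2) (hcover : ∀ b, ∃ ν u, (b, u) ∈ S ν)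
    (hsum : ∀ ν A (p : ℕ → X × U) b, (∀ i, p i ∈ S ν) → HasSum (fun i => (p i).1) b →
      (∀ i, Bd (i + 1) (A * (1 / 2) ^ i) (p i).2) → ∃ u, (b, u) ∈ S ν ∧ Bd 1 (2 * A) u) :
    ∃ ν A, ∀ b : X, ‖b‖ ≤ 1 → ∃ u, (b, u) ∈ S ν ∧ Bd 1 A u := by
  -- One ν must work for all orders m. If every ν failed at some order m ν, the closed sets indexed
  -- by (ν, N) at that order would cover X with empty interiors, against Baire's theorem.
  obtain ⟨ν, hν⟩ : ∃ ν, ∀ m, ∃ N : ℕ,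
      (interior (closure {b : X | ∃ u, (b, u) ∈ S ν ∧ Bd m N u})).Nonempty := by
    by_contra hcon
    push Not at hcon
    choose m hm using hcon
    obtain ⟨⟨ν, N⟩, hN⟩ := nonempty_interior_of_iUnion_of_closed
      (f := fun q : ℕ × ℕ => closure {b : X | ∃ u, (b, u) ∈ S q.1 ∧ Bd (m q.1) q.2 u})
      (fun _ => isClosed_closure) (by
        refine eq_univ_of_forall fun b => ?_
        obtain ⟨ν, u, hu⟩ := hcover b
        obtain ⟨C, hC⟩ := hfin ν _ hu (m ν)
        obtain ⟨N, hN⟩ := exists_nat_ge C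
        exact mem_iUnion.2 ⟨(ν, N), subset_closure ⟨u, hu, hBd.mono hC hN⟩⟩)
    exact hN.ne_empty (hm ν N)
  choose N hN using hν
  choose K hK1 hK using fun m => exists_dense_bound hBd (hN m)
  have hK0 : ∀ m, 0 < K m := fun m => one_pos.trans_le (hK1 m)
  let δ : ℕ → ℝ := fun i => (1 / 2) ^ i / K (i + 1)
  have hδ : ∀ i, 0 < δ i := fun i => div_pos (by positivity) (hK0 _)
  -- Step i of the successive approximation uses the seminorm of order i + 1. Its remainder is made
  -- small against K (i + 2), the constant of the following step, so that the corrections are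
  -- bounded geometrically in seminorms of growing order.
  choose g hgS hgB hgd using fun (i : ℕ) (b : X) => hK (i + 1) b (δ (i + 1)) (hδ _)
  refine ⟨ν, 2 * K 1, fun b hb => ?_⟩
  let r : ℕ → X := fun i => Nat.rec b (fun i x => x - (g i x).1) i
  have hr : ∀ i, r (i + 1) = r i - (g i (r i)).1 := fun i => rfl
  have hrn : ∀ i, K (i + 1) * ‖r i‖ ≤ K 1 * (1 / 2) ^ i := by
    intro i
    cases i with
    | zero =>
      have h0 : r 0 = b := rfl
      simpa [h0] using mul_le_mul_of_nonneg_left hb (hK0 1).le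
    | succ i =>
      have h1 : ‖r (i + 1)‖ ≤ (1 / 2) ^ (i + 1) / K (i + 1 + 1) := by
        rw [hr]; exact (hgd i (r i)).le
      rw [le_div_iff₀ (hK0 _), mul_comm] at h1
      refine h1.trans ?_
      have : (0 : ℝ) < (1 / 2) ^ (i + 1) := by positivity
      nlinarith [hK1 1]
  have hrn' : ∀ i, ‖r i‖ ≤ K 1 * (1 / 2) ^ i := by
    intro i
    refine le_trans ?_ (hrn i)
    nlinarith [hK1 (i + 1), norm_nonneg (r i)]
  have hgeo : Summable fun i : ℕ => K 1 * (1 / 2 : ℝ) ^ i :=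
    (summable_geometric_two).mul_left _
  have hr0 : Tendsto r atTop (𝓝 0) :=
    squeeze_zero_norm hrn' hgeo.tendsto_atTop_zero
  have hpart : ∀ n, ∑ i ∈ Finset.range n, (g i (r i)).1 = b - r n := by
    intro n
    induction n with
    | zero => simp [r]
    | succ n ih => rw [Finset.sum_range_succ, ih, hr]; abel
  have hsm : Summable fun i => (g i (r i)).1 := by
    refine Summable.of_norm_bounded (hgeo.mul_left 2) fun i => ?_
    have e : (g i (r i)).1 = r i - r (i + 1) := by rw [hr]; abel
    rw [e]
    refine (norm_sub_le _ _).trans ?_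
    have h1 := hrn' i
    have h2 := hrn' (i + 1)
    rw [pow_succ] at h2
    have : 0 < K 1 * (1 / 2) ^ i := mul_pos (hK0 1) (by positivity)
    linarith
  have hhs : HasSum (fun i => (g i (r i)).1) b := by
    rw [hsm.hasSum_iff_tendsto_nat]
    simp only [hpart]
    simpa using tendsto_const_nhds.sub hr0
  exact hsum ν (K 1) (fun i => g i (r i)) b (fun i => hgS i _) hhs
    fun i => hBd.mono (hgB i (r i)) (hrn i)

end OpenMapping

/-! ### Series of smooth functions and superpositions with bounded coefficients -/

section Series

variable {E : Type} [NormedAddCommGroup E] [NormedSpace ℝ E] {u : ℕ → E → ℂ} {v : ℕ → ℕ → ℝ}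

theorem contDiff_series (hu : ∀ i, ContDiff ℝ ∞ (u i)) (hv : ∀ m, Summable (v m))
    (h : ∀ m i x, ‖iteratedFDeriv ℝ m (u i) x‖ ≤ v m i) :
    ContDiff ℝ ∞ fun x => ∑' i, u i x :=
  contDiff_tsum (N := (⊤ : ℕ∞)) hu (fun m _ => hv m) fun m i x _ => h m i x

theorem norm_iteratedFDeriv_series_le (hu : ∀ i, ContDiff ℝ ∞ (u i)) (hv : ∀ m, Summable (v m))
    (h : ∀ m i x, ‖iteratedFDeriv ℝ m (u i) x‖ ≤ v m i) (m : ℕ) (x : E) :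
    ‖iteratedFDeriv ℝ m (fun x => ∑' i, u i x) x‖ ≤ ∑' i, v m i := by
  rw [iteratedFDeriv_tsum_apply (N := (⊤ : ℕ∞)) hu (fun m _ => hv m) (fun m i x _ => h m i x)
    (by exact_mod_cast le_top)]
  exact tsum_of_norm_bounded (hv m).hasSum fun i => h m i x

theorem summable_series (hv : ∀ m, Summable (v m))
    (h : ∀ m i x, ‖iteratedFDeriv ℝ m (u i) x‖ ≤ v m i) (x : E) : Summable fun i => u i x :=
  Summable.of_norm_bounded (hv 0) fun i => by simpa using h 0 i x

theorem hasFDerivAt_series (hu : ∀ i, ContDiff ℝ ∞ (u i)) (hv : ∀ m, Summable (v m))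
    (h : ∀ m i x, ‖iteratedFDeriv ℝ m (u i) x‖ ≤ v m i) (x : E) :
    HasFDerivAt (fun x => ∑' i, u i x) (∑' i, fderiv ℝ (u i) x) x :=
  hasFDerivAt_tsum (hv 1)
    (fun i x => ((hu i).differentiable (by simp)).differentiableAt.hasFDerivAt)
    (fun i x => by rw [← norm_iteratedFDeriv_one]; exact h 1 i x) (summable_series hv h 0) x

theorem crDeriv_series (X Y : E → E) (hu : ∀ i, ContDiff ℝ ∞ (u i)) (hv : ∀ m, Summable (v m))
    (h : ∀ m i x, ‖iteratedFDeriv ℝ m (u i) x‖ ≤ v m i) (x : E) :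
    HasSum (fun i => crDeriv X Y (u i) x) (crDeriv X Y (fun x => ∑' i, u i x) x) := by
  have hs : Summable fun i => fderiv ℝ (u i) x :=
    Summable.of_norm_bounded (hv 1) fun i => by rw [← norm_iteratedFDeriv_one]; exact h 1 i x
  rw [crDeriv, (hasFDerivAt_series hu hv h x).fderiv]
  have e : ∀ w, HasSum (fun i => fderiv ℝ (u i) x w) ((∑' i, fderiv ℝ (u i) x) w) := fun w =>
    (ContinuousLinearMap.apply ℝ ℂ w).hasSum hs.hasSum
  exact (e (X x)).add ((e (Y x)).mul_left _)

/-- The combination `∑ j, b j • f j` of a sequence of functions. -/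
noncomputable def superpose (f : ℕ → E → ℂ) (b : ℕ →ᵇ ℝ) (x : E) : ℂ := ∑' j, b j • f j x

variable {f : ℕ → E → ℂ}

theorem superpose_bound (hf : ∀ i, ContDiff ℝ ∞ (f i))
    (h : ∀ m i x, ‖iteratedFDeriv ℝ m (f i) x‖ ≤ v m i) (b : ℕ →ᵇ ℝ) (m i : ℕ) (x : E) :
    ‖iteratedFDeriv ℝ m (fun x => b i • f i x) x‖ ≤ ‖b‖ * v m i := by
  rw [show (fun x => b i • f i x) = b i • f i from rfl, iteratedFDeriv_const_smul_apply
    ((hf i).of_le (by exact_mod_cast le_top)).contDiffAt, norm_smul]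
  exact mul_le_mul (b.norm_coe_le_norm i) (h m i x) (norm_nonneg _) (norm_nonneg _)

theorem contDiff_superpose (hf : ∀ i, ContDiff ℝ ∞ (f i)) (hv : ∀ m, Summable (v m))
    (h : ∀ m i x, ‖iteratedFDeriv ℝ m (f i) x‖ ≤ v m i) (b : ℕ →ᵇ ℝ) :
    ContDiff ℝ ∞ (superpose f b) :=
  contDiff_series (fun i => (hf i).const_smul (b i)) (fun m => (hv m).mul_left ‖b‖)
    (superpose_bound hf h b)

theorem crDeriv_superpose (X Y : E → E) (hf : ∀ i, ContDiff ℝ ∞ (f i))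
    (hv : ∀ m, Summable (v m)) (h : ∀ m i x, ‖iteratedFDeriv ℝ m (f i) x‖ ≤ v m i)
    (b : ℕ →ᵇ ℝ) (x : E) :
    crDeriv X Y (superpose f b) x = superpose (fun i => crDeriv X Y (f i)) b x := by
  have := crDeriv_series X Y (fun i => (hf i).const_smul (b i)) (fun m => (hv m).mul_left ‖b‖)
    (superpose_bound hf h b) x
  refine this.tsum_eq.symm.trans (tsum_congr fun i => ?_)
  have := crDeriv_const_mul (X := X) (Y := Y) (b i : ℂ)
    ((hf i).differentiable (by simp)).differentiableAt (x := x)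
  simpa only [← Complex.real_smul] using this

theorem summable_superpose (hv : ∀ m, Summable (v m))
    (h : ∀ m i x, ‖iteratedFDeriv ℝ m (f i) x‖ ≤ v m i) (b : ℕ →ᵇ ℝ) (x : E) :
    Summable fun j => b j • f j x :=
  Summable.of_norm_bounded ((hv 0).mul_left ‖b‖) fun i => by
    rw [norm_smul]
    exact mul_le_mul (b.norm_coe_le_norm i) (by simpa using h 0 i x) (norm_nonneg _)
      (norm_nonneg _)

/-- The value of the superposition at a point, as a function of the coefficients. -/
noncomputable def superposeCLM (hv : ∀ m, Summable (v m))
    (h : ∀ m i x, ‖iteratedFDeriv ℝ m (f i) x‖ ≤ v m i) (x : E) : (ℕ →ᵇ ℝ) →L[ℝ] ℂ :=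
  LinearMap.mkContinuous
    { toFun := fun b => superpose f b x
      map_add' := fun b c => by
        rw [superpose, superpose, superpose, ← (summable_superpose hv h b x).tsum_add
          (summable_superpose hv h c x)]
        exact tsum_congr fun i => by simp [add_mul]
      map_smul' := fun t b => by
        rw [superpose, superpose, RingHom.id_apply, ← tsum_const_smul'']
        exact tsum_congr fun i => by simp [mul_assoc] }
    (∑' i, v 0 i) fun b => by
      have := tsum_of_norm_bounded ((hv 0).mul_left ‖b‖).hasSum fun i =>
        (norm_smul (b i) (f i x)).le.trans (mul_le_mul (b.norm_coe_le_norm i)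
          (by simpa using h 0 i x) (norm_nonneg _) (norm_nonneg _))
      rw [tsum_mul_left, mul_comm] at this
      exact this

end Series

/-! ### Uniform bounds on derivatives -/

section SupBound

variable {E : Type} [NormedAddCommGroup E] [NormedSpace ℝ E]

/-- `u` is smooth and its derivatives up to the order `m` are bounded by `A`. -/
def SmoothBound (m : ℕ) (A : ℝ) (u : E → ℂ) : Prop :=
  ContDiff ℝ ∞ u ∧ ∀ k ≤ m, ∀ x, ‖iteratedFDeriv ℝ k u x‖ ≤ A

theorem boundSystem_smoothBound : BoundSystem (SmoothBound (E := E)) where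
  smul {m C u} t := by
    rintro ⟨hu, h⟩
    refine ⟨hu.const_smul t, fun k hk x => ?_⟩
    rw [iteratedFDeriv_const_smul_apply
      (hu.of_le (by exact_mod_cast le_top)).contDiffAt, norm_smul]
    exact mul_le_mul_of_nonneg_left (h k hk x) (abs_nonneg t)
  sub {m C C' u v} := by
    rintro ⟨hu, h⟩ ⟨hv, h'⟩
    refine ⟨hu.sub hv, fun k hk x => ?_⟩
    rw [iteratedFDeriv_sub_apply (hu.of_le (by exact_mod_cast le_top)).contDiffAt
      (hv.of_le (by exact_mod_cast le_top)).contDiffAt]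
    exact (norm_sub_le _ _).trans (add_le_add (h k hk x) (h' k hk x))
  mono h hC := ⟨h.1, fun k hk x => (h.2 k hk x).trans hC⟩

theorem crDeriv_real_smul {X Y : E → E} {u : E → ℂ} (t : ℝ) {x : E}
    (hu : DifferentiableAt ℝ u x) : crDeriv X Y (t • u) x = t • crDeriv X Y u x := by
  rw [crDeriv, fderiv_const_smul hu]
  simp only [smul_apply, crDeriv, Complex.real_smul]
  ring

theorem exists_smoothBound {u : E → ℂ} (hu : ContDiff ℝ ∞ u) (hs : HasCompactSupport u) (m : ℕ) :
    ∃ A, SmoothBound m A u := by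
  have hb : ∀ k : ℕ, ∃ B, ∀ x, ‖iteratedFDeriv ℝ k u x‖ ≤ B := fun k =>
    (hu.continuous_iteratedFDeriv (by exact_mod_cast le_top)).bounded_above_of_compact_support
      (hs.iteratedFDeriv k)
  choose B hB using hb
  exact ⟨∑ k ∈ Finset.range (m + 1), |B k|, hu, fun k hk x => (hB k x).trans
    ((le_abs_self _).trans (Finset.single_le_sum (f := fun k => |B k|)
      (fun _ _ => abs_nonneg _) (Finset.mem_range.2 (by omega))))⟩

end SupBound

/-! ### From the Poincaré lemma to solutions with prescribed differential -/

namespace FlatFrame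

variable {ι E : Type} [DecidableEq ι] [NormedAddCommGroup E]

section Solutions

variable [NormedSpace ℝ E] (C : FlatFrame ι E)

/-- The Poincaré lemma at the origin for the operators `D k`. -/
def PoincareLemma : Prop :=
  ∀ F : ι → E → ℂ, (∀ k, ContDiff ℝ ∞ (F k)) →
    (∀ x ∈ Metric.ball (0 : E) C.r, ∀ l k, C.D l (F k) x = C.D k (F l) x) →
    ∃ u, ContDiff ℝ ∞ u ∧ ∀ᶠ x in 𝓝 0, ∀ k, C.D k u x = F k x

variable {f : ι → ℕ → E → ℂ} {v : ℕ → ℕ → ℝ}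

/-- The pairs `(b, u)` for which `u` has bounded derivatives and solves `D k u = ∑ b j • f k j` on
the ball of radius `1 / (ν + 1)`. -/
noncomputable def solutions (hv : ∀ m, Summable (v m))
    (h : ∀ k m i x, ‖iteratedFDeriv ℝ m (f k i) x‖ ≤ v m i) (ν : ℕ) :
    Submodule ℝ ((ℕ →ᵇ ℝ) × (E → ℂ)) where
  carrier := {p | (∀ m, ∃ A, SmoothBound m A p.2) ∧
    ∀ x ∈ Metric.ball (0 : E) (1 / (ν + 1)), ∀ k, C.D k p.2 x = superposeCLM hv (h k) x p.1}
  add_mem' := by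
    rintro ⟨b, u⟩ ⟨c, w⟩ ⟨hu1, hu2⟩ ⟨hw1, hw2⟩
    refine ⟨fun m => ?_, fun x hx k => ?_⟩
    · obtain ⟨A, hA⟩ := hu1 m
      obtain ⟨A', hA'⟩ := hw1 m
      have := boundSystem_smoothBound.sub hA (boundSystem_smoothBound.smul (-1) hA')
      rw [neg_one_smul, sub_neg_eq_add] at this
      exact ⟨_, this⟩
    · obtain ⟨A, hA, -⟩ := hu1 0
      obtain ⟨A', hA', -⟩ := hw1 0
      rw [Prod.mk_add_mk, map_add, ← hu2 x hx k, ← hw2 x hx k]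
      exact crDeriv_add (hA.differentiable (by simp)).differentiableAt
        (hA'.differentiable (by simp)).differentiableAt
  zero_mem' := by
    refine ⟨fun m => ⟨0, contDiff_const, fun k _ x => ?_⟩, fun x _ k => ?_⟩
    · change ‖iteratedFDeriv ℝ k (fun _ : E => (0 : ℂ)) x‖ ≤ 0
      simp
    · change C.D k (fun _ => 0) x = superposeCLM hv (h k) x 0
      simp [D, crDeriv]
  smul_mem' := by
    rintro t ⟨b, u⟩ ⟨hu1, hu2⟩
    refine ⟨fun m => ?_, fun x hx k => ?_⟩
    · obtain ⟨A, hA⟩ := hu1 m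
      exact ⟨_, boundSystem_smoothBound.smul t hA⟩
    · obtain ⟨A, hA, -⟩ := hu1 0
      rw [Prod.smul_mk, map_smul, ← hu2 x hx k]
      exact crDeriv_real_smul t (hA.differentiable (by simp)).differentiableAt

/-- The order of the controlled derivatives grows with i, so each fixed derivative of the series is
eventually dominated by a geometric series. The sum is smooth and D k acts termwise. -/
theorem solutions_sum (hv : ∀ m, Summable (v m))
    (h : ∀ k m i x, ‖iteratedFDeriv ℝ m (f k i) x‖ ≤ v m i) (ν : ℕ) (A : ℝ)
    (p : ℕ → (ℕ →ᵇ ℝ) × (E → ℂ)) (b : ℕ →ᵇ ℝ) (hp : ∀ i, p i ∈ C.solutions hv h ν)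
    (hb : HasSum (fun i => (p i).1) b)
    (hB : ∀ i, SmoothBound (i + 1) (A * (1 / 2) ^ i) (p i).2) :
    ∃ u, (b, u) ∈ C.solutions hv h ν ∧ SmoothBound 1 (2 * A) u := by
  choose M hM using fun i m => (hp i).1 m
  -- For fixed m only finitely many i fall in the second case, where any finite bound will do.
  let w : ℕ → ℕ → ℝ := fun m i => if m ≤ i + 1 then A * (1 / 2) ^ i else M i m
  have hgeo : HasSum (fun i : ℕ => A * (1 / 2 : ℝ) ^ i) (2 * A) := by
    rw [mul_comm 2 A]
    exact hasSum_geometric_two.mul_left A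
  have hw : ∀ m, Summable (w m) := fun m => by
    refine (summable_congr_cofinite ?_).1 hgeo.summable
    filter_upwards [(Set.finite_lt_nat m).compl_mem_cofinite] with i hi
    have : m ≤ i + 1 := by simp at hi; omega
    simp only [w, if_pos this]
  have hs : ∀ i, ContDiff ℝ ∞ (p i).2 := fun i => (hB i).1
  have hbd : ∀ m i x, ‖iteratedFDeriv ℝ m (p i).2 x‖ ≤ w m i := by
    intro m i x
    simp only [w]
    split_ifs with hmi
    · exact (hB i).2 m hmi x
    · exact (hM i m).2 m le_rfl x
  have hu := contDiff_series hs hw hbd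
  have hub := norm_iteratedFDeriv_series_le hs hw hbd
  refine ⟨fun x => ∑' i, (p i).2 x, ⟨fun m => ?_, fun x hx k => ?_⟩, hu, ?_⟩
  · refine ⟨∑ k ∈ Finset.range (m + 1), |∑' i, w k i|, hu, fun k hk x => (hub k x).trans ?_⟩
    exact (le_abs_self _).trans (Finset.single_le_sum (f := fun k => |∑' i, w k i|)
      (fun _ _ => abs_nonneg _) (Finset.mem_range.2 (by omega)))
  · have h1 := crDeriv_series (C.X k) (C.Y k) hs hw hbd x
    have h2 := (superposeCLM hv (h k) x).hasSum hb
    refine h1.unique ?_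
    convert h2 using 2 with i
    exact (hp i).2 x hx k
  · intro k hk x
    refine (hub k x).trans (le_of_eq ?_)
    rw [← hgeo.tsum_eq]
    exact tsum_congr fun i => if_pos (by omega)

end Solutions

variable [InnerProductSpace ℝ E] [FiniteDimensional ℝ E] (C : FlatFrame ι E)

/-- If the Poincaré lemma holds, then a summable sequence of right hand sides has solutions on the
same ball, with bounded differential at the origin. -/
theorem exists_bounded_solutions (hPL : C.PoincareLemma) {f : ι → ℕ → E → ℂ} {v : ℕ → ℕ → ℝ}
    (hf : ∀ k j, ContDiff ℝ ∞ (f k j)) (hv : ∀ m, Summable (v m))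
    (h : ∀ k m i x, ‖iteratedFDeriv ℝ m (f k i) x‖ ≤ v m i)
    (hclosed : ∀ j, ∀ x ∈ Metric.ball (0 : E) C.r, ∀ l k, C.D l (f k j) x = C.D k (f l j) x) :
    ∃ A, ∀ j, ∃ u, ContDiff ℝ ∞ u ∧ (∀ᶠ x in 𝓝 0, ∀ k, C.D k u x = f k j x) ∧
      ‖fderiv ℝ u 0‖ ≤ A := by
  obtain ⟨ν, A, hA⟩ := exists_uniform_solution boundSystem_smoothBound (C.solutions hv h)
    (fun ν p hp m => hp.1 m) (fun b => by
      obtain ⟨u, hu, hu'⟩ := hPL (fun k => superpose (f k) b)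
        (fun k => contDiff_superpose (hf k) hv (h k) b) (fun x hx l k => by
          rw [D, D, crDeriv_superpose _ _ (hf k) hv (h k), crDeriv_superpose _ _ (hf l) hv (h l)]
          exact tsum_congr fun j => congrArg _ (hclosed j x hx l k))
      -- Multiplying by a cutoff keeps the equation near 0 and makes all derivatives bounded on E.
      -- The equation then holds on some ball of radius 1/(ν + 1).
      let χ : ContDiffBump (0 : E) := ⟨1, 2, one_pos, one_lt_two⟩
      let w : E → ℂ := fun x => (χ x : ℂ) * u x
      have hw : ContDiff ℝ ∞ w := (Complex.ofRealCLM.contDiff.comp χ.contDiff).mul hu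
      have hws : HasCompactSupport w :=
        χ.hasCompactSupport.mono' fun x hx => subset_tsupport _ fun h0 => hx (by simp [w, h0])
      have hwu : w =ᶠ[𝓝 0] u := by
        filter_upwards [χ.eventuallyEq_one] with x hx
        simp [w, hx]
      have hev : ∀ᶠ x in 𝓝 0, ∀ k, C.D k w x = superpose (f k) b x := by
        filter_upwards [hu', hwu.fderiv (𝕜 := ℝ)] with x hx hx' k
        rw [← hx k, D, crDeriv, hx']
        rfl
      obtain ⟨δ, hδ, hball⟩ := Metric.eventually_nhds_iff_ball.1 hev
      obtain ⟨ν, hν⟩ := exists_nat_one_div_lt hδ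
      exact ⟨ν, w, fun m => exists_smoothBound hw hws m,
        fun x hx k => hball x (Metric.ball_subset_ball hν.le hx) k⟩)
    (C.solutions_sum hv h)
  refine ⟨A, fun j => ?_⟩
  -- The unit sequence at j lies in the unit ball, and its superposition is the single function f k
  -- j; so one bound A serves all j.
  let e : ℕ →ᵇ ℝ := BoundedContinuousFunction.ofNormedAddCommGroupDiscrete
    (fun i => if i = j then 1 else 0) 1 (fun i => by split_ifs <;> simp)
  have he : ∀ i, e i = if i = j then 1 else 0 := fun i => rfl
  obtain ⟨u, hu, hu'⟩ := hA e ((BoundedContinuousFunction.norm_le zero_le_one).2 fun i => by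
    rw [he]; split_ifs <;> simp)
  refine ⟨u, hu'.1, ?_, ?_⟩
  · filter_upwards [Metric.ball_mem_nhds (0 : E) (by positivity : (0 : ℝ) < 1 / (ν + 1))]
      with x hx k
    refine (hu.2 x hx k).trans ?_
    change superpose (f k) e x = _
    rw [superpose, tsum_eq_single j (fun i hi => by rw [he, if_neg hi, zero_smul]), he, if_pos rfl,
      one_smul]
  · rw [← norm_iteratedFDeriv_one]
    exact hu'.2 1 le_rfl 0

variable [Fintype ι]

/-- Every covector annihilating the fields at the origin is a limit of differentials of solutions
of `D k h = 0`. -/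
theorem exists_solution_near (hPL : C.PoincareLemma) (hinj : ∀ c, C.combX c 0 = 0 → c = 0)
    {ξ : E →L[ℝ] ℝ} (hX : ∀ j, ξ (C.X j 0) = 0) (hY : ∀ j, ξ (C.Y j 0) = 0)
    (hL : ∀ c, c ≠ 0 → 0 < ξ (VectorField.lieBracket ℝ (C.combY c) (C.combX c) 0))
    {θ : E →L[ℝ] ℂ} (hθ : ∀ j, θ (C.X j 0) + Complex.I * θ (C.Y j 0) = 0) {ε : ℝ}
    (hε : 0 < ε) :
    ∃ h : E → ℂ, ContDiff ℝ ∞ h ∧ (∀ᶠ x in 𝓝 0, ∀ k, C.D k h x = 0) ∧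
      ‖fderiv ℝ h 0 - θ‖ < ε := by
  -- The factor 1/(j + 1) offsets the multiplication by j + 1 below; what remains, (1/2)^j, is
  -- summable.
  choose g hg hgs hgθ hgb using fun j : ℕ => C.exists_small hinj hX hY hL hθ j
    (ε := (1 / 2) ^ j / (j + 1)) (by positivity)
  let f : ι → ℕ → E → ℂ := fun k j => ((j : ℝ) + 1) • C.D k (g j)
  have hDg : ∀ k j, ContDiff ℝ ∞ (C.D k (g j)) := fun k j => C.contDiff_D k (hg j)
  have hf : ∀ k j, ContDiff ℝ ∞ (f k j) := fun k j => (hDg k j).const_smul ((j : ℝ) + 1)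
  have hfs : ∀ k j, HasCompactSupport (f k j) := fun k j =>
    (hgs j).crDeriv.mono' fun x hx => subset_tsupport _ fun h0 => hx (by
      change ((j : ℝ) + 1) • C.D k (g j) x = 0
      rw [D, h0, smul_zero])
  have hb : ∀ (k : ι) (m j : ℕ), ∃ B, ∀ x, ‖iteratedFDeriv ℝ m (f k j) x‖ ≤ B := fun k m j =>
    ((hf k j).continuous_iteratedFDeriv
      (by exact_mod_cast le_top)).bounded_above_of_compact_support ((hfs k j).iteratedFDeriv m)
  choose B hB using hb
  -- The smallness of D k (g j) is known only up to order j. The finitely many j < m are bounded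
  -- through compact support.
  let v : ℕ → ℕ → ℝ := fun m j => if m ≤ j then (1 / 2) ^ j else ∑ k, |B k m j|
  have hv : ∀ m, Summable (v m) := fun m => by
    refine (summable_congr_cofinite ?_).1 summable_geometric_two
    filter_upwards [(Set.finite_lt_nat m).compl_mem_cofinite] with i hi
    have : m ≤ i := by simpa using hi
    simp only [v, if_pos this]
  have hfv : ∀ k m i x, ‖iteratedFDeriv ℝ m (f k i) x‖ ≤ v m i := by
    intro k m j x
    simp only [v]
    split_ifs with hmj
    · change ‖iteratedFDeriv ℝ m (((j : ℝ) + 1) • C.D k (g j)) x‖ ≤ _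
      rw [iteratedFDeriv_const_smul_apply
        ((hDg k j).of_le (by exact_mod_cast le_top)).contDiffAt, norm_smul, Real.norm_eq_abs,
        abs_of_pos (by positivity)]
      have := mul_le_mul_of_nonneg_left (hgb j k m hmj x) (by positivity : (0 : ℝ) ≤ j + 1)
      rwa [mul_div_cancel₀ _ (by positivity)] at this
    · exact (hB k m j x).trans ((le_abs_self _).trans (Finset.single_le_sum
        (f := fun k => |B k m j|) (fun _ _ => abs_nonneg _) (Finset.mem_univ k)))
  obtain ⟨A, hA⟩ := C.exists_bounded_solutions hPL hf hv hfv (fun j x hx l k => by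
    have e : ∀ l k, C.D l (f k j) x = ((j : ℝ) + 1) • C.D l (C.D k (g j)) x := fun l k =>
      crDeriv_real_smul _ ((hDg k j).differentiable (by simp)).differentiableAt
    rw [e, e]
    exact congrArg _ (C.comm (g j) (hg j) x hx l k))
  obtain ⟨j, hj⟩ := exists_nat_gt (A / ε)
  obtain ⟨u, hu, hu', huA⟩ := hA j
  have hj0 : (0 : ℝ) < j + 1 := by positivity
  have hus : ContDiff ℝ ∞ (((j : ℝ) + 1)⁻¹ • u) :=
    hu.const_smul ((j : ℝ) + 1)⁻¹
  -- Since u solves the equation with right-hand side (j + 1) D k (g j), the correction u/(j + 1)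
  -- cancels D k (g j), and its differential at 0 is at most A/(j + 1) < ε.
  refine ⟨g j - ((j : ℝ) + 1)⁻¹ • u, (hg j).sub hus, ?_, ?_⟩
  · filter_upwards [hu'] with x hx k
    rw [D, crDeriv_sub ((hg j).differentiable (by simp)).differentiableAt
      (hus.differentiable (by simp)).differentiableAt]
    rw [crDeriv_real_smul _ (hu.differentiable (by simp)).differentiableAt]
    change C.D k (g j) x - _ • C.D k u x = 0
    rw [hx k]
    change C.D k (g j) x - _ • (((j : ℝ) + 1) • C.D k (g j) x) = 0
    rw [smul_smul, inv_mul_cancel₀ hj0.ne', one_smul, sub_self]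
  · rw [fderiv_sub ((hg j).differentiable (by simp)).differentiableAt
      (hus.differentiable (by simp)).differentiableAt, hgθ,
      fderiv_const_smul (hu.differentiable (by simp)).differentiableAt, sub_sub_cancel_left,
      norm_neg, norm_smul, Real.norm_eq_abs, abs_of_pos (by positivity), inv_mul_lt_iff₀ hj0]
    refine huA.trans_lt ?_
    rw [div_lt_iff₀ hε] at hj
    linarith

/-- Every covector annihilating the fields at the origin is the differential of a solution of
`D k h = 0`. -/
theorem exists_solution (hPL : C.PoincareLemma) (hinj : ∀ c, C.combX c 0 = 0 → c = 0)
    {ξ : E →L[ℝ] ℝ} (hX : ∀ j, ξ (C.X j 0) = 0) (hY : ∀ j, ξ (C.Y j 0) = 0)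
    (hL : ∀ c, c ≠ 0 → 0 < ξ (VectorField.lieBracket ℝ (C.combY c) (C.combX c) 0))
    {θ : E →L[ℝ] ℂ} (hθ : ∀ j, θ (C.X j 0) + Complex.I * θ (C.Y j 0) = 0) :
    ∃ h : E → ℂ, ContDiff ℝ ∞ h ∧ (∀ᶠ x in 𝓝 0, ∀ k, C.D k h x = 0) ∧ fderiv ℝ h 0 = θ := by
  let V : Submodule ℝ (E →L[ℝ] ℂ) :=
    { carrier := {η | ∃ h : E → ℂ, ContDiff ℝ ∞ h ∧ (∀ᶠ x in 𝓝 0, ∀ k, C.D k h x = 0) ∧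
        fderiv ℝ h 0 = η}
      add_mem' := by
        rintro _ _ ⟨h, hh, hD, rfl⟩ ⟨h', hh', hD', rfl⟩
        refine ⟨h + h', hh.add hh', ?_, fderiv_add (hh.differentiable (by simp)).differentiableAt
          (hh'.differentiable (by simp)).differentiableAt⟩
        filter_upwards [hD, hD'] with x hx hx' k
        rw [D, crDeriv_add (hh.differentiable (by simp)).differentiableAt
          (hh'.differentiable (by simp)).differentiableAt]
        exact (congrArg₂ _ (hx k) (hx' k)).trans (add_zero 0)
      zero_mem' := ⟨fun _ => 0, contDiff_const, Eventually.of_forall fun x k => by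
        simp [D, crDeriv], by simp⟩
      smul_mem' := by
        rintro t _ ⟨h, hh, hD, rfl⟩
        refine ⟨t • h, hh.const_smul t, ?_, fderiv_const_smul
          (hh.differentiable (by simp)).differentiableAt t⟩
        filter_upwards [hD] with x hx k
        exact (crDeriv_real_smul t (hh.differentiable (by simp)).differentiableAt).trans
          ((congrArg _ (hx k)).trans (smul_zero t)) }
  -- Finite dimension turns approximation into attainment: the attained differentials form a
  -- subspace, hence a closed set.
  have hcl : IsClosed (V : Set (E →L[ℝ] ℂ)) := V.closed_of_finiteDimensional
  have : θ ∈ closure (V : Set (E →L[ℝ] ℂ)) := Metric.mem_closure_iff.2 fun ε hε => by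
    obtain ⟨h, h1, h2, h3⟩ := C.exists_solution_near hPL hinj hX hY hL hθ hε
    exact ⟨_, ⟨h, h1, h2, rfl⟩, by rwa [dist_comm, dist_eq_norm]⟩
  rw [hcl.closure_eq] at this
  exact this

end FlatFrame

/-! ### Commutators of complex vector fields -/

section FlatIdentities

variable {E : Type} [NormedAddCommGroup E] [NormedSpace ℝ E]

/-- The commutator of the derivatives along two complex vector fields. -/
theorem crDeriv_commutator {A A' B B' : E → E} {u : E → ℂ} {x : E} (hA : ContDiffAt ℝ ∞ A x)
    (hA' : ContDiffAt ℝ ∞ A' x) (hB : ContDiffAt ℝ ∞ B x) (hB' : ContDiffAt ℝ ∞ B' x)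
    (hu : ContDiffAt ℝ ∞ u x) :
    crDeriv A A' (crDeriv B B' u) x - crDeriv B B' (crDeriv A A' u) x =
      fderiv ℝ u x (VectorField.lieBracket ℝ A B x - VectorField.lieBracket ℝ A' B' x) +
      Complex.I * fderiv ℝ u x
        (VectorField.lieBracket ℝ A B' x + VectorField.lieBracket ℝ A' B x) := by
  have hd : ContDiffAt ℝ ∞ (fderiv ℝ u) x := hu.fderiv_right (by simp)
  have hdd : DifferentiableAt ℝ (fderiv ℝ u) x := hd.differentiableAt (by simp)
  have hn : minSmoothness ℝ 2 ≤ (∞ : WithTop ℕ∞) := by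
    simpa using (WithTop.coe_le_coe.2 le_top : ((2 : ℕ∞) : WithTop ℕ∞) ≤ ∞)
  have key : ∀ {V W : E → E}, ContDiffAt ℝ ∞ V x → ContDiffAt ℝ ∞ W x →
      fderiv ℝ u x (VectorField.lieBracket ℝ V W x) =
      fderiv ℝ (fun x => fderiv ℝ u x (W x)) x (V x) -
        fderiv ℝ (fun x => fderiv ℝ u x (V x)) x (W x) := fun hV hW =>
    VectorField.fderiv_apply_lieBracket hu hn (hW.differentiableAt (by simp))
      (hV.differentiableAt (by simp))
  have hap : ∀ {V : E → E}, ContDiffAt ℝ ∞ V x →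
      DifferentiableAt ℝ (fun x => fderiv ℝ u x (V x)) x := fun hV =>
    hdd.clm_apply (hV.differentiableAt (by simp))
  have hcr : ∀ {V V' : E → E}, ContDiffAt ℝ ∞ V x → ContDiffAt ℝ ∞ V' x → ∀ w,
      fderiv ℝ (crDeriv V V' u) x w = fderiv ℝ (fun x => fderiv ℝ u x (V x)) x w +
        Complex.I * fderiv ℝ (fun x => fderiv ℝ u x (V' x)) x w := by
    intro V V' hV hV' w
    have := ((hap hV).hasFDerivAt.add ((hap hV').hasFDerivAt.const_mul Complex.I)).fderiv
    exact DFunLike.congr_fun this w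
  rw [map_sub, map_add, key hA hB, key hA' hB', key hA hB', key hA' hB, crDeriv, crDeriv,
    hcr hB hB', hcr hB hB', hcr hA hA', hcr hA hA']
  linear_combination (fderiv ℝ (fun x => fderiv ℝ u x (B' x)) x (A' x) -
    fderiv ℝ (fun x => fderiv ℝ u x (A' x)) x (B' x)) * Complex.I_mul_I

end FlatIdentities

/-! ### Vector fields, brackets and differentials in a chart -/

section Charts

variable {d : ℕ} {M : Type*} [TopologicalSpace M] [ChartedSpace (EuclideanSpace ℝ (Fin d)) M]
  [IsManifold (𝓡 d) ∞ M]

/-- A diffeomorphism of an open set of `M` onto an open set of Euclidean space. -/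
structure IsSmoothChart (e : OpenPartialHomeomorph M (EuclideanSpace ℝ (Fin d))) : Prop where
  contMDiffOn : ContMDiffOn (𝓡 d) (𝓡 d) ∞ e e.source
  contMDiffOn_symm : ContMDiffOn (𝓡 d) (𝓡 d) ∞ e.symm e.target

theorem exists_smoothChart (p : M) :
    ∃ e : OpenPartialHomeomorph M (EuclideanSpace ℝ (Fin d)), IsSmoothChart e ∧ p ∈ e.source ∧
      e p = 0 := by
  set c := chartAt (EuclideanSpace ℝ (Fin d)) p with hc
  refine ⟨c.transHomeomorph (Homeomorph.addRight (-c p)), ⟨?_, ?_⟩,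
    mem_chart_source _ p, by simp⟩
  · have h1 : ContMDiff (𝓡 d) (𝓡 d) ∞ fun x : EuclideanSpace ℝ (Fin d) => x + -c p :=
      (contDiff_id.add contDiff_const).contMDiff
    exact h1.comp_contMDiffOn (contMDiffOn_chart (I := 𝓡 d) (n := ∞) (x := p))
  · have h1 : ContMDiff (𝓡 d) (𝓡 d) ∞ fun x : EuclideanSpace ℝ (Fin d) => x + - -c p :=
      (contDiff_id.add contDiff_const).contMDiff
    exact (contMDiffOn_chart_symm (I := 𝓡 d) (n := ∞) (x := p)).comp h1.contMDiffOn
      fun x hx => hx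

/-- The vector field `V` in the chart `e`. -/
noncomputable def pushField (e : OpenPartialHomeomorph M (EuclideanSpace ℝ (Fin d)))
    (V : ∀ q : M, TangentSpace (𝓡 d) q) (x : EuclideanSpace ℝ (Fin d)) :
    EuclideanSpace ℝ (Fin d) :=
  VectorField.mpullback (𝓡 d) (𝓡 d) e.symm V x

namespace IsSmoothChart

variable {e : OpenPartialHomeomorph M (EuclideanSpace ℝ (Fin d))} (he : IsSmoothChart e)
include he

theorem mdifferentiable : e.MDifferentiable (𝓡 d) (𝓡 d) :=
  ⟨he.contMDiffOn.mdifferentiableOn (by simp), he.contMDiffOn_symm.mdifferentiableOn (by simp)⟩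

theorem contMDiffAt {q : M} (hq : q ∈ e.source) : ContMDiffAt (𝓡 d) (𝓡 d) ∞ e q :=
  he.contMDiffOn.contMDiffAt (e.open_source.mem_nhds hq)

theorem contMDiffAt_symm {x : EuclideanSpace ℝ (Fin d)} (hx : x ∈ e.target) :
    ContMDiffAt (𝓡 d) (𝓡 d) ∞ e.symm x :=
  he.contMDiffOn_symm.contMDiffAt (e.open_target.mem_nhds hx)

theorem isInvertible {x : EuclideanSpace ℝ (Fin d)} (hx : x ∈ e.target) :
    (mfderiv (𝓡 d) (𝓡 d) e.symm x).IsInvertible :=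
  ⟨he.mdifferentiable.symm.mfderiv hx, rfl⟩

theorem mfderiv_symm_pushField (V : ∀ q : M, TangentSpace (𝓡 d) q)
    {x : EuclideanSpace ℝ (Fin d)} (hx : x ∈ e.target) :
    mfderiv (𝓡 d) (𝓡 d) e.symm x (pushField e V x) = V (e.symm x) :=
  (he.isInvertible hx).self_apply_inverse _

theorem pushField_eq (V : ∀ q : M, TangentSpace (𝓡 d) q) {x : EuclideanSpace ℝ (Fin d)}
    (hx : x ∈ e.target) :
    pushField e V x = mfderiv (𝓡 d) (𝓡 d) e (e.symm x) (V (e.symm x)) := by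
  rw [← he.mfderiv_symm_pushField V hx]
  exact (DFunLike.congr_fun (he.mdifferentiable.comp_symm_deriv hx) (pushField e V x)).symm

theorem contDiffAt_pushField {H : ∀ q : M, Submodule ℝ (TangentSpace (𝓡 d) q)} {X : ∀ q, H q}
    {U : Set M} (hU : IsOpen U) (hX : SmoothSectionOn H X U) {x : EuclideanSpace ℝ (Fin d)}
    (hx : x ∈ e.target) (hxU : e.symm x ∈ U) :
    ContDiffAt ℝ ∞ (pushField e fun q => (X q : TangentSpace (𝓡 d) q)) x := by
  have h1 := (hX.contMDiffAt (hU.mem_nhds hxU)).mpullback_vectorField_preimage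
    (he.contMDiffAt_symm hx) (he.isInvertible hx) (by simp)
  exact contMDiffAt_vectorSpace_iff_contDiffAt.1 h1

theorem lieBracket_pushField {H : ∀ q : M, Submodule ℝ (TangentSpace (𝓡 d) q)} {X Y : ∀ q, H q}
    {U : Set M} (hU : IsOpen U) (hX : SmoothSectionOn H X U) (hY : SmoothSectionOn H Y U)
    {x : EuclideanSpace ℝ (Fin d)} (hx : x ∈ e.target) (hxU : e.symm x ∈ U) :
    VectorField.lieBracket ℝ (pushField e fun q => (X q : TangentSpace (𝓡 d) q))
      (pushField e fun q => (Y q : TangentSpace (𝓡 d) q)) x = pushField e (bracketAt X Y) x := by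
  have hn : minSmoothness ℝ 2 ≤ (∞ : WithTop ℕ∞) := by
    simpa using (WithTop.coe_le_coe.2 le_top : ((2 : ℕ∞) : WithTop ℕ∞) ≤ ∞)
  have : IsManifold (𝓡 d) (minSmoothness ℝ 2) M := IsManifold.of_le hn
  have h1 := VectorField.mpullback_mlieBracket (I := 𝓡 d) (I' := 𝓡 d) (n := ∞) (f := e.symm)
    ((hX.contMDiffAt (hU.mem_nhds hxU)).mdifferentiableAt (by simp))
    ((hY.contMDiffAt (hU.mem_nhds hxU)).mdifferentiableAt (by simp))
    (he.contMDiffAt_symm hx) hn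
  rw [← VectorField.mlieBracketWithin_univ (I := 𝓡 d) (M := EuclideanSpace ℝ (Fin d)),
    VectorField.mlieBracketWithin_eq_lieBracketWithin] at h1
  rw [← VectorField.lieBracketWithin_univ]
  exact h1.symm

theorem complexDiff_comp {u : EuclideanSpace ℝ (Fin d) → ℂ} {q : M} (hq : q ∈ e.source)
    {x : EuclideanSpace ℝ (Fin d)} (hx : e q = x) (hu : DifferentiableAt ℝ u x)
    (v : TangentSpace (𝓡 d) q) :
    complexDiff (u ∘ e) q v = fderiv ℝ u x (mfderiv (𝓡 d) (𝓡 d) e q v) := by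
  subst hx
  have h1 := mfderiv_comp q hu.mdifferentiableAt (he.mdifferentiable.mdifferentiableAt hq)
  rw [complexDiff, h1, mfderiv_eq_fderiv]
  rfl

end IsSmoothChart

end Charts

theorem ContDiffAt.crDeriv {E : Type} [NormedAddCommGroup E] [NormedSpace ℝ E]
    {X Y : E → E} {u : E → ℂ} {x : E} (hX : ContDiffAt ℝ ∞ X x) (hY : ContDiffAt ℝ ∞ Y x)
    (hu : ContDiffAt ℝ ∞ u x) : ContDiffAt ℝ ∞ (crDeriv X Y u) x := by
  have h : ContDiffAt ℝ ∞ (fderiv ℝ u) x := hu.fderiv_right (by simp)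
  exact (h.clm_apply hX).add (contDiffAt_const.mul (h.clm_apply hY))

theorem OpenPartialHomeomorph.eventuallyEq_comp_symm_comp {A B γ : Type*} [TopologicalSpace A]
    [TopologicalSpace B] (e : OpenPartialHomeomorph A B) (u : A → γ) {x : B} (hx : x ∈ e.target) :
    u =ᶠ[𝓝 (e.symm x)] (u ∘ e.symm) ∘ e := by
  filter_upwards [e.open_source.mem_nhds (e.map_target hx)] with q hq
  simp [e.left_inv hq]

/-! ### The operator ∂̄ in a chart, and dual frames -/

namespace CRStructure

variable {n k : ℕ} {M : Type*} [TopologicalSpace M]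
  [ChartedSpace (EuclideanSpace ℝ (Fin (2 * n + k))) M] [IsManifold (𝓡 (2 * n + k)) ∞ M]
  (S : CRStructure n k M)

theorem dbar_apply (u : M → ℂ) (q : M) (v : S.H q) :
    S.dbar u q v = complexDiff (d := 2 * n + k) u q v +
      Complex.I * complexDiff (d := 2 * n + k) u q (S.J q v) := rfl

theorem dbar_J (u : M → ℂ) (q : M) (v : S.H q) :
    S.dbar u q (S.J q v) = -Complex.I * S.dbar u q v := by
  rw [dbar_apply, dbar_apply, S.J_sq, Submodule.coe_neg, map_neg]
  linear_combination (complexDiff (d := 2 * n + k) u q (S.J q v)) * Complex.I_mul_I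

theorem dbar_congr {u w : M → ℂ} {q : M} (h : u =ᶠ[𝓝 q] w) : S.dbar u q = S.dbar w q := by
  have : complexDiff (d := 2 * n + k) u q = complexDiff w q := h.mfderiv_eq
  rw [dbar, dbar, this]

/-- The section `JX`. -/
noncomputable def JSec (X : ∀ q, S.H q) (q : M) : S.H q := S.J q (X q)

/-- A section of `HM` in the chart `e`. -/
noncomputable def push (e : OpenPartialHomeomorph M (EuclideanSpace ℝ (Fin (2 * n + k)))) (X : ∀ q, S.H q) :
    EuclideanSpace ℝ (Fin (2 * n + k)) → EuclideanSpace ℝ (Fin (2 * n + k)) :=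
  pushField e fun q => (X q : TangentSpace (𝓡 (2 * n + k)) q)

variable {S} {e : OpenPartialHomeomorph M (EuclideanSpace ℝ (Fin (2 * n + k)))}
  (he : IsSmoothChart e) {x : EuclideanSpace ℝ (Fin (2 * n + k))}

include he

theorem dbar_comp {u : EuclideanSpace ℝ (Fin (2 * n + k)) → ℂ} (hx : x ∈ e.target)
    (hu : DifferentiableAt ℝ u x) (X : ∀ q, S.H q) :
    S.dbar (u ∘ e) (e.symm x) (X (e.symm x)) =
      crDeriv (S.push e X) (S.push e (S.JSec X)) u x := by
  have hq := e.map_target hx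
  rw [dbar_apply, he.complexDiff_comp hq (e.right_inv hx) hu,
    he.complexDiff_comp hq (e.right_inv hx) hu, crDeriv, push, push, he.pushField_eq _ hx,
    he.pushField_eq _ hx]
  rfl

theorem contDiffAt_comp_symm {u : M → ℂ} (hx : x ∈ e.target)
    (hu : ContMDiffAt (𝓡 (2 * n + k)) 𝓘(ℝ, ℂ) ∞ u (e.symm x)) :
    ContDiffAt ℝ ∞ (u ∘ e.symm) x :=
  (hu.comp x (he.contMDiffAt_symm hx)).contDiffAt

theorem dbar_eq {u : M → ℂ} (hx : x ∈ e.target)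
    (hu : ContMDiffAt (𝓡 (2 * n + k)) 𝓘(ℝ, ℂ) ∞ u (e.symm x)) (X : ∀ q, S.H q) :
    S.dbar u (e.symm x) (X (e.symm x)) =
      crDeriv (S.push e X) (S.push e (S.JSec X)) (u ∘ e.symm) x := by
  rw [S.dbar_congr (e.eventuallyEq_comp_symm_comp u hx),
    dbar_comp he hx ((contDiffAt_comp_symm he hx hu).differentiableAt (by simp))]

theorem contDiffAt_push {U : Set M} (hU : IsOpen U) {X : ∀ q, S.H q}
    (hX : SmoothSectionOn S.H X U) (hx : x ∈ e.target) (hxU : e.symm x ∈ U) :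
    ContDiffAt ℝ ∞ (S.push e X) x :=
  he.contDiffAt_pushField hU hX hx hxU

/-- `∂̄∂̄ = 0` on functions. -/
theorem dbar_dbar {U : Set M} (hU : IsOpen U) {X Y : ∀ q, S.H q} (hX : SmoothSectionOn S.H X U)
    (hY : SmoothSectionOn S.H Y U) (hx : x ∈ e.target) (hxU : e.symm x ∈ U)
    {u : EuclideanSpace ℝ (Fin (2 * n + k)) → ℂ} (hu : ContDiffAt ℝ ∞ u x)
    {V : S.H (e.symm x)} (hV : (V : TangentSpace (𝓡 (2 * n + k)) (e.symm x)) =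
      bracketAt X Y (e.symm x) - bracketAt (S.JSec X) (S.JSec Y) (e.symm x)) :
    crDeriv (S.push e X) (S.push e (S.JSec X))
        (crDeriv (S.push e Y) (S.push e (S.JSec Y)) u) x -
      crDeriv (S.push e Y) (S.push e (S.JSec Y))
        (crDeriv (S.push e X) (S.push e (S.JSec X)) u) x =
      S.dbar (u ∘ e) (e.symm x) V := by
  have hJX : SmoothSectionOn S.H (S.JSec X) U := S.smooth_J U hU X hX
  have hJY : SmoothSectionOn S.H (S.JSec Y) U := S.smooth_J U hU Y hY
  -- Integrability supplies a vector with the same real part as [X + iJX, Y + iJY]; it therefore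
  -- equals V, and JV is the imaginary part.
  have hJV : (S.J _ V : TangentSpace (𝓡 (2 * n + k)) (e.symm x)) =
      bracketAt X (S.JSec Y) (e.symm x) + bracketAt (S.JSec X) Y (e.symm x) := by
    obtain ⟨V', hV', hJV'⟩ := S.integrable U hU X Y hX hY _ hxU
    have : V = V' := Subtype.ext (hV.trans hV'.symm)
    rw [this]
    exact hJV'
  have hq := e.map_target hx
  have hd := hu.differentiableAt (by simp : (∞ : WithTop ℕ∞) ≠ 0)
  rw [crDeriv_commutator (contDiffAt_push he hU hX hx hxU) (contDiffAt_push he hU hJX hx hxU)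
    (contDiffAt_push he hU hY hx hxU) (contDiffAt_push he hU hJY hx hxU) hu, dbar_apply,
    he.complexDiff_comp hq (e.right_inv hx) hd, he.complexDiff_comp hq (e.right_inv hx) hd, hV, hJV,
    map_sub (mfderiv (𝓡 (2 * n + k)) (𝓡 (2 * n + k)) e (e.symm x)),
    map_add (mfderiv (𝓡 (2 * n + k)) (𝓡 (2 * n + k)) e (e.symm x))]
  simp only [push]
  rw [he.lieBracket_pushField hU hX hY hx hxU, he.lieBracket_pushField hU hJX hJY hx hxU,
    he.lieBracket_pushField hU hX hJY hx hxU, he.lieBracket_pushField hU hJX hY hx hxU,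
    he.pushField_eq _ hx, he.pushField_eq _ hx, he.pushField_eq _ hx, he.pushField_eq _ hx]
  rfl

omit he

/-- Sections `X l` of `HM` near a point, and linear functions `ζ k` in the chart `e`, with
`∂̄ ζ k (X l) = δ_kl`. -/
structure IsDualFrame (S : CRStructure n k M)
    (e : OpenPartialHomeomorph M (EuclideanSpace ℝ (Fin (2 * n + k))))
    (X : Fin n → ∀ q, S.H q) (ζ : Fin n → EuclideanSpace ℝ (Fin (2 * n + k)) →L[ℝ] ℂ)
    (W : Set M) : Prop where
  isOpen : IsOpen W
  subset : W ⊆ e.source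
  smooth : ∀ l, SmoothSectionOn S.H (X l) W
  dual : ∀ q ∈ W, ∀ l m, S.dbar (ζ m ∘ e) q (X l q) = if l = m then 1 else 0

namespace IsDualFrame

variable {X : Fin n → ∀ q, S.H q} {ζ : Fin n → EuclideanSpace ℝ (Fin (2 * n + k)) →L[ℝ] ℂ}
  {W : Set M} (hF : S.IsDualFrame e X ζ W)

variable (X) in
/-- The vector whose image under an antilinear form `α` is `∑ l, c l * α (X l q)`. -/
noncomputable def _root_.CRStructure.frameSum (c : Fin n → ℂ) (q : M) : S.H q :=
  ∑ l, ((c l).re • X l q - (c l).im • S.J q (X l q))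

theorem _root_.CRStructure.map_frameSum {q : M} {α : S.H q →ₗ[ℝ] ℂ}
    (hα : ∀ v, α (S.J q v) = -Complex.I * α v) (c : Fin n → ℂ) :
    α (frameSum X c q) = ∑ l, c l * α (X l q) := by
  rw [frameSum, map_sum]
  refine Finset.sum_congr rfl fun l _ => ?_
  rw [map_sub, map_smul, map_smul, hα, Complex.real_smul, Complex.real_smul]
  conv_rhs => rw [← Complex.re_add_im (c l)]
  ring

include hF

theorem dbar_frameSum {q : M} (hq : q ∈ W) (c : Fin n → ℂ) (m : Fin n) :
    S.dbar (ζ m ∘ e) q (frameSum X c q) = c m := by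
  rw [map_frameSum (S.dbar_J _ q)]
  simp [hF.dual q hq]

/-- The forms ∂̄ζ_m give a real linear map from H_q to ℂ^n. The frame makes it surjective, and both
sides have real dimension 2n. -/
theorem eq_zero {q : M} (hq : q ∈ W) {v : S.H q} (hv : ∀ m, S.dbar (ζ m ∘ e) q v = 0) :
    v = 0 := by
  let T : S.H q →ₗ[ℝ] (Fin n → ℂ) := LinearMap.pi fun m => S.dbar (ζ m ∘ e) q
  have hsurj : Function.Surjective T := fun c =>
    ⟨frameSum X c q, funext fun m => hF.dbar_frameSum hq c m⟩
  have : FiniteDimensional ℝ (TangentSpace (𝓡 (2 * n + k)) q) :=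
    inferInstanceAs (FiniteDimensional ℝ (EuclideanSpace ℝ (Fin (2 * n + k))))
  have hfr : Module.finrank ℝ (S.H q) = Module.finrank ℝ (Fin n → ℂ) := by
    rw [S.finrank_H, Module.finrank_pi_fintype]
    simp [mul_comm]
  have hinj := (LinearMap.injective_iff_surjective_of_finrank_eq_finrank hfr).2 hsurj
  exact hinj (by rw [map_zero]; exact funext hv)

theorem eq_frameSum {q : M} (hq : q ∈ W) (v : S.H q) :
    v = frameSum X (fun m => S.dbar (ζ m ∘ e) q v) q := by
  rw [← sub_eq_zero]
  refine hF.eq_zero hq fun m => ?_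
  rw [map_sub, hF.dbar_frameSum hq, sub_self]

theorem antilinear_eq {q : M} (hq : q ∈ W) {α : S.H q →ₗ[ℝ] ℂ}
    (hα : ∀ v, α (S.J q v) = -Complex.I * α v) (v : S.H q) :
    α v = ∑ l, S.dbar (ζ l ∘ e) q v * α (X l q) := by
  conv_lhs => rw [hF.eq_frameSum hq v]
  exact map_frameSum hα _

theorem antilinear_ext {q : M} (hq : q ∈ W) {α β : S.H q →ₗ[ℝ] ℂ}
    (hα : ∀ v, α (S.J q v) = -Complex.I * α v) (hβ : ∀ v, β (S.J q v) = -Complex.I * β v)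
    (h : ∀ l, α (X l q) = β (X l q)) : α = β := by
  ext v
  rw [hF.antilinear_eq hq hα, hF.antilinear_eq hq hβ]
  simp only [h]

end IsDualFrame

end CRStructure

/-- A real vector space with a complex structure has vectors and complex linear forms dual to
each other. -/
theorem exists_dual_of_complexStructure {V : Type*} [AddCommGroup V] [Module ℝ V] {n : ℕ}
    [FiniteDimensional ℝ V] (hV : Module.finrank ℝ V = 2 * n) (J : V →ₗ[ℝ] V)
    (hJ : ∀ v, J (J v) = -v) :
    ∃ (b : Fin n → V) (η : Fin n → V →ₗ[ℝ] ℂ), ∀ l m,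
      η m (b l) + Complex.I * η m (J (b l)) = if l = m then 1 else 0 := by
  have hJ' : J * J = -1 := by ext v; simp [hJ]
  let φ : ℂ →ₐ[ℝ] Module.End ℝ V := Complex.liftAux J hJ'
  let _ : Module ℂ V := Module.compHom V φ.toRingHom
  have hsmul : ∀ (z : ℂ) (v : V), z • v = φ z v := fun _ _ => rfl
  have hI : ∀ v : V, Complex.I • v = J v := fun v => by
    rw [hsmul]
    exact DFunLike.congr_fun (Complex.liftAux_apply_I J hJ') v
  have : IsScalarTower ℝ ℂ V := ⟨fun r z v => by rw [hsmul, hsmul, map_smul]; rfl⟩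
  have : FiniteDimensional ℂ V := FiniteDimensional.right ℝ ℂ V
  have hfr : Module.finrank ℂ V = n := by
    have := Module.finrank_mul_finrank ℝ ℂ V
    rw [Complex.finrank_real_complex, hV] at this
    omega
  let b := Module.finBasisOfFinrankEq ℂ V hfr
  -- With J acting as i and b a complex basis, η_m is half the conjugate coordinate: conjugation
  -- makes iη(Jv) equal to η(v), so the two summands add up to δ.
  refine ⟨b, fun m => (2⁻¹ : ℝ) • (Complex.conjLIE.toLinearMap ∘ₗ (b.coord m).restrictScalars ℝ),
    fun l m => ?_⟩
  have h1 : b.coord m (b l) = if l = m then 1 else 0 := by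
    rw [Module.Basis.coord_apply, b.repr_self, Finsupp.single_apply]
  rw [← hI]
  simp only [LinearMap.smul_apply, LinearMap.comp_apply, LinearMap.restrictScalars_apply, map_smul,
    h1]
  split_ifs
  · simp
    linear_combination (-1 / 2 : ℂ) * Complex.I_mul_I
  · simp

theorem ContDiffAt.det {E : Type*} [NormedAddCommGroup E] [NormedSpace ℝ E] {n : ℕ}
    {a : E → Matrix (Fin n) (Fin n) ℂ} {x : E} (ha : ∀ i j, ContDiffAt ℝ ∞ (fun x => a x i j) x) :
    ContDiffAt ℝ ∞ (fun x => (a x).det) x := by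
  simp only [Matrix.det_apply]
  exact ContDiffAt.sum fun σ _ => (contDiffAt_prod fun i _ => ha _ _).const_smul _

theorem ContDiffAt.matrix_inv {E : Type*} [NormedAddCommGroup E] [NormedSpace ℝ E] {n : ℕ}
    {a : E → Matrix (Fin n) (Fin n) ℂ} {x : E} (ha : ∀ i j, ContDiffAt ℝ ∞ (fun x => a x i j) x)
    (hx : (a x).det ≠ 0) (i j : Fin n) : ContDiffAt ℝ ∞ (fun x => (a x)⁻¹ i j) x := by
  simp only [Matrix.inv_def, Matrix.smul_apply, Ring.inverse_eq_inv', smul_eq_mul,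
    Matrix.adjugate_apply]
  refine ((ContDiffAt.det ha).inv hx).mul (ContDiffAt.det fun l m => ?_)
  simp only [Matrix.updateRow_apply]
  split_ifs
  · exact contDiffAt_const
  · exact ha _ _

/-! ### Existence of dual frames -/

namespace CRStructure

variable {n k : ℕ} {M : Type*} [TopologicalSpace M]
  [ChartedSpace (EuclideanSpace ℝ (Fin (2 * n + k))) M] [IsManifold (𝓡 (2 * n + k)) ∞ M]
  {S : CRStructure n k M}

theorem smoothSectionOn_sum_smul {ι : Type*} [Fintype ι] {X : ι → ∀ q, S.H q} {U : Set M}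
    (hX : ∀ i, SmoothSectionOn S.H (X i) U) {c : ι → M → ℝ}
    (hc : ∀ i, ContMDiffOn (𝓡 (2 * n + k)) 𝓘(ℝ, ℝ) ∞ (c i) U) :
    SmoothSectionOn S.H (fun q => ∑ i, c i q • X i q) U := by
  have := ContMDiffOn.sum_section (s := Finset.univ) fun i _ => (hc i).smul_section (hX i)
  refine this.congr fun q _ => ?_
  simp

theorem smoothSectionOn_frameSum {X : Fin n → ∀ q, S.H q} {U : Set M} (hU : IsOpen U)
    (hX : ∀ l, SmoothSectionOn S.H (X l) U) {c : Fin n → M → ℂ}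
    (hc : ∀ l, ContMDiffOn (𝓡 (2 * n + k)) 𝓘(ℝ, ℂ) ∞ (c l) U) :
    SmoothSectionOn S.H (fun q => frameSum X (fun l => c l q) q) U := by
  have hre : ∀ l, ContMDiffOn (𝓡 (2 * n + k)) 𝓘(ℝ, ℝ) ∞ (fun q => (c l q).re) U := fun l =>
    Complex.reCLM.contDiff.contMDiff.comp_contMDiffOn (hc l)
  have him : ∀ l, ContMDiffOn (𝓡 (2 * n + k)) 𝓘(ℝ, ℝ) ∞ (fun q => (c l q).im) U := fun l =>
    Complex.imCLM.contDiff.contMDiff.comp_contMDiffOn (hc l)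
  have := ContMDiffOn.sub_section (smoothSectionOn_sum_smul hX hre)
    (smoothSectionOn_sum_smul (fun l => S.smooth_J U hU _ (hX l)) him)
  refine this.congr fun q _ => ?_
  simp [frameSum, Finset.sum_sub_distrib]

variable (S) in
theorem exists_smooth_extension (p : M) : ∃ U : Set M, IsOpen U ∧ p ∈ U ∧
    ∀ v : S.H p, ∃ X : ∀ q, S.H q, SmoothSectionOn S.H X U ∧ X p = v := by
  obtain ⟨U, hU, hp, Y, hY, hli⟩ := S.exists_frame p
  refine ⟨U, hU, hp, fun v => ?_⟩
  have : FiniteDimensional ℝ (TangentSpace (𝓡 (2 * n + k)) p) :=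
    inferInstanceAs (FiniteDimensional ℝ (EuclideanSpace ℝ (Fin (2 * n + k))))
  have hspan := (hli p hp).span_eq_top_of_card_eq_finrank' (by simp [S.finrank_H])
  have hv : v ∈ Submodule.span ℝ (range fun i => Y i p) := hspan ▸ Submodule.mem_top
  obtain ⟨c, rfl⟩ := (Submodule.mem_span_range_iff_exists_fun ℝ).1 hv
  exact ⟨fun q => ∑ i, c i • Y i q, smoothSectionOn_sum_smul hY fun i => contMDiffOn_const, rfl⟩

variable (S) in
-- Dual vectors and forms on H_p are extended to smooth sections and to linear functions in the
-- chart. The matrix of the ∂̄ζ_m on the extended sections is the identity at p, and where it is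
-- invertible its inverse corrects the sections to a dual frame.
theorem exists_isDualFrame {e : OpenPartialHomeomorph M (EuclideanSpace ℝ (Fin (2 * n + k)))}
    (he : IsSmoothChart e) {p : M} (hp : p ∈ e.source) :
    ∃ X ζ W, S.IsDualFrame e X ζ W ∧ p ∈ W := by
  have : FiniteDimensional ℝ (TangentSpace (𝓡 (2 * n + k)) p) :=
    inferInstanceAs (FiniteDimensional ℝ (EuclideanSpace ℝ (Fin (2 * n + k))))
  obtain ⟨U, hU, hpU, hext⟩ := S.exists_smooth_extension p
  obtain ⟨b, η, hb⟩ := exists_dual_of_complexStructure (S.finrank_H p) (S.J p) (S.J_sq p)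
  choose X hX hXb using fun l => hext (b l)
  choose g hg using fun m => (η m).exists_extend
  let ζ : Fin n → EuclideanSpace ℝ (Fin (2 * n + k)) →L[ℝ] ℂ := fun m =>
    LinearMap.toContinuousLinearMap
      (g m ∘ₗ (mfderiv (𝓡 (2 * n + k)) (𝓡 (2 * n + k)) e.symm (e p)).toLinearMap)
  let a : EuclideanSpace ℝ (Fin (2 * n + k)) → Matrix (Fin n) (Fin n) ℂ := fun x =>
    Matrix.of fun m l => crDeriv (S.push e (X l)) (S.push e (S.JSec (X l))) (ζ m) x
  have ha : ∀ x ∈ e.target, e.symm x ∈ U → ∀ m l, ContDiffAt ℝ ∞ (fun x => a x m l) x :=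
    fun x hx hxU m l => ContDiffAt.crDeriv (contDiffAt_push he hU (hX l) hx hxU)
      (contDiffAt_push he hU (S.smooth_J U hU _ (hX l)) hx hxU) (ζ m).contDiff.contDiffAt
  have hdb : ∀ q ∈ e.source, ∀ m l, S.dbar (ζ m ∘ e) q (X l q) = a (e q) m l := fun q hq m l => by
    have := dbar_comp he (e.map_source hq) (ζ m).differentiableAt (X l)
    rwa [e.left_inv hq] at this
  have hgp : ∀ m (v : S.H p), complexDiff (d := 2 * n + k) (ζ m ∘ e) p v = η m v := fun m v => by
    rw [he.complexDiff_comp hp rfl (ζ m).differentiableAt, (ζ m).fderiv, ← hg]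
    exact congrArg (g m) (DFunLike.congr_fun (he.mdifferentiable.symm_comp_deriv hp) _)
  have hap : a (e p) = 1 := by
    ext m l
    rw [← hdb p hp, dbar_apply, hgp, hgp, hXb, hb, Matrix.one_apply]
    simp [eq_comm]
  have hVo : IsOpen (e.source ∩ U) := e.open_source.inter hU
  have hcoef : ∀ q ∈ e.source ∩ U, ∀ m l,
      ContDiffAt ℝ ∞ (fun x => a x m l) (e q) := fun q hq =>
    ha (e q) (e.map_source hq.1) (by rw [e.left_inv hq.1]; exact hq.2)
  have hcont : ContinuousOn (fun q => (a (e q)).det) (e.source ∩ U) := fun q hq =>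
    ((ContDiffAt.det (hcoef q hq)).continuousAt.comp
      (f := e) (e.continuousAt hq.1)).continuousWithinAt
  have hWo := hcont.isOpen_inter_preimage hVo (isOpen_compl_singleton (x := (0 : ℂ)))
  set W := e.source ∩ U ∩ (fun q => (a (e q)).det) ⁻¹' {0}ᶜ with hW
  refine ⟨fun l q => frameSum X (fun j => (a (e q))⁻¹ j l) q, ζ, W,
    ⟨hWo, fun q hq => hq.1.1, fun l => ?_, fun q hq l m => ?_⟩, ⟨hp, hpU⟩, ?_⟩
  · refine smoothSectionOn_frameSum hWo (fun l => (hX l).mono fun q hq => hq.1.2) fun j q hq => ?_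
    have h1 := (ContDiffAt.matrix_inv (hcoef q hq.1) hq.2 j l).contMDiffAt
    exact (h1.comp q (he.contMDiffAt hq.1.1)).contMDiffWithinAt
  · have hinv : a (e q) * (a (e q))⁻¹ = 1 := Matrix.mul_nonsing_inv _ (isUnit_iff_ne_zero.2 hq.2)
    have h2 := congrFun (congrFun hinv m) l
    rw [Matrix.mul_apply, Matrix.one_apply] at h2
    rw [map_frameSum (S.dbar_J _ q)]
    simp only [hdb q hq.1.1, eq_comm (a := l)]
    rw [← h2]
    exact Finset.sum_congr rfl fun j _ => mul_comm _ _
  · simp [hap]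

end CRStructure

theorem ContDiffBump.contDiff_smul {E F : Type*} [NormedAddCommGroup E] [InnerProductSpace ℝ E]
    [NormedAddCommGroup F] [NormedSpace ℝ F] {c : E} (χ : ContDiffBump c)
    {f : E → F} (hf : ∀ x ∈ Metric.closedBall c χ.rOut, ContDiffAt ℝ ∞ f x)
    [FiniteDimensional ℝ E] : ContDiff ℝ ∞ fun x => χ x • f x := by
  refine contDiff_iff_contDiffAt.2 fun x => ?_
  by_cases hx : x ∈ Metric.closedBall c χ.rOut
  · exact χ.contDiff.contDiffAt.smul (hf x hx)
  · rw [← χ.tsupport_eq, notMem_tsupport_iff_eventuallyEq] at hx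
    refine (contDiffAt_const (c := (0 : F))).congr_of_eventuallyEq ?_
    filter_upwards [hx] with y hy
    simp [hy]

theorem exists_contDiffBump_subset {E : Type*} [NormedAddCommGroup E] {c : E} {s : Set E}
    (hs : s ∈ 𝓝 c) : ∃ χ : ContDiffBump c, Metric.closedBall c χ.rOut ⊆ s := by
  obtain ⟨R, hR, hRs⟩ := Metric.nhds_basis_closedBall.mem_iff.1 hs
  exact ⟨⟨R / 2, R, by positivity, by linarith⟩, hRs⟩

theorem crDeriv_congr_fields {E : Type} [NormedAddCommGroup E] [NormedSpace ℝ E]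
    {X X' Y Y' : E → E} {x : E} (hX : X =ᶠ[𝓝 x] X') (hY : Y =ᶠ[𝓝 x] Y') (u : E → ℂ) :
    crDeriv X Y u =ᶠ[𝓝 x] crDeriv X' Y' u := by
  filter_upwards [hX, hY] with y h1 h2
  rw [crDeriv, crDeriv, h1, h2]

theorem crDeriv_eq_zero_of_eventually_const {E : Type} [NormedAddCommGroup E] [NormedSpace ℝ E]
    {X Y : E → E} {u : E → ℂ} {x : E} {a : ℂ} (hu : u =ᶠ[𝓝 x] fun _ => a) :
    crDeriv X Y u x = 0 := by
  rw [(crDeriv_congr hu).eq_of_nhds, crDeriv]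
  simp

theorem crDeriv_sum_mul {E ι : Type} [Fintype ι] [NormedAddCommGroup E] [NormedSpace ℝ E]
    {X Y : E → E} {u v : ι → E → ℂ} {x : E} (hu : ∀ i, DifferentiableAt ℝ (u i) x)
    (hv : ∀ i, DifferentiableAt ℝ (v i) x) :
    crDeriv X Y (fun x => ∑ i, u i x * v i x) x =
      ∑ i, (u i x * crDeriv X Y (v i) x + v i x * crDeriv X Y (u i) x) := by
  have h := HasFDerivAt.fun_sum (u := Finset.univ) fun i _ =>
    ((hu i).mul (hv i)).hasFDerivAt
  have h' : (fun x => ∑ i, u i x * v i x) = fun y => ∑ i, (u i * v i) y := rfl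
  rw [h', crDeriv, h.fderiv, sum_apply, sum_apply,
    Finset.mul_sum, ← Finset.sum_add_distrib]
  exact Finset.sum_congr rfl fun i _ => crDeriv_mul (hu i) (hv i)

/-! ### The commuting frame in the chart -/

namespace CRStructure

variable {n k : ℕ} {M : Type*} [TopologicalSpace M]
  [ChartedSpace (EuclideanSpace ℝ (Fin (2 * n + k))) M] [IsManifold (𝓡 (2 * n + k)) ∞ M]
  {S : CRStructure n k M} {e : OpenPartialHomeomorph M (EuclideanSpace ℝ (Fin (2 * n + k)))}

namespace IsDualFrame

variable {X : Fin n → ∀ q, S.H q} {ζ : Fin n → EuclideanSpace ℝ (Fin (2 * n + k)) →L[ℝ] ℂ}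
  {W : Set M}

theorem smooth_J (hF : S.IsDualFrame e X ζ W) (l : Fin n) :
    SmoothSectionOn S.H (S.JSec (X l)) W :=
  S.smooth_J W hF.isOpen _ (hF.smooth l)

theorem crDeriv_coord (hF : S.IsDualFrame e X ζ W) (he : IsSmoothChart e)
    {x : EuclideanSpace ℝ (Fin (2 * n + k))} (hx : x ∈ e.target) (hxW : e.symm x ∈ W) (l m : Fin n) :
    crDeriv (S.push e (X l)) (S.push e (S.JSec (X l))) (ζ m) x = if l = m then 1 else 0 := by
  rw [← dbar_comp he hx (ζ m).differentiableAt (X l), hF.dual _ hxW]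

theorem eventually_mem (e : OpenPartialHomeomorph M (EuclideanSpace ℝ (Fin (2 * n + k))))
    {V : Set M} (hV : IsOpen V)
    {x : EuclideanSpace ℝ (Fin (2 * n + k))} (hx : x ∈ e.target) (hxV : e.symm x ∈ V) :
    ∀ᶠ y in 𝓝 x, y ∈ e.target ∧ e.symm y ∈ V :=
  (e.open_target.eventually_mem hx).and
    ((e.continuousAt_symm hx).eventually_mem (hV.mem_nhds hxV))

/-- The fields of a dual frame commute. -/
theorem crDeriv_comm (hF : S.IsDualFrame e X ζ W) (he : IsSmoothChart e)
    {x : EuclideanSpace ℝ (Fin (2 * n + k))} (hx : x ∈ e.target) (hxW : e.symm x ∈ W) (j l : Fin n)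
    {u : EuclideanSpace ℝ (Fin (2 * n + k)) → ℂ} (hu : ContDiffAt ℝ ∞ u x) :
    crDeriv (S.push e (X j)) (S.push e (S.JSec (X j)))
        (crDeriv (S.push e (X l)) (S.push e (S.JSec (X l))) u) x =
      crDeriv (S.push e (X l)) (S.push e (S.JSec (X l)))
        (crDeriv (S.push e (X j)) (S.push e (S.JSec (X j))) u) x := by
  obtain ⟨V, hV, -⟩ := S.integrable W hF.isOpen _ _ (hF.smooth j) (hF.smooth l) _ hxW
  have hconst : ∀ i m, crDeriv (S.push e (X i)) (S.push e (S.JSec (X i))) (ζ m) =ᶠ[𝓝 x]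
      fun _ => if i = m then 1 else 0 := fun i m => by
    filter_upwards [eventually_mem e hF.isOpen hx hxW] with y hy
    exact hF.crDeriv_coord he hy.1 hy.2 i m
  -- The commutator kills every ζ_m, because the derivatives of ζ_m along the frame are constant,
  -- and the ∂̄ζ_m separate the vectors of H.
  have hV0 : V = 0 := hF.eq_zero hxW fun m => by
    rw [← dbar_dbar he hF.isOpen (hF.smooth j) (hF.smooth l) hx hxW (ζ m).contDiff.contDiffAt hV,
      crDeriv_eq_zero_of_eventually_const (hconst l m),
      crDeriv_eq_zero_of_eventually_const (hconst j m), sub_zero]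
  rw [← sub_eq_zero, dbar_dbar he hF.isOpen (hF.smooth j) (hF.smooth l) hx hxW hu hV, hV0, map_zero]

/-- The frame in the chart, cut off away from the origin. -/
noncomputable def flatFrame (hF : S.IsDualFrame e X ζ W) (he : IsSmoothChart e)
    (χ : ContDiffBump (0 : EuclideanSpace ℝ (Fin (2 * n + k))))
    (hχ : ∀ x ∈ Metric.closedBall 0 χ.rOut, x ∈ e.target ∧ e.symm x ∈ W) :
    FlatFrame (Fin n) (EuclideanSpace ℝ (Fin (2 * n + k))) :=
  have hball : ∀ x ∈ Metric.ball 0 χ.rIn, x ∈ e.target ∧ e.symm x ∈ W := fun x hx =>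
    hχ x (Metric.ball_subset_closedBall (Metric.ball_subset_ball χ.rIn_lt_rOut.le hx))
  have hcut : ∀ (f : EuclideanSpace ℝ (Fin (2 * n + k)) → EuclideanSpace ℝ (Fin (2 * n + k))),
      ∀ x ∈ Metric.ball 0 χ.rIn, (fun x => χ x • f x) =ᶠ[𝓝 x] f := fun f x hx => by
    filter_upwards [χ.eventuallyEq_one_of_mem_ball hx] with y hy
    simp [hy]
  { X := fun l x => χ x • S.push e (X l) x
    Y := fun l x => χ x • S.push e (S.JSec (X l)) x
    ζ := ζ
    r := χ.rIn
    r_pos := χ.rIn_pos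
    contDiff_X := fun l => χ.contDiff_smul fun x hx =>
      contDiffAt_push he hF.isOpen (hF.smooth l) (hχ x hx).1 (hχ x hx).2
    contDiff_Y := fun l => χ.contDiff_smul fun x hx =>
      contDiffAt_push he hF.isOpen (hF.smooth_J l) (hχ x hx).1 (hχ x hx).2
    dual := fun x hx j l => by
      rw [← hF.crDeriv_coord he (hball x hx).1 (hball x hx).2, crDeriv_clm,
        (hcut (S.push e (X j)) x hx).eq_of_nhds, (hcut (S.push e (S.JSec (X j))) x hx).eq_of_nhds]
    comm := fun u hu x hx j l => by
      have h := fun i => crDeriv_congr_fields (hcut (S.push e (X i)) x hx)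
        (hcut (S.push e (S.JSec (X i))) x hx)
      rw [(h j _).eq_of_nhds, (h l _).eq_of_nhds, (crDeriv_congr (h j u)).eq_of_nhds,
        (crDeriv_congr (h l u)).eq_of_nhds]
      exact hF.crDeriv_comm he (hball x hx).1 (hball x hx).2 j l hu.contDiffAt }

variable {χ : ContDiffBump (0 : EuclideanSpace ℝ (Fin (2 * n + k)))}

theorem flatFrame_X_eventuallyEq (hF : S.IsDualFrame e X ζ W) (he : IsSmoothChart e)
    (hχ : ∀ x ∈ Metric.closedBall 0 χ.rOut, x ∈ e.target ∧ e.symm x ∈ W) (l : Fin n)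
    {x : EuclideanSpace ℝ (Fin (2 * n + k))} (hx : x ∈ Metric.ball 0 χ.rIn) :
    (hF.flatFrame he χ hχ).X l =ᶠ[𝓝 x] S.push e (X l) := by
  filter_upwards [χ.eventuallyEq_one_of_mem_ball hx] with y hy
  simp [flatFrame, hy]

theorem flatFrame_Y_eventuallyEq (hF : S.IsDualFrame e X ζ W) (he : IsSmoothChart e)
    (hχ : ∀ x ∈ Metric.closedBall 0 χ.rOut, x ∈ e.target ∧ e.symm x ∈ W) (l : Fin n)
    {x : EuclideanSpace ℝ (Fin (2 * n + k))} (hx : x ∈ Metric.ball 0 χ.rIn) :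
    (hF.flatFrame he χ hχ).Y l =ᶠ[𝓝 x] S.push e (S.JSec (X l)) := by
  filter_upwards [χ.eventuallyEq_one_of_mem_ball hx] with y hy
  simp [flatFrame, hy]

theorem flatFrame_D (hF : S.IsDualFrame e X ζ W) (he : IsSmoothChart e)
    (hχ : ∀ x ∈ Metric.closedBall 0 χ.rOut, x ∈ e.target ∧ e.symm x ∈ W) (l : Fin n)
    {x : EuclideanSpace ℝ (Fin (2 * n + k))} (hx : x ∈ Metric.ball 0 χ.rIn)
    (u : EuclideanSpace ℝ (Fin (2 * n + k)) → ℂ) :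
    (hF.flatFrame he χ hχ).D l u x = crDeriv (S.push e (X l)) (S.push e (S.JSec (X l))) u x :=
  (crDeriv_congr_fields (hF.flatFrame_X_eventuallyEq he hχ l hx)
    (hF.flatFrame_Y_eventuallyEq he hχ l hx) u).eq_of_nhds

theorem flatFrame_D_eq_dbar (hF : S.IsDualFrame e X ζ W) (he : IsSmoothChart e)
    (hχ : ∀ x ∈ Metric.closedBall 0 χ.rOut, x ∈ e.target ∧ e.symm x ∈ W) (l : Fin n)
    {x : EuclideanSpace ℝ (Fin (2 * n + k))} (hx : x ∈ Metric.ball 0 χ.rIn)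
    {u : EuclideanSpace ℝ (Fin (2 * n + k)) → ℂ} (hu : DifferentiableAt ℝ u x) :
    (hF.flatFrame he χ hχ).D l u x = S.dbar (u ∘ e) (e.symm x) (X l (e.symm x)) := by
  rw [hF.flatFrame_D he hχ l hx, dbar_comp he (hχ x ?_).1 hu]
  exact Metric.ball_subset_closedBall (Metric.ball_subset_ball χ.rIn_lt_rOut.le hx)

end IsDualFrame

end CRStructure

/-! ### Closed (0,1) forms and CR functions through the flat frame -/

namespace CRStructure

variable {n k : ℕ} {M : Type*} [TopologicalSpace M]
  [ChartedSpace (EuclideanSpace ℝ (Fin (2 * n + k))) M] [IsManifold (𝓡 (2 * n + k)) ∞ M]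
  {S : CRStructure n k M} {e : OpenPartialHomeomorph M (EuclideanSpace ℝ (Fin (2 * n + k)))}

namespace IsDualFrame

variable {X : Fin n → ∀ q, S.H q} {ζ : Fin n → EuclideanSpace ℝ (Fin (2 * n + k)) →L[ℝ] ℂ}
  {W : Set M}

/-- The `(0,1)` form with components `F` with respect to the forms `∂̄ ζ_k`. -/
noncomputable def formOf (S : CRStructure n k M)
    (e : OpenPartialHomeomorph M (EuclideanSpace ℝ (Fin (2 * n + k))))
    (ζ : Fin n → EuclideanSpace ℝ (Fin (2 * n + k)) →L[ℝ] ℂ)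
    (F : Fin n → EuclideanSpace ℝ (Fin (2 * n + k)) → ℂ) (q : M) : S.H q →ₗ[ℝ] ℂ :=
  ∑ m, F m (e q) • S.dbar (ζ m ∘ e) q

/-- The value of `formOf` on the section `Y`, in the chart. -/
noncomputable def formApply (S : CRStructure n k M)
    (e : OpenPartialHomeomorph M (EuclideanSpace ℝ (Fin (2 * n + k))))
    (ζ : Fin n → EuclideanSpace ℝ (Fin (2 * n + k)) →L[ℝ] ℂ)
    (F : Fin n → EuclideanSpace ℝ (Fin (2 * n + k)) → ℂ) (Y : ∀ q, S.H q)
    (x : EuclideanSpace ℝ (Fin (2 * n + k))) : ℂ :=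
  ∑ m, F m x * crDeriv (S.push e Y) (S.push e (S.JSec Y)) (ζ m) x

theorem formOf_apply (F : Fin n → EuclideanSpace ℝ (Fin (2 * n + k)) → ℂ) (q : M) (v : S.H q) :
    formOf S e ζ F q v = ∑ m, F m (e q) * S.dbar (ζ m ∘ e) q v := by
  simp [formOf, LinearMap.sum_apply]

theorem formOf_apply_section (he : IsSmoothChart e)
    (F : Fin n → EuclideanSpace ℝ (Fin (2 * n + k)) → ℂ) (Y : ∀ q, S.H q) {q : M}
    (hq : q ∈ e.source) : formOf S e ζ F q (Y q) = formApply S e ζ F Y (e q) := by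
  rw [formOf_apply, formApply]
  refine Finset.sum_congr rfl fun m _ => ?_
  have := dbar_comp he (e.map_source hq) (ζ m).differentiableAt Y
  rw [e.left_inv hq] at this
  rw [this]

theorem contDiffAt_formApply (he : IsSmoothChart e)
    {F : Fin n → EuclideanSpace ℝ (Fin (2 * n + k)) → ℂ} (hF : ∀ m, ContDiff ℝ ∞ (F m))
    {U : Set M} (hU : IsOpen U) {Y : ∀ q, S.H q} (hY : SmoothSectionOn S.H Y U)
    {x : EuclideanSpace ℝ (Fin (2 * n + k))} (hx : x ∈ e.target) (hxU : e.symm x ∈ U) :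
    ContDiffAt ℝ ∞ (formApply S e ζ F Y) x :=
  ContDiffAt.sum fun m _ => (hF m).contDiffAt.mul
    (ContDiffAt.crDeriv (contDiffAt_push he hU hY hx hxU)
      (contDiffAt_push he hU (S.smooth_J U hU Y hY) hx hxU) (ζ m).contDiff.contDiffAt)

theorem isForm01On_formOf (he : IsSmoothChart e)
    {F : Fin n → EuclideanSpace ℝ (Fin (2 * n + k)) → ℂ} (hF : ∀ m, ContDiff ℝ ∞ (F m))
    {Ω : Set M} (hΩ : Ω ⊆ e.source) : S.IsForm01On (formOf S e ζ F) Ω where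
  map_J q _ v := by
    simp only [formOf_apply, dbar_J, Finset.mul_sum]
    exact Finset.sum_congr rfl fun m _ => by ring
  smooth U hUΩ hU Y hY q hq := by
    have hqs := hΩ (hUΩ hq)
    have h1 := (contDiffAt_formApply (ζ := ζ) he hF hU hY (e.map_source hqs)
      (by rwa [e.left_inv hqs])).contMDiffAt.comp q (he.contMDiffAt hqs)
    refine (h1.congr_of_eventuallyEq ?_).contMDiffWithinAt
    filter_upwards [e.open_source.mem_nhds hqs] with y hy
    exact formOf_apply_section he F Y hy

theorem dbar_formOf (he : IsSmoothChart e)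
    {F : Fin n → EuclideanSpace ℝ (Fin (2 * n + k)) → ℂ} (hF : ∀ m, ContDiff ℝ ∞ (F m))
    {U : Set M} (hU : IsOpen U) {Y : ∀ q, S.H q} (hY : SmoothSectionOn S.H Y U)
    {x : EuclideanSpace ℝ (Fin (2 * n + k))} (hx : x ∈ e.target) (hxU : e.symm x ∈ U)
    (Z : ∀ q, S.H q) :
    S.dbar (fun q => formOf S e ζ F q (Y q)) (e.symm x) (Z (e.symm x)) =
      ∑ m, (F m x * crDeriv (S.push e Z) (S.push e (S.JSec Z))
          (crDeriv (S.push e Y) (S.push e (S.JSec Y)) (ζ m)) x +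
        crDeriv (S.push e Y) (S.push e (S.JSec Y)) (ζ m) x *
          crDeriv (S.push e Z) (S.push e (S.JSec Z)) (F m) x) := by
  have h1 : (fun q => formOf S e ζ F q (Y q)) =ᶠ[𝓝 (e.symm x)] formApply S e ζ F Y ∘ e := by
    filter_upwards [e.open_source.mem_nhds (e.map_target hx)] with q hq
    exact formOf_apply_section he F Y hq
  rw [S.dbar_congr h1, dbar_comp he hx
    ((contDiffAt_formApply he hF hU hY hx hxU).differentiableAt (by simp))]
  exact crDeriv_sum_mul (fun m => (hF m).differentiable (by simp) x) fun m =>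
    (ContDiffAt.crDeriv (contDiffAt_push he hU hY hx hxU)
      (contDiffAt_push he hU (S.smooth_J U hU Y hY) hx hxU)
      (ζ m).contDiff.contDiffAt).differentiableAt (by simp)

theorem crDeriv_eq_sum (hW : S.IsDualFrame e X ζ W) (he : IsSmoothChart e)
    {u : EuclideanSpace ℝ (Fin (2 * n + k)) → ℂ}
    {x : EuclideanSpace ℝ (Fin (2 * n + k))} (hx : x ∈ e.target) (hxW : e.symm x ∈ W)
    (hu : DifferentiableAt ℝ u x) (Y : ∀ q, S.H q) :
    crDeriv (S.push e Y) (S.push e (S.JSec Y)) u x =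
      ∑ l, crDeriv (S.push e Y) (S.push e (S.JSec Y)) (ζ l) x *
        crDeriv (S.push e (X l)) (S.push e (S.JSec (X l))) u x := by
  rw [← dbar_comp he hx hu Y, hW.antilinear_eq hxW (S.dbar_J _ _)]
  refine Finset.sum_congr rfl fun l _ => ?_
  rw [dbar_comp he hx hu, dbar_comp he hx (ζ l).differentiableAt]

/-- By ∂̄∂̄ζ_m = 0 the terms with second derivatives of ζ_m cancel against the bracket term. What
remains is ∑ ∂̄F_m ∧ ∂̄ζ_m, which vanishes by symmetry of the components. -/
theorem dbarClosedOn_formOf (hW : S.IsDualFrame e X ζ W) (he : IsSmoothChart e)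
    {F : Fin n → EuclideanSpace ℝ (Fin (2 * n + k)) → ℂ} (hF : ∀ m, ContDiff ℝ ∞ (F m))
    {Ω : Set M} (hΩ : Ω ⊆ W)
    (hcl : ∀ x ∈ e.target, e.symm x ∈ Ω → ∀ l m,
      crDeriv (S.push e (X l)) (S.push e (S.JSec (X l))) (F m) x =
        crDeriv (S.push e (X m)) (S.push e (S.JSec (X m))) (F l) x) :
    S.DbarClosedOn (formOf S e ζ F) Ω := by
  intro U hUΩ hU Y Z hY hZ q hq V hV
  have hqs := hW.subset (hΩ (hUΩ hq))
  obtain ⟨x, hx, rfl⟩ : ∃ x ∈ e.target, e.symm x = q := ⟨e q, e.map_source hqs, e.left_inv hqs⟩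
  have hxW := hΩ (hUΩ hq)
  rw [dbar_formOf he hF hU hZ hx hq, dbar_formOf he hF hU hY hx hq, formOf_apply,
    ← Finset.sum_sub_distrib, ← Finset.sum_sub_distrib]
  simp only [e.right_inv hx]
  have hterm : ∀ m, S.dbar (ζ m ∘ e) (e.symm x) V = _ := fun m =>
    (dbar_dbar he hU hY hZ hx hq (ζ m).contDiff.contDiffAt hV).symm
  simp only [hterm]
  have hsum : ∀ (P : ∀ q, S.H q) m, crDeriv (S.push e P) (S.push e (S.JSec P)) (F m) x = _ :=
    fun P m => hW.crDeriv_eq_sum he hx hxW ((hF m).differentiable (by simp) x) P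
  -- Expanding the derivatives of F_m in the frame gives double sums that exchange under l ↔ m, and
  -- the coefficients are symmetric by `hcl`.
  have hanti : ∑ m, crDeriv (S.push e Z) (S.push e (S.JSec Z)) (ζ m) x *
        crDeriv (S.push e Y) (S.push e (S.JSec Y)) (F m) x =
      ∑ m, crDeriv (S.push e Y) (S.push e (S.JSec Y)) (ζ m) x *
        crDeriv (S.push e Z) (S.push e (S.JSec Z)) (F m) x := by
    simp only [hsum Y, hsum Z, Finset.mul_sum]
    rw [Finset.sum_comm]
    refine Finset.sum_congr rfl fun l _ => Finset.sum_congr rfl fun m _ => ?_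
    rw [hcl x hx (hUΩ hq) l m]
    ring
  rw [← sub_eq_zero, ← Finset.sum_sub_distrib] at hanti
  rw [← hanti]
  exact Finset.sum_congr rfl fun m _ => by ring

variable {χ : ContDiffBump (0 : EuclideanSpace ℝ (Fin (2 * n + k)))}

/-- Compatible data F are the components of the closed form ∑ F_m ∂̄ζ_m near the point. Its local
solution is cut off to become smooth on the whole Euclidean space. -/
theorem poincareLemma_flatFrame (hW : S.IsDualFrame e X ζ W) (he : IsSmoothChart e)
    (hχ : ∀ x ∈ Metric.closedBall 0 χ.rOut, x ∈ e.target ∧ e.symm x ∈ W)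
    (hPL : S.PoincareLemmaAt (e.symm 0)) : (hW.flatFrame he χ hχ).PoincareLemma := by
  intro F hF hcl
  have hball : ∀ x ∈ Metric.ball 0 χ.rIn, x ∈ e.target ∧ e.symm x ∈ W := fun x hx =>
    hχ x (Metric.ball_subset_closedBall (Metric.ball_subset_ball χ.rIn_lt_rOut.le hx))
  have h0 : (0 : EuclideanSpace ℝ (Fin (2 * n + k))) ∈ Metric.ball 0 χ.rIn :=
    Metric.mem_ball_self χ.rIn_pos
  have h0t := (hball 0 h0).1
  set Ω := e.source ∩ e ⁻¹' Metric.ball 0 χ.rIn with hΩ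
  have hΩo : IsOpen Ω := e.isOpen_inter_preimage Metric.isOpen_ball
  have hΩW : Ω ⊆ W := fun q hq => by
    have := (hball _ hq.2).2
    rwa [e.left_inv hq.1] at this
  obtain ⟨U, hUo, hpU, -, u, hu, hdu⟩ := hPL Ω hΩo ⟨e.map_target h0t, by simpa [h0t] using h0⟩
    (formOf S e ζ F) (isForm01On_formOf he hF fun q hq => hq.1)
    (hW.dbarClosedOn_formOf he hF hΩW fun x hx hxΩ l m => by
      have hxb : x ∈ Metric.ball 0 χ.rIn := by simpa [e.right_inv hx] using hxΩ.2
      rw [← hW.flatFrame_D he hχ l hxb, ← hW.flatFrame_D he hχ m hxb]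
      exact hcl x hxb l m)
  have huat : ∀ x ∈ e.target, e.symm x ∈ U → ContMDiffAt (𝓡 (2 * n + k)) 𝓘(ℝ, ℂ) ∞ u (e.symm x) :=
    fun x _ hxU => hu.contMDiffAt (hUo.mem_nhds hxU)
  obtain ⟨ψ, hψ⟩ := exists_contDiffBump_subset (eventually_mem e hUo h0t hpU)
  refine ⟨fun x => ψ x • (u ∘ e.symm) x, ψ.contDiff_smul fun x hx =>
    contDiffAt_comp_symm he (hψ hx).1 (huat x (hψ hx).1 (hψ hx).2), ?_⟩
  filter_upwards [Metric.ball_mem_nhds 0 χ.rIn_pos, Metric.ball_mem_nhds 0 ψ.rIn_pos,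
    eventually_mem e hUo h0t hpU] with x hxχ hxψ hx m
  have heq : (fun x => ψ x • (u ∘ e.symm) x) =ᶠ[𝓝 x] u ∘ e.symm := by
    filter_upwards [ψ.eventuallyEq_one_of_mem_ball hxψ] with y hy
    simp [hy]
  rw [hW.flatFrame_D he hχ m hxχ, (crDeriv_congr heq).eq_of_nhds,
    ← dbar_eq he hx.1 (huat x hx.1 hx.2), hdu _ hx.2, formOf_apply]
  simp [hW.dual _ (hball x hxχ).2, e.right_inv hx.1]

/-- Together with `push_J_frameSum`, this identifies the complex combinations of the flat frame with
sections of HM, to which the Levi form hypothesis applies. -/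
theorem push_frameSum (hW : S.IsDualFrame e X ζ W) (he : IsSmoothChart e)
    (hχ : ∀ x ∈ Metric.closedBall 0 χ.rOut, x ∈ e.target ∧ e.symm x ∈ W) (c : Fin n → ℂ)
    {x : EuclideanSpace ℝ (Fin (2 * n + k))} (hx : x ∈ Metric.ball 0 χ.rIn) :
    (hW.flatFrame he χ hχ).combX c x = S.push e (frameSum X c) x := by
  have hxt := (hχ x (Metric.ball_subset_closedBall
    (Metric.ball_subset_ball χ.rIn_lt_rOut.le hx))).1
  rw [FlatFrame.combX, push, he.pushField_eq _ hxt, frameSum, Submodule.coe_sum, map_sum]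
  refine Finset.sum_congr rfl fun l _ => ?_
  rw [(hW.flatFrame_X_eventuallyEq he hχ l hx).eq_of_nhds,
    (hW.flatFrame_Y_eventuallyEq he hχ l hx).eq_of_nhds, push, push, he.pushField_eq _ hxt,
    he.pushField_eq _ hxt, Submodule.coe_sub, map_sub, Submodule.coe_smul, Submodule.coe_smul,
    map_smul, map_smul]
  rfl

theorem push_J_frameSum (hW : S.IsDualFrame e X ζ W) (he : IsSmoothChart e)
    (hχ : ∀ x ∈ Metric.closedBall 0 χ.rOut, x ∈ e.target ∧ e.symm x ∈ W) (c : Fin n → ℂ)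
    {x : EuclideanSpace ℝ (Fin (2 * n + k))} (hx : x ∈ Metric.ball 0 χ.rIn) :
    (hW.flatFrame he χ hχ).combY c x = S.push e (S.JSec (frameSum X c)) x := by
  have hxt := (hχ x (Metric.ball_subset_closedBall
    (Metric.ball_subset_ball χ.rIn_lt_rOut.le hx))).1
  rw [FlatFrame.combY, push, he.pushField_eq _ hxt, JSec, frameSum, map_sum, Submodule.coe_sum,
    map_sum]
  refine Finset.sum_congr rfl fun l _ => ?_
  rw [(hW.flatFrame_X_eventuallyEq he hχ l hx).eq_of_nhds,
    (hW.flatFrame_Y_eventuallyEq he hχ l hx).eq_of_nhds, push, push, he.pushField_eq _ hxt,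
    he.pushField_eq _ hxt, map_sub, map_smul, map_smul, S.J_sq, smul_neg, sub_neg_eq_add,
    Submodule.coe_add, map_add, Submodule.coe_smul, Submodule.coe_smul, map_smul, map_smul]
  rfl

/-- Near the origin of the chart there are CR functions with prescribed differential. -/
theorem exists_solution (hW : S.IsDualFrame e X ζ W) (he : IsSmoothChart e)
    (hχ : ∀ x ∈ Metric.closedBall 0 χ.rOut, x ∈ e.target ∧ e.symm x ∈ W)
    (hPL : S.PoincareLemmaAt (e.symm 0))
    {ξ : TangentSpace (𝓡 (2 * n + k)) (e.symm 0) →L[ℝ] ℝ}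
    (hξ : S.IsCharacteristic (e.symm 0) ξ) (hL : S.LeviPosDef (e.symm 0) ξ)
    {θ : EuclideanSpace ℝ (Fin (2 * n + k)) →L[ℝ] ℂ}
    (hθ : ∀ j, θ (S.push e (X j) 0) + Complex.I * θ (S.push e (S.JSec (X j)) 0) = 0) :
    ∃ h : EuclideanSpace ℝ (Fin (2 * n + k)) → ℂ, ContDiff ℝ ∞ h ∧
      (∀ᶠ x in 𝓝 0, ∀ l, S.dbar (h ∘ e) (e.symm x) (X l (e.symm x)) = 0) ∧
      fderiv ℝ h 0 = θ := by
  have h0 : (0 : EuclideanSpace ℝ (Fin (2 * n + k))) ∈ Metric.ball 0 χ.rIn :=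
    Metric.mem_ball_self χ.rIn_pos
  obtain ⟨h0t, h0W⟩ := hχ 0 (Metric.mem_closedBall_self χ.rOut_pos.le)
  have hXe := fun l => (hW.flatFrame_X_eventuallyEq he hχ l h0).eq_of_nhds
  have hYe := fun l => (hW.flatFrame_Y_eventuallyEq he hχ l h0).eq_of_nhds
  set C := hW.flatFrame he χ hχ with hC
  let ξ' : EuclideanSpace ℝ (Fin (2 * n + k)) →L[ℝ] ℝ :=
    ξ ∘L mfderiv (𝓡 (2 * n + k)) (𝓡 (2 * n + k)) e.symm 0
  have hξ' : ∀ V, ξ' (pushField e V 0) = ξ (V (e.symm 0)) := fun V =>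
    congrArg ξ (he.mfderiv_symm_pushField V h0t)
  have hsm : ∀ c : Fin n → ℂ, SmoothSectionOn S.H (frameSum X c) W := fun c =>
    smoothSectionOn_frameSum hW.isOpen hW.smooth fun l => contMDiffOn_const
  have hinj : ∀ c : Fin n → ℂ, frameSum X c (e.symm 0) = 0 → c = 0 := fun c hc => by
    funext m
    have := hW.dbar_frameSum h0W c m
    rw [hc, map_zero] at this
    exact this.symm
  have hsol : ∃ h : EuclideanSpace ℝ (Fin (2 * n + k)) → ℂ, ContDiff ℝ ∞ h ∧
      (∀ᶠ x in 𝓝 0, ∀ l, C.D l h x = 0) ∧ fderiv ℝ h 0 = θ := by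
    refine C.exists_solution (hW.poincareLemma_flatFrame he hχ hPL) (ξ := ξ')
      (fun c hc => hinj c ?_) (fun j => ?_) (fun j => ?_) (fun c hc => ?_) (fun j => ?_)
    · rw [hC, hW.push_frameSum he hχ c h0] at hc
      have := he.mfderiv_symm_pushField
        (fun q => (frameSum X c q : TangentSpace (𝓡 (2 * n + k)) q)) h0t
      apply Subtype.ext
      rw [← this]
      change mfderiv _ _ _ _ (S.push e (frameSum X c) 0) = _
      rw [hc]
      exact map_zero _
    · rw [hXe, push, hξ']
      exact hξ _ (X j _).2
    · rw [hYe, push, hξ']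
      exact hξ _ (S.JSec (X j) _).2
    · have h1 : C.combX c =ᶠ[𝓝 0] S.push e (frameSum X c) := by
        filter_upwards [Metric.ball_mem_nhds 0 χ.rIn_pos] with x hx
        exact hW.push_frameSum he hχ c hx
      have h2 : C.combY c =ᶠ[𝓝 0] S.push e (S.JSec (frameSum X c)) := by
        filter_upwards [Metric.ball_mem_nhds 0 χ.rIn_pos] with x hx
        exact hW.push_J_frameSum he hχ c hx
      have hJsm : SmoothSectionOn S.H (S.JSec (frameSum X c)) W := S.smooth_J W hW.isOpen _ (hsm c)
      rw [(h2.lieBracket_vectorField h1).eq_of_nhds, push, push,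
        he.lieBracket_pushField hW.isOpen hJsm (hsm c) h0t h0W, hξ']
      exact hL _ (fun h => hc (hinj c h)) W hW.isOpen h0W _ (hsm c) rfl
    · rw [hXe, hYe]
      exact hθ j
  obtain ⟨h, hh, hD, hd⟩ := hsol
  refine ⟨h, hh, ?_, hd⟩
  filter_upwards [hD, Metric.ball_mem_nhds 0 χ.rIn_pos] with x hx hxb l
  rw [← hW.flatFrame_D_eq_dbar he hχ l hxb (hh.differentiable (by simp) x)]
  exact hx l

end IsDualFrame

end CRStructure

/-- There are `dim E - n` independent complex covectors annihilating `n` complex vectors. -/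
theorem exists_linearIndependent_annihilating {E : Type} [NormedAddCommGroup E] [NormedSpace ℝ E]
    [FiniteDimensional ℝ E] {n m : ℕ} (hE : n + m ≤ Module.finrank ℝ E) (v w : Fin n → E) :
    ∃ θ : Fin m → E →L[ℝ] ℂ, LinearIndependent ℂ θ ∧
      ∀ i j, θ i (v j) + Complex.I * θ i (w j) = 0 := by
  let T : (E →ₗ[ℝ] ℂ) →ₗ[ℂ] (Fin n → ℂ) :=
    { toFun := fun θ j => θ (v j) + Complex.I * θ (w j)
      map_add' := fun θ θ' => by ext j; simp; ring
      map_smul' := fun c θ => by ext j; simp; ring }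
  have h1 := T.finrank_range_add_finrank_ker
  rw [Module.finrank_linearMap ℝ ℂ E ℂ, Module.finrank_self, mul_one] at h1
  have h2 : Module.finrank ℂ (LinearMap.range T) ≤ n := by
    simpa using Submodule.finrank_le (LinearMap.range T)
  obtain ⟨f, hf⟩ := exists_linearIndependent_of_le_finrank
    (R := ℂ) (M := LinearMap.ker T) (n := m) (by omega)
  refine ⟨fun i => LinearMap.toContinuousLinearMap (f i : E →ₗ[ℝ] ℂ), ?_, fun i j =>
    congrFun (f i).2 j⟩
  have hf' := hf.map' (LinearMap.ker T).subtype (Submodule.ker_subtype _)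
  rw [Fintype.linearIndependent_iff] at hf' ⊢
  intro g hg
  refine hf' g (LinearMap.ext fun x => ?_)
  have := DFunLike.congr_fun hg x
  simpa [sum_apply, LinearMap.sum_apply] using this

/-! ### Independent CR functions near the point -/

namespace CRStructure

variable {n k : ℕ} {M : Type*} [TopologicalSpace M]
  [ChartedSpace (EuclideanSpace ℝ (Fin (2 * n + k))) M] [IsManifold (𝓡 (2 * n + k)) ∞ M]
  {S : CRStructure n k M} {e : OpenPartialHomeomorph M (EuclideanSpace ℝ (Fin (2 * n + k)))}
  {X : Fin n → ∀ q, S.H q} {ζ : Fin n → EuclideanSpace ℝ (Fin (2 * n + k)) →L[ℝ] ℂ} {W : Set M}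

theorem linearIndependent_complexDiff_comp (he : IsSmoothChart e) {m : ℕ}
    {h : Fin m → EuclideanSpace ℝ (Fin (2 * n + k)) → ℂ} {q : M} (hq : q ∈ e.source)
    (hh : ∀ j, DifferentiableAt ℝ (h j) (e q))
    (hli : LinearIndependent ℂ fun j => fderiv ℝ (h j) (e q)) :
    LinearIndependent ℂ
      (fun j => (complexDiff (h j ∘ e) q : TangentSpace (𝓡 (2 * n + k)) q →L[ℝ] ℂ)) := by
  let A : EuclideanSpace ℝ (Fin (2 * n + k)) →L[ℝ] EuclideanSpace ℝ (Fin (2 * n + k)) :=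
    mfderiv (𝓡 (2 * n + k)) (𝓡 (2 * n + k)) e q
  let B : EuclideanSpace ℝ (Fin (2 * n + k)) →L[ℝ] EuclideanSpace ℝ (Fin (2 * n + k)) :=
    mfderiv (𝓡 (2 * n + k)) (𝓡 (2 * n + k)) e.symm (e q)
  have hA : ∀ y, A (B y) = y := fun y => by
    have := DFunLike.congr_fun (he.mdifferentiable.comp_symm_deriv (e.map_source hq)) y
    rwa [e.left_inv hq] at this
  have hcomp : ∀ j, complexDiff (h j ∘ e) q = (fderiv ℝ (h j) (e q)).comp A := fun j =>
    ContinuousLinearMap.ext (he.complexDiff_comp hq rfl (hh j))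
  have key : LinearIndependent ℂ fun j => (fderiv ℝ (h j) (e q)).comp A := by
    rw [Fintype.linearIndependent_iff] at hli ⊢
    intro g hg
    refine hli g (ContinuousLinearMap.ext fun y => ?_)
    have h1 := DFunLike.congr_fun hg (B y)
    simpa [sum_apply, hA] using h1
  simp only [hcomp]
  exact key

theorem IsDualFrame.locallyCREmbeddableAt (hW : S.IsDualFrame e X ζ W) (he : IsSmoothChart e)
    (h0t : (0 : EuclideanSpace ℝ (Fin (2 * n + k))) ∈ e.target) (h0W : e.symm 0 ∈ W)
    (hPL : S.PoincareLemmaAt (e.symm 0))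
    {ξ : TangentSpace (𝓡 (2 * n + k)) (e.symm 0) →L[ℝ] ℝ}
    (hξ : S.IsCharacteristic (e.symm 0) ξ) (hL : S.LeviPosDef (e.symm 0) ξ) :
    S.LocallyCREmbeddableAt (e.symm 0) := by
  obtain ⟨χ, hχ⟩ := exists_contDiffBump_subset (eventually_mem e hW.isOpen h0t h0W)
  -- The n conditions leave room for n + k covectors, as n + (n + k) is the dimension of the space.
  obtain ⟨θ, hθ, hθX⟩ := exists_linearIndependent_annihilating (n := n) (m := n + k)
    (E := EuclideanSpace ℝ (Fin (2 * n + k))) (by simp; omega)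
    (fun j => S.push e (X j) 0) fun j => S.push e (S.JSec (X j)) 0
  choose h hh hD hd using fun i =>
    hW.exists_solution he (fun x hx => hχ hx) hPL hξ hL (hθX i)
  have hcont : Continuous fun x i => fderiv ℝ (h i) x :=
    continuous_pi fun i => (hh i).continuous_fderiv (by simp)
  -- Linear independence is an open condition on the differentials, which vary continuously and
  -- equal the θ i at 0.
  have hli : ∀ᶠ x in 𝓝 0, LinearIndependent ℂ fun i => fderiv ℝ (h i) x :=
    hcont.continuousAt.eventually_mem ((isOpen_setOfPred_linearIndependent (𝕜 := ℂ)).mem_nhds (by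
      simpa only [mem_ofPred_eq, hd] using hθ))
  obtain ⟨V, hV, hVo, h0V⟩ := eventually_nhds_iff.1 (hli.and (eventually_all.2 hD))
  refine ⟨W ∩ (e.source ∩ e ⁻¹' V), hW.isOpen.inter (e.isOpen_inter_preimage hVo),
    ⟨h0W, e.map_target h0t, by simpa [h0t] using h0V⟩, fun i => h i ∘ e, fun i => ⟨?_, ?_⟩, ?_⟩
  · exact (hh i).contMDiff.comp_contMDiffOn (he.contMDiffOn.mono fun q hq => hq.2.1)
  · intro q hq
    refine hW.antilinear_ext hq.1 (S.dbar_J _ q) (by simp) fun l => ?_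
    have := (hV _ hq.2.2).2 i l
    rwa [e.left_inv hq.2.1] at this
  · intro q hq
    exact linearIndependent_complexDiff_comp he hq.2.1
      (fun j => (hh j).differentiable (by simp) _) (hV _ hq.2.2).1

end CRStructure

theorem theorem2 (n k : ℕ) (hn : 1 ≤ n) (hk : 1 ≤ k)
    {M : Type*} [TopologicalSpace M] [T2Space M] [SecondCountableTopology M]
    [ChartedSpace (EuclideanSpace ℝ (Fin (2 * n + k))) M]
    [IsManifold (𝓡 (2 * n + k)) ∞ M]
    (S : CRStructure n k M) (p : M)
    (hLevi : ∃ ξ : TangentSpace (𝓡 (2 * n + k)) p →L[ℝ] ℝ,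
      ξ ≠ 0 ∧ S.IsCharacteristic p ξ ∧ S.LeviPosDef p ξ)
    (hPoincare : S.PoincareLemmaAt p) :
    S.LocallyCREmbeddableAt p := by
  obtain ⟨ξ, -, hξ, hL⟩ := hLevi
  obtain ⟨e, he, hp, hp0⟩ := exists_smoothChart (d := 2 * n + k) p
  obtain ⟨X, ζ, W, hW, hpW⟩ := S.exists_isDualFrame he hp
  have h0 : (0 : EuclideanSpace ℝ (Fin (2 * n + k))) ∈ e.target := hp0 ▸ e.map_source hp
  obtain rfl : p = e.symm 0 := by rw [← hp0, e.left_inv hp]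
  exact hW.locallyCREmbeddableAt he h0 hpW hPoincare hξ hL
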